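/- **Notation.** For $k\ge 2$ and $0<q<1$ let $S_k(q)=\sum_{m\ge1}\frac{1}{m^k}\frac{q^m}{1-q^m}$, and for rational $s>0$ let $q_s=e^{-\pi\sqrt s}$. A series has *merit* $a$ if the ratio of successive terms tends to $e^{-\pi\sqrt a}$; $S_k(q_s^d)$ converges and has merit $d^2s$. Write $X=2^k+1$, $Y=3^k+1$. **(1) Explicit evaluations.** Discriminant $-3$: $\zeta(3)=\frac{133\sqrt3}{5940}\pi^3-\frac6{11}S_3(q_{1/3}^4)-\frac{18}{11}S_3(q_3^2)+\frac2{11}S_3(q_3^4)$; $\zeta(5)=\frac{17\sqrt3}{8694}\pi^5+\frac{18}{23}S_5(q_{1/3}^4)-\frac{66}{23}S_5(q_3^2)+\frac2{23}S_5(q_3^4)$; $\zeta(7)=\frac{10309\sqrt3}{53468100}\pi^7-\frac{2322}{6601}S_7(q_{1/3}^4)-\frac{10966}{6601}S_7(q_3^2)+\frac{86}{6601}S_7(q_3^4)$. Discriminant $-8$: $\zeta(3)=\frac{181\sqrt2}{6600}\pi^3-\frac{16}{55}S_3(q_{1/2}^3)-\frac45S_3(q_2^2)-\frac{52}{55}S_3(q_2^4)+\frac2{55}S_3(q_2^{12})$;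 $\zeta(5)=\frac{5171\sqrt2}{2158380}\pi^5+\frac{128}{571}S_5(q_{1/2}^3)-\frac{812}{571}S_5(q_2^2)-\frac{460}{571}S_5(q_2^4)+\frac2{571}S_5(q_2^{12})$. Discriminant $-20$: $\zeta(3)=\frac{13\sqrt5}{750}\pi^3+\frac25S_3(q_5)-\frac14S_3(q_{1/5}^6)-\frac{23}{10}S_3(q_5^2)+\frac1{10}S_3(q_5^4)+\frac1{20}S_3(q_5^6)$; $\zeta(5)=\frac{809\sqrt5}{533925}\pi^5+\frac8{113}S_5(q_5)+\frac{25}{113}S_5(q_{1/5}^6)-\frac{521}{226}S_5(q_5^2)+\frac1{226}S_5(q_5^4)+\frac1{113}S_5(q_5^6)$; $\zeta(3)=\frac{18491\sqrt5}{1066500}\pi^3-\frac{10}{79}S_3(q_{1/5}^6)-\frac2{79}S_3(q_{1/5}^{12})+\frac{18}{395}S_3(q_5^{4/3})+\frac2{395}\left(-384S_3(q_5^2)+4S_3(q_5^3)+5S_3(q_5^6)+S_3(q_5^{12})\right)$. Discriminant $-11$: $\zeta(3)=\frac{623}{4860\sqrt{11}}\pi^3+\frac{22}{45}S_3(q_{1/11}^{12})+\frac2{45}\sum_d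 f_dS_3(q_{11}^{d/3})$ with $f_d=81,132,-9,-297,-4,33,9,-1$ for $d=2,3,4,6,9,12,18,36$; $131\zeta(3)=\frac{13\cdot3511}{2700\sqrt{11}}\pi^3-99S_3(q_{1/11}^{20/3})-635\left(4S_3(q_{11})-9S_3(q_{11}^2)+S_3(q_{11}^4)\right)+11\sum_d\alpha_dS_3(q_{1/11}^{5d})+25\sum_d\beta_dS_3(q_{11}^{d/5})+\sum_d\gamma_dS_3(q_{11}^{5d/3})$ with $\alpha_d=-207,-4,23,9,-1$ for $d=2,3,4,6,12$; $\beta_d=-23,-9,1$ for $d=4,6,12$; $\gamma_d=36,-81,-92,9,207,4,-23,-9,1$ for $d=1,2,3,4,6,9,12,18,36$. Discriminant $-35$: $\zeta(3)=\frac{2969}{12960\sqrt{35}}\pi^3+\frac{35}{24}S_3(q_{1/35}^{12})-\frac7{24}S_3(q_{5/7}^4)-\frac{15}8S_3(q_{7/5}^2)+\frac5{24}S_3(q_{7/5}^4)+\frac1{24}\sum_dg_dS_3(q_{35}^{d/3})$ with $g_d=81,112,-9,-252,-4,28,9,-1$ for $d=2,3,4,6,9,12,18,36$; $\zeta(3)=\frac{4573}{19920\sqrt{35}}\pi^3-\frac{315}{166}S_3(q_{7/5}^2)+\frac1{664}\left(4S_3(q_{35})-9S_3(q_{35}^2)+S_3(q_{35}^4)\right)+\frac1{664}(-4F_3+28F_4+9F_6-F_{12})$,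 $F_d=5S_3(q_{7/5}^d)-7S_3(q_{5/7}^d)$. Discriminant $-7$: $73\zeta(3)=\frac{15}{2\sqrt7}\pi^3-175S_3(q_{1/7}^6)+21S_3(q_{1/7}^{12})-27S_3(q_7^{4/3})+\sum_d\tilde a_dS_3(q_7^d)$ with $\tilde a_d=-12,40,-12,-3,25,-3$ for $d=1,2,3,4,6,12$. Discriminant $-23$: $\zeta(3)=\frac{93}{500\sqrt{23}}\pi^3-\frac{23}{25}S_3(q_{1/23}^{12})+\frac1{25}\sum_dh_dS_3(q_{23}^{d/3})$ with $h_d=-72,-60,9,114,4,-15,-8,1$ for $d=2,3,4,6,9,12,18,36$. Discriminant $-4$: $\frac{2639795}{74}\zeta(5)=\frac{12075457}{99900}\pi^5+5^4S_5(q_1^{12/5})-\frac{3050976}{37}S_5(q_1^4)+2^5\,389\,S_5(q_1^6)+\sum_d\tilde C_dS_5(q_1^{5d/3})$ with $\tilde C_d=-3^4 37,3^4,2^4 61,2^4,-37,1$ for $d=2,4,6,9,18,36$. Discriminant $-3$, $\zeta(7)$: $970\zeta(7)=\frac{3029\sqrt3}{16200}\pi^7-\frac{29\cdot449}7S_7(q_3^2)+\frac{43}{2^7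 7}\sum_dG_dS_7(q_{1/3}^{5d})$ with $G_d=12^3,-3^3 129,-64,27,129,-1$ for $d=1,2,3,4,6,12$; $44071\zeta(7)=\frac{5734\sqrt3}{675}\pi^7+\frac1{2^7}\sum_dH_dS_7(q_{1/3}^d)$ with $H_d=443\cdot12^3,\ 10545024,\ -1542969,\ -21254814,\ -28352,\ 11961,\ 164766,\ 57147,\ -443$ for $d=7,9,14,18,21,28,36,42,84$. **(2) Denominator sequences.** Let - $s_n=\frac13\left((2^{6n+2}-1)2^{6n}-(2^{6n+1}+1)(-3)^{3n}\right)$; - $t_n=3^{2n+1}-(-2)^{3n}-(2^{2n+2}+(-2)^{n+1})\Re(1+\sqrt{-2})^{2n}$; - $\sigma=-2+\sqrt{-5}$, $u_n=\frac12(3^{2n+1}-(-5)^n)-\Re(2\sigma)^n$, $\tilde u_n=2^{n-1}\left(3^{4n+2}-3^{2n+1}(-5)^n+3^{2n}-(-5)^n\right)-\Re\left(\sigma^n(2^{2n+1}(-5)^n-3^{2n}+2^{2n}+(2\sigma)^n)\right)$; - $v_n=\frac1{45}\left(36^n+(-11)^n-2\Re(1+\sqrt{-11})^{2n}\right)$;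 - with $k=2n+1$, $\mu=\frac12(1+\sqrt{-11})$, $b_n=2\Re\mu^{2n}$, $c_n=2\Re(1+\mu)^{2n}$, $g_n=3^k+b_n+1$: $\tilde v_n=(2g_n-1)44^n+99^n-(g_n+2^k)(-25)^n+2^k(-9)^n+b_n(c_n-5^k)(-4)^n$; - $\omega=\frac12(1+\sqrt{-35})$, $w_n=\frac13\left(36^n+(-35)^n-2\Re(2^{2n+1}(-5\omega)^n-(7\omega)^n)\right)$, $\tilde w_n=\frac14\left(6(180)^n+20^n-(3^{2n+1}+2^{2n}+1)(-7)^n\right)-\frac12\Re(-4\omega)^n$; - $x_n=\Im\frac{\alpha(\alpha+2\beta-2^{2n+1}\gamma_++\gamma_-)-\beta\gamma_+}{2^{2n+2}\sqrt{23}}$ with $\alpha=(1+\sqrt{-23})^{2n}$, $\beta=(5-\sqrt{-23})^{2n}$, $\gamma_\pm=36^n\pm(-23)^n$; - with $k=4n+1$: $\tilde c_n=4^n(15^k-10^k-5^{4n}-2^{4n})-4(-12^4)^n+7(-10^4)^n+(-5^4)^n-2(-4^4)^n-(2^k-1)18^{2n}-(2^k-(-4)^n+1)\left((6+8i)^{2n}+(6-8i)^{2n}\right)$;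 - $y_n=\frac1{84}\left(5^{6n+1}-2^{6n+1}-(2^{6n+1}+1)(-3)^{3n}\right)$; - $z_n=\frac1{20}\left(7^{6n+1}-3^{6n}(2-(-3)^{3n+1})-2\Re(2+\sqrt{-3})^{6n}\right)$. All are integers for every $n\ge0$, and for $n=1,2,\dots$ they begin $s$: 6601, 20377357, 95065741729; $t$: 55, 571, −3557, −1277, 1212475, −4016045, −82965653; $u$: 20, 113, 980, 10793, 86360, 774053, 7471820, 62858993; $\tilde u$: 790, 107111, 20593510, 3025683569, 511718343910; $v$: 1, 29, 993, 38293, 1329305, 48535917, 1740077137; $\tilde v$: 262, 449966, 461557057, 195425426366; $w$: 16, 5096, −140379, −12384944, 774803876, 34673015481; $\tilde w$: 332, 45583, 8942693, 1562702887, 284184726617; $x$: 25, 85132, −50570780, 66436773424, −39027031565300; $\tilde c$: 2639795, 598022567345, 123944841925119215; $y$: 970, 14460979, 227188159336, 3547683233832985; $z$: 44071, 4786291978, 571088556271897. The sequences $s,\tilde u,\tilde v,\tilde c$ obey linear recurrences with constant integer coefficients of orders $4,12,17,16$; $s_0=\tilde c_0=0$, $7\mid s_n$ and $5\mid\tilde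 c_n$. **(3) Infinite families.** For every admissible $n$ and each family below there is a rational $r$ with $$V_n\,\zeta(k)=r\sqrt D\,\pi^k+\sum_{(s,d)} c_{s,d}(n)\,S_k(q_s^d),$$ where $2V_n$ is a nonzero integer, every $c_{s,d}(n)$ is a rational whose denominator is a power of $2$, and the least merit $d^2s$ of the Lambert series occurring with nonzero coefficient is exactly the stated $a>4$. Admissible means $n\ge1$, except in (i) where it means $3\nmid n$. Coefficients are listed as "$(s,d)$: coefficient". (i) $k=2n+1$, $3\nmid n$, $D=3$, $a=\frac{16}3$, $V_n=2^{2n+1}-(-3)^n$. $(\frac13,4)$: $2(-3)^n$; $(3,2)$: $-2X$; $(3,4)$: $2$. The final coefficient $2/V_n$ in the evaluation of $\zeta(k)$ has denominator exactly $V_n$ in lowest terms. (ii) $k=6n+1$, $D=3$, $a=\frac{16}3$, $V_n=s_n$. $(\frac13,4)$: $\frac23X(-27)^n$; $(3,2)$: $-\frac23(4\cdot64^{2n}+64^n+1)$; $(3,4)$: $\frac23X$. (iii) $k=2n+1$, $D=2$, $a=\frac92$, $V_n=t_n$; $\tau=\Re(1+\sqrt{-2})^{2n}$. $(\frac12,3)$: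 $2(-8)^n$; $(2,2)$: $4\tau(X-(-2)^n)$; $(2,4)$: $-2(Y+2\tau)$; $(2,12)$: $2$. (iv) $k=2n+1$, $D=5$, $a=5$, $V_n=u_n$; $S=2\Re\sigma^n$. $(5,1)$: $-2^nS$; $(\frac15,6)$: $(-5)^n$; $(5,2)$: $2^{-n}XS-Y$; $(5,4)$: $-2^{-n}S$; $(5,6)$: $1$. (v) $k=2n+1$, $D=5$, $a=\frac{36}5$, $V_n=\tilde u_n$; $S=2\Re\sigma^n$, $Z=2^nY+XS$. $(\frac15,6)$: $(-5)^nZ$; $(\frac15,12)$: $-(-5)^nS$; $(5,\frac43)$: $-9^nS$; $(5,2)$: $-2^n(Y^2-S^2)$; $(5,3)$: $-4^nS$; $(5,6)$: $Z$; $(5,12)$: $-S$. (vi) $k=2n+1$, $D=11$, $a=\frac{44}9$, $V_n=\frac{45}2v_n$. $(\frac1{11},12)$: $-(-11)^n$; $(11,\frac d3)$ for $d=2,3,4,6,9,12,18,36$: $9^nX$, $4^n(Y-b_n)$, $-9^n$, $-X(Y-b_n)$, $-4^n$, $Y-b_n$, $X$, $-1$. (vii) $k=2n+1$, $D=11$,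 $a=\frac{400}{99}$, $V_n=\tilde v_n$; each coefficient below is to be multiplied by $-2(-1)^n$, and $f_n=b_n(5^k+1-c_n)$. $(\frac1{11},\frac{20}3)$: $(-99)^n$; $(11,d)$ for $d=1,2,4$: $f_n$ times $4^n,-X,1$; $(\frac1{11},5d)$ for $d=2,3,4,6,12$: $(-11)^n$ times $Xg_n,4^n,-g_n,-X,1$; $(11,\frac d5)$ for $d=4,6,12$: $25^n$ times $-g_n,-X,1$; $(11,\frac{5d}3)$ for $d=1,2,3,4,6,9,12,18,36$: $36^n,-9^nX,-4^ng_n,9^n,Xg_n,4^n,-g_n,-X,1$. (viii) $k=2n+1$, $D=35$, $a=\frac{144}{35}$, $V_n=\frac32w_n$; $W=2\Re\omega^n$. $(\frac1{35},12)$: $-(-35)^n$; $(\frac57,4)$: $-7^nW$; $(\frac75,2)$: $(-5)^nXW$; $(\frac75,4)$: $-(-5)^nW$; $(35,\frac d3)$ for $d=2,3,4,6,9,12,18,36$: $9^nX,4^nY,-9^n,-XY,-4^n,Y,X,-1$. (ix) $k=2n+1$, $D=35$, $a=\frac{28}5$, $V_n=2\tilde w_n$; $W=2\Re\omega^n$.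 $(\frac75,2)$: $-5^nXY$; $(35,d)$ for $d=1,2,4$: $(-1)^nW$ times $-4^n,X,-1$; $(\frac75,d)$ for $d=3,4,6,12$: $5^n$ times $-4^n,Y,X,-1$; $(\frac57,d)$ for $d=3,4,6,12$: $(-7)^n$ times $-4^n,Y,X,-1$. (x) $k=2n+1$, $D=7$, $a=\frac{36}7$; $V=X+2\Re\left(\frac{1+\sqrt{-7}}2\right)^{2n}$, $Z=XV-4^n$, $V_n=\frac12\left(V(9^n+4^n)+4^n(1-2V)(1+(-7)^n)\right)+16^nY$. $(\frac17,6)$: $(-7)^nZ$; $(\frac17,12)$: $-(-7)^nV$; $(7,\frac43)$: $-9^nV$; $(7,d)$ for $d=1,2,3,4,6,12$: $4^nXY$, $-(X^2-4^n)Y$, $-4^nV$, $XY$, $Z$, $-V$. (xi) $k=2n+1$, $D=23$, $a=\frac{144}{23}$, $V_n=x_n$. With $\delta(z)=2\,\Im z/\sqrt{23}$ put $\kappa=\frac{\delta(\beta)+X\delta(\alpha)}{4^{n+1}}$, $\lambda=-X\kappa+\frac14\delta(\alpha)$, $\rho=-Y\kappa+\frac{1}{4^{n+1}}\left(\frac{X\delta(\alpha\beta)}{16^n}+\frac{\delta(\alpha^2)}{4^n}\right)$,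 $\theta=\frac1{4^{n+1}}\left(XY\delta(\beta)-(X^2-4^n)\frac{\delta(\alpha\beta)}{16^n}-\frac{X\delta(\alpha^2)}{4^n}+(X^2-4^n)Y\delta(\alpha)\right)$. $(\frac1{23},12)$: $(-23)^n\kappa$; $(23,\frac d3)$ for $d=2,3,4,6,9,12,18,36$: $9^n\lambda,4^n\rho,9^n\kappa,\theta,4^n\kappa,\rho,\lambda,\kappa$. (xii) $k=4n+1$, $D=1$, $a=\frac{144}{25}$, $V_n=\frac12\tilde c_n$; $\lambda=4^n-(-1)^nX$. $(1,\frac{12}5)$: $5^{4n}\lambda$; $(1,4)$: $-4^nY(5^k+1)$; $(1,6)$: $-(-4)^n\lambda\left(5^k+1+2\Re(3+4i)^{2n}\right)$; $(1,\frac{5d}3)$ for $d=2,4,6,9,18,36$: $\lambda$ times $-81^n(X-(-4)^n)$, $81^n$, $-(-4)^nY$, $16^n$, $-(X-(-4)^n)$, $1$. (xiii) $k=6n+1$, $D=3$, $a=\frac{25}3$, $V_n=42y_n$. $(3,2)$: $-(5^k+1)$; $(\frac13,5d)$ for $d=1,2,3,4,6,12$: $64^{-n}X$ times $-(-27)^n64^n$,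 $(-27)^nX$, $-64^n$, $-(-27)^n$, $X$, $-1$. (xiv) $k=6n+1$, $D=3$, $a=\frac{49}3$, $V_n=10z_n$; $\kappa=3^k+1-(-27)^n$, $m=7^k+1-2\Re(2+\sqrt{-3})^{6n}$. For $d_2=7,9,21$ let $e=-(-27)^n\kappa,\ m,\ -\kappa$ respectively; then $(\frac13,d_2)$: $e$; $(\frac13,2d_2)$: $-64^{-n}Xe$; $(\frac13,4d_2)$: $64^{-n}e$. -/

import Mathlib

/-! Lambert series at complex-multiplication points, their merit, and the closed forms of the
denominator sequences and of the rational coefficients of the evaluations of odd zeta values. -/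

noncomputable section

namespace ZetaLambert

/-! ### Lambert series, merit, evaluations -/

/-- `q_s = exp (-π √s)`. -/
def nome (s : ℝ) : ℝ := Real.exp (-Real.pi * Real.sqrt s)

/-- The `n`-th term (`n ≥ 1`) of the Lambert series `S_k(q)`. -/
def lambertSummand (k : ℕ) (q : ℝ) (n : ℕ) : ℝ := 1 / (n : ℝ) ^ k * (q ^ n / (1 - q ^ n))

/-- The Lambert series `S_k(q) = ∑_{n ≥ 1} n⁻ᵏ qⁿ / (1 - qⁿ)`. -/
def lambertS (k : ℕ) (q : ℝ) : ℝ := ∑' n : ℕ, lambertSummand k q (n + 1)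

/-- A sequence of terms has merit `a` if the ratio of successive terms tends to `exp (-π √a)`. -/
def HasMerit (u : ℕ → ℝ) (a : ℝ) : Prop :=
  Filter.Tendsto (fun n => u (n + 1) / u n) Filter.atTop
    (nhds (Real.exp (-Real.pi * Real.sqrt a)))

/-- A summand `c · S_k(q_s ^ d)` with rational `s` and `d`. -/
structure LambertTerm where
  s : ℚ
  d : ℚ
  c : ℝ

/-- The argument `q_s ^ d` of the Lambert series. -/
def LambertTerm.arg (t : LambertTerm) : ℝ := nome (t.s : ℝ) ^ (t.d : ℝ)

/-- The number `d² s`. -/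
def LambertTerm.merit (t : LambertTerm) : ℚ := t.d ^ 2 * t.s

/-- `∑ c · S_k(q_s ^ d)` over a list of terms. -/
def lambertSum (k : ℕ) (T : List LambertTerm) : ℝ :=
  (T.map fun t => t.c * lambertS k t.arg).sum

/-- The terms `(c · x) · S_k(q_s ^ (r · d))` for `(d, x)` in the list. -/
def block (s r : ℚ) (c : ℝ) (L : List (ℚ × ℝ)) : List LambertTerm :=
  L.map fun p => ⟨s, r * p.1, c * p.2⟩

/-- `v · ζ(k) = p + ∑ c · S_k(q_s ^ d)`. -/
def Evaluates (k : ℕ) (v p : ℝ) (T : List LambertTerm) : Prop :=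
  (v : ℂ) * riemannZeta (k : ℂ) = ((p + lambertSum k T : ℝ) : ℂ)

/-- For every `n ∈ I`, with `k = k(n)`:
* `v n · ζ(k) = r √D πᵏ + ∑ c · S_k(q_s ^ d)` over the terms of `T n`, with `r` rational;
* `v n` is a nonzero integer or half-integer, and each coefficient `c` is a rational number whose
  denominator is a power of two (so that `v n` accounts for the odd part of the denominators of
  the coefficients in the evaluation of `ζ(k)`);
* every Lambert series in `T n` converges with merit `d² s`, and the least merit of those that
  occur with a nonzero coefficient is `a`, where `a > 4`. -/
structure IsFamily (I : Set ℕ) (k : ℕ → ℕ) (D : ℕ) (a : ℚ) (v : ℕ → ℝ)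
    (T : ℕ → List LambertTerm) : Prop where
  evaluates : ∀ n ∈ I, ∃ r : ℚ,
    Evaluates (k n) (v n) ((r : ℝ) * Real.sqrt D * Real.pi ^ k n) (T n)
  denominator : ∀ n ∈ I, ∃ z : ℤ, z ≠ 0 ∧ 2 * v n = z
  coefficient : ∀ n ∈ I, ∀ t ∈ T n, ∃ (j : ℕ) (z : ℤ), 2 ^ j * t.c = z
  hasMerit : ∀ n ∈ I, ∀ t ∈ T n,
    Summable (fun m => lambertSummand (k n) t.arg (m + 1)) ∧
      HasMerit (lambertSummand (k n) t.arg) (t.merit : ℝ)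
  least : ∀ n ∈ I, IsLeast {x : ℚ | ∃ t ∈ T n, t.c ≠ 0 ∧ t.merit = x} a
  four_lt : 4 < a

/-- `f` is integer-valued and its values at `1, 2, 3, …` begin with the given list. -/
def IsIntegerSequence (f : ℕ → ℝ) (l : List ℤ) : Prop :=
  (∀ n, ∃ z : ℤ, f n = z) ∧ ∀ (i : ℕ) (h : i < l.length), f (i + 1) = (l[i] : ℝ)

/-- `f` obeys a linear recurrence of order `m` with constant integer coefficients. -/
def ObeysRecurrence (f : ℕ → ℝ) (m : ℕ) : Prop :=
  ∃ c : Fin m → ℤ, ∀ n, f (n + m) = ∑ i : Fin m, (c i : ℝ) * f (n + i)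

/-! ### The denominator sequences -/

/-- `√(-D)`. -/
def sqrtNeg (D : ℕ) : ℂ := (Real.sqrt D : ℂ) * Complex.I

def sSeq (n : ℕ) : ℝ :=
  1 / 3 * ((2 ^ (6 * n + 2) - 1) * 2 ^ (6 * n) - (2 ^ (6 * n + 1) + 1) * (-3) ^ (3 * n))

def tSeq (n : ℕ) : ℝ :=
  3 ^ (2 * n + 1) - (-2) ^ (3 * n)
    - (2 ^ (2 * n + 2) + (-2) ^ (n + 1)) * ((1 + sqrtNeg 2) ^ (2 * n)).re

/-- `σ = -2 + √-5`. -/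
def sigma : ℂ := -2 + sqrtNeg 5

def uSeq (n : ℕ) : ℝ :=
  1 / 2 * (3 ^ (2 * n + 1) - (-5) ^ n) - ((2 * sigma) ^ n).re

def uTildeSeq (n : ℕ) : ℝ :=
  2 ^ n / 2 * (3 ^ (4 * n + 2) - 3 ^ (2 * n + 1) * (-5) ^ n + 3 ^ (2 * n) - (-5) ^ n)
    - (sigma ^ n * (2 ^ (2 * n + 1) * (-5) ^ n - 3 ^ (2 * n) + 2 ^ (2 * n) + (2 * sigma) ^ n)).re

def vSeq (n : ℕ) : ℝ :=
  1 / 45 * (36 ^ n + (-11) ^ n - 2 * ((1 + sqrtNeg 11) ^ (2 * n)).re)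

/-- `μ = (1 + √-11) / 2`. -/
def mu : ℂ := (1 + sqrtNeg 11) / 2

/-- `b_n = 2 Re (μ²ⁿ)`. -/
def bEleven (n : ℕ) : ℝ := 2 * (mu ^ (2 * n)).re

/-- `c_n = 2 Re ((1 + μ)²ⁿ)`. -/
def cEleven (n : ℕ) : ℝ := 2 * ((1 + mu) ^ (2 * n)).re

/-- `g_n = 3²ⁿ⁺¹ + b_n + 1`. -/
def gEleven (n : ℕ) : ℝ := 3 ^ (2 * n + 1) + bEleven n + 1

def vTildeSeq (n : ℕ) : ℝ :=
  (2 * gEleven n - 1) * 44 ^ n + 99 ^ n - (gEleven n + 2 ^ (2 * n + 1)) * (-25) ^ n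
    + 2 ^ (2 * n + 1) * (-9) ^ n + bEleven n * (cEleven n - 5 ^ (2 * n + 1)) * (-4) ^ n

/-- `ω = (1 + √-35) / 2`. -/
def omega : ℂ := (1 + sqrtNeg 35) / 2

def wSeq (n : ℕ) : ℝ :=
  1 / 3 * (36 ^ n + (-35) ^ n
    - 2 * (2 ^ (2 * n + 1) * (-5 * omega) ^ n - (7 * omega) ^ n).re)

def wTildeSeq (n : ℕ) : ℝ :=
  1 / 4 * (6 * 180 ^ n + 20 ^ n - (3 ^ (2 * n + 1) + 2 ^ (2 * n) + 1) * (-7) ^ n)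
    - 1 / 2 * ((-4 * omega) ^ n).re

def alpha (n : ℕ) : ℂ := (1 + sqrtNeg 23) ^ (2 * n)

def beta (n : ℕ) : ℂ := (5 - sqrtNeg 23) ^ (2 * n)

def gammaPlus (n : ℕ) : ℂ := 36 ^ n + (-23) ^ n

def gammaMinus (n : ℕ) : ℂ := 36 ^ n - (-23) ^ n

def xSeq (n : ℕ) : ℝ :=
  ((alpha n * (alpha n + 2 * beta n - 2 ^ (2 * n + 1) * gammaPlus n + gammaMinus n)
    - beta n * gammaPlus n) / (2 ^ (2 * n + 2) * (Real.sqrt 23 : ℂ))).im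

def cTildeSeq (n : ℕ) : ℝ :=
  4 ^ n * (15 ^ (4 * n + 1) - 10 ^ (4 * n + 1) - 5 ^ (4 * n) - 2 ^ (4 * n))
    - 4 * (-12 ^ 4) ^ n + 7 * (-10 ^ 4) ^ n + (-5 ^ 4) ^ n - 2 * (-4 ^ 4) ^ n
    - (2 ^ (4 * n + 1) - 1) * 18 ^ (2 * n)
    - (2 ^ (4 * n + 1) - (-4) ^ n + 1)
      * ((6 + 8 * Complex.I) ^ (2 * n) + (6 - 8 * Complex.I) ^ (2 * n)).re

def ySeq (n : ℕ) : ℝ :=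
  1 / 84 * (5 ^ (6 * n + 1) - 2 ^ (6 * n + 1) - (2 ^ (6 * n + 1) + 1) * (-3) ^ (3 * n))

def zSeq (n : ℕ) : ℝ :=
  1 / 20 * (7 ^ (6 * n + 1) - 3 ^ (6 * n) * (2 - (-3) ^ (3 * n + 1))
    - 2 * ((2 + sqrtNeg 3) ^ (6 * n)).re)

/-! ### The general members of the families -/

/-- `X = 2ᵏ + 1`. -/
def X (k : ℕ) : ℝ := 2 ^ k + 1

/-- `Y = 3ᵏ + 1`. -/
def Y (k : ℕ) : ℝ := 3 ^ k + 1

/-- Discriminant `-3`, `k = 2n+1`, `3 ∤ n`. -/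
def famH (n : ℕ) : List LambertTerm :=
  [⟨1/3, 4, 2 * (-3) ^ n⟩, ⟨3, 2, -2 * X (2 * n + 1)⟩, ⟨3, 4, 2⟩]

/-- Discriminant `-3`, `k = 6n+1`. -/
def famHSix (n : ℕ) : List LambertTerm :=
  [⟨1/3, 4, 2 / 3 * X (6 * n + 1) * (-27) ^ n⟩,
   ⟨3, 2, -2 / 3 * (4 * 64 ^ (2 * n) + 64 ^ n + 1)⟩,
   ⟨3, 4, 2 / 3 * X (6 * n + 1)⟩]

/-- `Re ((1 + √-2)²ⁿ)`. -/
def tauTwo (n : ℕ) : ℝ := ((1 + sqrtNeg 2) ^ (2 * n)).re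

/-- Discriminant `-8`, `k = 2n+1`. -/
def famG (n : ℕ) : List LambertTerm :=
  [⟨1/2, 3, 2 * (-8) ^ n⟩,
   ⟨2, 2, 4 * tauTwo n * (X (2 * n + 1) - (-2) ^ n)⟩,
   ⟨2, 4, -2 * (Y (2 * n + 1) + 2 * tauTwo n)⟩,
   ⟨2, 12, 2⟩]

/-- `2 Re (σⁿ)`. -/
def trSigma (n : ℕ) : ℝ := 2 * (sigma ^ n).re

/-- Discriminant `-20`, `k = 2n+1`, merit `5`. -/
def famI (n : ℕ) : List LambertTerm :=
  [⟨5, 1, -2 ^ n * trSigma n⟩,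
   ⟨1/5, 6, (-5) ^ n⟩,
   ⟨5, 2, X (2 * n + 1) * trSigma n / 2 ^ n - Y (2 * n + 1)⟩,
   ⟨5, 4, -trSigma n / 2 ^ n⟩,
   ⟨5, 6, 1⟩]

/-- `2ⁿ Y + 2 X Re (σⁿ)`. -/
def zI (n : ℕ) : ℝ := 2 ^ n * Y (2 * n + 1) + X (2 * n + 1) * trSigma n

/-- Discriminant `-20`, `k = 2n+1`, merit `36/5`. -/
def famITilde (n : ℕ) : List LambertTerm :=
  [⟨1/5, 6, (-5) ^ n * zI n⟩,
   ⟨1/5, 12, -(-5) ^ n * trSigma n⟩,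
   ⟨5, 4/3, -9 ^ n * trSigma n⟩,
   ⟨5, 2, -2 ^ n * (Y (2 * n + 1) ^ 2 - trSigma n ^ 2)⟩,
   ⟨5, 3, -4 ^ n * trSigma n⟩,
   ⟨5, 6, zI n⟩,
   ⟨5, 12, -trSigma n⟩]

/-- Discriminant `-11`, `k = 2n+1`, merit `44/9`. -/
def famF (n : ℕ) : List LambertTerm :=
  ⟨1/11, 12, -(-11) ^ n⟩ ::
  block 11 (1/3) 1
    [(2, 9 ^ n * X (2 * n + 1)),
     (3, 4 ^ n * (Y (2 * n + 1) - bEleven n)),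
     (4, -9 ^ n),
     (6, -X (2 * n + 1) * (Y (2 * n + 1) - bEleven n)),
     (9, -4 ^ n),
     (12, Y (2 * n + 1) - bEleven n),
     (18, X (2 * n + 1)),
     (36, -1)]

/-- `b_n (5ᵏ + 1 - c_n)`, `k = 2n+1`. -/
def fEleven (n : ℕ) : ℝ := bEleven n * (5 ^ (2 * n + 1) + 1 - cEleven n)

/-- Discriminant `-11`, `k = 2n+1`, merit `400/99`. -/
def famFTilde (n : ℕ) : List LambertTerm :=
  block (1/11) 1 (-2 * (-1) ^ n) [(20/3, (-99) ^ n)]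
  ++ block 11 1 (-2 * (-1) ^ n * fEleven n) [(1, 4 ^ n), (2, -X (2 * n + 1)), (4, 1)]
  ++ block (1/11) 5 (-2 * (-1) ^ n * (-11) ^ n)
      [(2, X (2 * n + 1) * gEleven n), (3, 4 ^ n), (4, -gEleven n), (6, -X (2 * n + 1)), (12, 1)]
  ++ block 11 (1/5) (-2 * (-1) ^ n * 25 ^ n)
      [(4, -gEleven n), (6, -X (2 * n + 1)), (12, 1)]
  ++ block 11 (5/3) (-2 * (-1) ^ n)
      [(1, 36 ^ n), (2, -9 ^ n * X (2 * n + 1)), (3, -4 ^ n * gEleven n), (4, 9 ^ n),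
       (6, X (2 * n + 1) * gEleven n), (9, 4 ^ n), (12, -gEleven n), (18, -X (2 * n + 1)), (36, 1)]

/-- `2 Re (ωⁿ)`. -/
def trOmega (n : ℕ) : ℝ := 2 * (omega ^ n).re

/-- Discriminant `-35`, `k = 2n+1`, merit `144/35`. -/
def famW (n : ℕ) : List LambertTerm :=
  [⟨1/35, 12, -(-35) ^ n⟩,
   ⟨5/7, 4, -7 ^ n * trOmega n⟩,
   ⟨7/5, 2, (-5) ^ n * X (2 * n + 1) * trOmega n⟩,
   ⟨7/5, 4, -(-5) ^ n * trOmega n⟩]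
  ++ block 35 (1/3) 1
    [(2, 9 ^ n * X (2 * n + 1)), (3, 4 ^ n * Y (2 * n + 1)), (4, -9 ^ n),
     (6, -X (2 * n + 1) * Y (2 * n + 1)), (9, -4 ^ n), (12, Y (2 * n + 1)),
     (18, X (2 * n + 1)), (36, -1)]

/-- Discriminant `-35`, `k = 2n+1`, merit `28/5`. -/
def famWTilde (n : ℕ) : List LambertTerm :=
  ⟨7/5, 2, -5 ^ n * X (2 * n + 1) * Y (2 * n + 1)⟩ ::
  (block 35 1 ((-1) ^ n * trOmega n) [(1, -4 ^ n), (2, X (2 * n + 1)), (4, -1)]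
  ++ block (7/5) 1 (5 ^ n) [(3, -4 ^ n), (4, Y (2 * n + 1)), (6, X (2 * n + 1)), (12, -1)]
  ++ block (5/7) 1 ((-7) ^ n) [(3, -4 ^ n), (4, Y (2 * n + 1)), (6, X (2 * n + 1)), (12, -1)])

/-- `X + 2 Re (((1 + √-7) / 2)²ⁿ)`. -/
def vSeven (n : ℕ) : ℝ := X (2 * n + 1) + 2 * (((1 + sqrtNeg 7) / 2) ^ (2 * n)).re

/-- `X · vSeven - 4ⁿ`. -/
def zSeven (n : ℕ) : ℝ := X (2 * n + 1) * vSeven n - 4 ^ n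

/-- Coefficient of `ζ(2n+1)` for discriminant `-7`. -/
def sevenSeq (n : ℕ) : ℝ :=
  1 / 2 * (vSeven n * (9 ^ n + 4 ^ n) + 4 ^ n * (1 - 2 * vSeven n) * (1 + (-7) ^ n))
    + 16 ^ n * Y (2 * n + 1)

/-- Discriminant `-7`, `k = 2n+1`. -/
def famSeven (n : ℕ) : List LambertTerm :=
  [⟨1/7, 6, (-7) ^ n * zSeven n⟩,
   ⟨1/7, 12, -(-7) ^ n * vSeven n⟩,
   ⟨7, 4/3, -9 ^ n * vSeven n⟩,
   ⟨7, 1, 4 ^ n * X (2 * n + 1) * Y (2 * n + 1)⟩,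
   ⟨7, 2, -(X (2 * n + 1) ^ 2 - 4 ^ n) * Y (2 * n + 1)⟩,
   ⟨7, 3, -4 ^ n * vSeven n⟩,
   ⟨7, 4, X (2 * n + 1) * Y (2 * n + 1)⟩,
   ⟨7, 6, zSeven n⟩,
   ⟨7, 12, -vSeven n⟩]

/-- `2 Im z / √23`. -/
def imPart (z : ℂ) : ℝ := 2 * z.im / Real.sqrt 23

def kappaX (n : ℕ) : ℝ := (imPart (beta n) + X (2 * n + 1) * imPart (alpha n)) / 4 ^ (n + 1)

def lambdaX (n : ℕ) : ℝ := -X (2 * n + 1) * kappaX n + imPart (alpha n) / 4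

def rhoX (n : ℕ) : ℝ :=
  -Y (2 * n + 1) * kappaX n
    + (X (2 * n + 1) * imPart (alpha n * beta n) / 16 ^ n + imPart (alpha n ^ 2) / 4 ^ n)
      / 4 ^ (n + 1)

def thetaX (n : ℕ) : ℝ :=
  (X (2 * n + 1) * Y (2 * n + 1) * imPart (beta n)
    - (X (2 * n + 1) ^ 2 - 4 ^ n) * imPart (alpha n * beta n) / 16 ^ n
    - X (2 * n + 1) * imPart (alpha n ^ 2) / 4 ^ n
    + (X (2 * n + 1) ^ 2 - 4 ^ n) * Y (2 * n + 1) * imPart (alpha n)) / 4 ^ (n + 1)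

/-- Discriminant `-23`, `k = 2n+1`. -/
def famX (n : ℕ) : List LambertTerm :=
  ⟨1/23, 12, (-23) ^ n * kappaX n⟩ ::
  block 23 (1/3) 1
    [(2, 9 ^ n * lambdaX n), (3, 4 ^ n * rhoX n), (4, 9 ^ n * kappaX n), (6, thetaX n),
     (9, 4 ^ n * kappaX n), (12, rhoX n), (18, lambdaX n), (36, kappaX n)]

/-- `4ⁿ - (-1)ⁿ X`, `k = 4n+1`. -/
def lambdaC (n : ℕ) : ℝ := 4 ^ n - (-1) ^ n * X (4 * n + 1)

/-- Discriminant `-4`, `k = 4n+1`. -/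
def famC (n : ℕ) : List LambertTerm :=
  [⟨1, 12/5, 5 ^ (4 * n) * lambdaC n⟩,
   ⟨1, 4, -4 ^ n * Y (4 * n + 1) * (5 ^ (4 * n + 1) + 1)⟩,
   ⟨1, 6, -(-4) ^ n * lambdaC n
      * (5 ^ (4 * n + 1) + 1 + 2 * ((3 + 4 * Complex.I) ^ (2 * n)).re)⟩]
  ++ block 1 (5/3) (lambdaC n)
    [(2, -81 ^ n * (X (4 * n + 1) - (-4) ^ n)), (4, 81 ^ n), (6, -(-4) ^ n * Y (4 * n + 1)),
     (9, 16 ^ n), (18, -(X (4 * n + 1) - (-4) ^ n)), (36, 1)]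

/-- Discriminant `-3`, `k = 6n+1`, merit `25/3`. -/
def famY (n : ℕ) : List LambertTerm :=
  ⟨3, 2, -(5 ^ (6 * n + 1) + 1)⟩ ::
  block (1/3) 5 (X (6 * n + 1) / 64 ^ n)
    [(1, -(-27) ^ n * 64 ^ n), (2, (-27) ^ n * X (6 * n + 1)), (3, -64 ^ n), (4, -(-27) ^ n),
     (6, X (6 * n + 1)), (12, -1)]

def kappaZ (n : ℕ) : ℝ := 3 ^ (6 * n + 1) + 1 - (-27) ^ n

def muZ (n : ℕ) : ℝ := 7 ^ (6 * n + 1) + 1 - 2 * ((2 + sqrtNeg 3) ^ (6 * n)).re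

/-- Discriminant `-3`, `k = 6n+1`, merit `49/3`. -/
def famZ (n : ℕ) : List LambertTerm :=
  block (1/3) 7 (-(-27) ^ n * kappaZ n) [(1, 1), (2, -X (6 * n + 1) / 64 ^ n), (4, 1 / 64 ^ n)]
  ++ block (1/3) 9 (muZ n) [(1, 1), (2, -X (6 * n + 1) / 64 ^ n), (4, 1 / 64 ^ n)]
  ++ block (1/3) 21 (-kappaZ n) [(1, 1), (2, -X (6 * n + 1) / 64 ^ n), (4, 1 / 64 ^ n)]

end ZetaLambert

end

open ZetaLambert

/-! Put k = 2N+1. The function `phi N`, equal to ζ(k)/2 + S_k(exp(2πiτ)) on the imaginary axis, is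
the Eichler integral of the Eisenstein series of weight 2N+2, and three of its properties carry
everything. (a) It has period 1, and τ ↦ -conj τ conjugates its values, so it is real on the
imaginary axis (`phi_add_int`, `phi_neg_conj`). (b) Ramanujan's formula: τ^(2N) φ(-1/τ) = φ(τ) +
iπ^k P(τ), where P has rational coefficients (`phi_neg_one_div`). The proof expands the cotangent in
partial fractions and exchanges the two summation indices of the resulting double series; the
correction terms are products of even zeta values. (c) It is an eigenfunction of the Hecke
operators: φ(pτ) + p^(2N) Σ_b φ((τ+b)/p) = (p^k+1) φ(τ) (`phi_hecke`).

At points of ℚ(√-D) these become linear algebra. A Hecke relation T_p at a point relates the values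
at finitely many points. Some are purely imaginary, so their values are Lambert series at real
arguments; an inversion followed by a translation carries the others to points already present, with
a factor that is a ratio of N-th powers of elements of ℚ(√-D), and at the price of a period iπ^k
P(τ) with P(τ) in ℚ(√-D) (`ph_step`). Once the non-imaginary points are eliminated, there remains Σ
c φ(r√-D) = iπ^k E with E in ℚ(√-D). The left side is real, so E = β√-D with β rational, and φ =
ζ(k)/2 + S_k gives v ζ(k) = β√D π^k + Σ c S_k with 2v = -Σ c (`evaluates_of_relSum`). Each family is
one such elimination, uniform in n; the explicit evaluations compute β for the smallest n and
rescale, except the one of discriminant -7, which also uses a relation special to N = 1.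

The rest is arithmetic. The coefficients and denominators are combinations of geometric sequences
and of Lucas sequences, that is, of traces and normalized differences of powers of conjugate
quadratic integers. Their integrality, divisibility and nonvanishing are congruences modulo small
integers; the recurrences hold because a product of the characteristic polynomials annihilates the
sequence under the shift. The merit of a term is the limit of the ratio of its summands, and d²s =
4Dr² links the term to its point r√-D. -/

noncomputable section

namespace ZetaLambert

open Complex Filter

/-! ### The Eichler integral of the Eisenstein series -/

/-- The completed Lambert series `ζ(2N+1)/2 + S_{2N+1}(e^{2πiτ})`, as a series of cotangents. -/
def phi (N : ℕ) (τ : ℂ) : ℂ :=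
  I / 2 * ∑' m : ℕ, cot (Real.pi * ((m + 1) * τ)) / ((m : ℂ) + 1) ^ (2 * N + 1)

/-- `ζ(j)` as a sum over `ℕ`. -/
def zetaSum (j : ℕ) : ℂ := ∑' m : ℕ, 1 / ((m : ℂ) + 1) ^ j

/-- The terms of the double series that arises from the partial fractions of the cotangent. -/
def cotTerms (N : ℕ) (τ : ℂ) (p : ℕ × ℕ) : ℂ :=
  1 / (((p.1 : ℂ) + 1) ^ (2 * N) * ((((p.1 : ℂ) + 1) * τ) ^ 2 - ((p.2 : ℂ) + 1) ^ 2))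

lemma summable_zetaSum {j : ℕ} (hj : 2 ≤ j) :
    Summable fun m : ℕ => 1 / ((m : ℂ) + 1) ^ j := by
  have h := (summable_nat_add_iff 1).mpr (Real.summable_one_div_nat_pow.mpr (by omega : 1 < j))
  rw [← summable_norm_iff]
  refine h.congr fun m => ?_
  rw [norm_div, norm_one, norm_pow]
  norm_cast

lemma zetaSum_eq {j : ℕ} (hj : 2 ≤ j) : zetaSum j = riemannZeta j := by
  have hs : Summable fun n : ℕ => 1 / (n : ℂ) ^ j :=
    (summable_nat_add_iff 1).mp ((summable_zetaSum hj).congr fun m => by push_cast; rfl)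
  rw [zeta_nat_eq_tsum_of_gt_one (by omega : 1 < j), zetaSum, hs.tsum_eq_zero_add]
  simp [show j ≠ 0 by omega]

lemma im_succ_mul_pos {τ : ℂ} (hτ : 0 < τ.im) (m : ℕ) : 0 < (((m : ℂ) + 1) * τ).im := by
  have : ((m : ℂ) + 1) = ((m + 1 : ℝ) : ℂ) := by push_cast; rfl
  rw [this, im_ofReal_mul]; positivity

/-- The difference factors as (mτ + l)(mτ - l), and |xτ ± 1| is bounded below uniformly in the real
number x = m/l by the constant r of the theory of Eisenstein series. Uniformity in m is what makes
the double series converge absolutely. -/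
lemma sq_sub_sq_lower_bound {τ : ℂ} (hτ : 0 < τ.im) : ∃ c : ℝ, 0 < c ∧ ∀ m l : ℕ,
    c * ((l : ℝ) + 1) ^ 2 ≤ ‖(((m : ℂ) + 1) * τ) ^ 2 - ((l : ℂ) + 1) ^ 2‖ := by
  set z : UpperHalfPlane := ⟨τ, hτ⟩
  refine ⟨EisensteinSeries.r z ^ 2, pow_pos (EisensteinSeries.r_pos z) 2, fun m l => ?_⟩
  have hl : (0 : ℝ) < (l : ℝ) + 1 := by positivity
  have hl' : ((l : ℂ) + 1) ≠ 0 := by exact_mod_cast hl.ne'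
  have key : ∀ d : ℝ, d ^ 2 = 1 → EisensteinSeries.r z * ((l : ℝ) + 1) ≤
      ‖((m : ℂ) + 1) * τ + d * ((l : ℂ) + 1)‖ := by
    intro d hd
    have h := EisensteinSeries.auxbound2 z (((m : ℝ) + 1) / ((l : ℝ) + 1)) (d := d) hd.ge
    have e : ((m : ℂ) + 1) * τ + d * ((l : ℂ) + 1) =
        (((((m : ℝ) + 1) / ((l : ℝ) + 1) : ℝ) : ℂ) * (z : ℂ) + d) * (((l : ℝ) + 1 : ℝ) : ℂ) := by
      change _ = (_ * τ + _) * _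
      push_cast
      field_simp
    rw [e, norm_mul, norm_real, Real.norm_of_nonneg hl.le]
    gcongr
  have e : (((m : ℂ) + 1) * τ) ^ 2 - ((l : ℂ) + 1) ^ 2 =
      (((m : ℂ) + 1) * τ + (1 : ℝ) * ((l : ℂ) + 1)) *
        (((m : ℂ) + 1) * τ + (-1 : ℝ) * ((l : ℂ) + 1)) := by
    push_cast; ring
  rw [e, norm_mul]
  calc _ = (EisensteinSeries.r z * ((l : ℝ) + 1)) * (EisensteinSeries.r z * ((l : ℝ) + 1)) := by
        ring
    _ ≤ _ := mul_le_mul (key 1 (by norm_num)) (key (-1) (by norm_num))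
        (by have := EisensteinSeries.r_pos z; positivity) (norm_nonneg _)

lemma sq_sub_sq_ne_zero {τ : ℂ} (hτ : 0 < τ.im) (m l : ℕ) :
    (((m : ℂ) + 1) * τ) ^ 2 - ((l : ℂ) + 1) ^ 2 ≠ 0 := by
  obtain ⟨c, hc, h⟩ := sq_sub_sq_lower_bound hτ
  rw [← norm_pos_iff]
  exact lt_of_lt_of_le (by positivity) (h m l)

/-- For N ≥ 1 the terms are dominated by a multiple of 1/(m²l²). Absolute convergence is what
permits the exchange of the two indices below. -/
lemma summable_cotTerms {N : ℕ} (hN : 1 ≤ N) {τ : ℂ} (hτ : 0 < τ.im) :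
    Summable (cotTerms N τ) := by
  obtain ⟨c, hc, h⟩ := sq_sub_sq_lower_bound hτ
  have h2 : Summable fun m : ℕ => 1 / ((m : ℝ) + 1) ^ 2 := by
    have := (summable_nat_add_iff 1).mpr (Real.summable_one_div_nat_pow.mpr (by omega : 1 < 2))
    exact this.congr fun m => by push_cast; rfl
  have h3 := (h2.mul_of_nonneg h2 (fun m => by positivity) (fun m => by positivity)).mul_left c⁻¹
  refine Summable.of_norm_bounded h3 fun p => ?_
  rw [cotTerms, norm_div, norm_one, norm_mul, norm_pow]
  have e : ‖(p.1 : ℂ) + 1‖ = (p.1 : ℝ) + 1 := by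
    have : (p.1 : ℂ) + 1 = ((p.1 + 1 : ℕ) : ℂ) := by push_cast; rfl
    rw [this, norm_natCast]; push_cast; rfl
  have e2 : c⁻¹ * (1 / ((p.1 : ℝ) + 1) ^ 2 * (1 / ((p.2 : ℝ) + 1) ^ 2)) =
      1 / (((p.1 : ℝ) + 1) ^ 2 * (c * ((p.2 : ℝ) + 1) ^ 2)) := by
    field_simp
  rw [e, e2]
  have h4 : ((p.1 : ℝ) + 1) ^ 2 ≤ ((p.1 : ℝ) + 1) ^ (2 * N) :=
    pow_le_pow_right₀ (by linarith [Nat.cast_nonneg (α := ℝ) p.1]) (by omega)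
  exact one_div_le_one_div_of_le (by positivity)
    (mul_le_mul h4 (h p.1 p.2) (by positivity) (by positivity))

/-- The Mittag-Leffler expansion, with the poles at l and -l paired into one term so that the series
converges absolutely. -/
lemma pi_mul_cot_eq {τ : ℂ} (hτ : 0 < τ.im) (m : ℕ) :
    Real.pi * cot (Real.pi * ((m + 1) * τ)) = 1 / (((m : ℂ) + 1) * τ) +
      ∑' l : ℕ, 2 * (((m : ℂ) + 1) * τ) / ((((m : ℂ) + 1) * τ) ^ 2 - ((l : ℂ) + 1) ^ 2) := by
  have hx := UpperHalfPlane.coe_mem_integerComplement ⟨_, im_succ_mul_pos hτ m⟩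
  have h := cot_series_rep' hx
  rw [UpperHalfPlane.coe_mk] at h
  rw [← sub_eq_iff_eq_add', h]
  refine tsum_congr fun l => ?_
  have h0 := sq_sub_sq_ne_zero hτ m l
  have h1 : ((m : ℂ) + 1) * τ - ((l : ℂ) + 1) ≠ 0 := fun h1 => h0 (by rw [sq_sub_sq, h1, mul_zero])
  have h2 : ((m : ℂ) + 1) * τ + ((l : ℂ) + 1) ≠ 0 := fun h1 => h0 (by rw [sq_sub_sq, h1, zero_mul])
  rw [one_div_add_one_div h1 h2, div_eq_div_iff (mul_ne_zero h1 h2) h0]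
  ring

/-- The poles at 0 of the cotangents contribute ζ(2N+2)/τ; the paired poles give the double series.
-/
lemma phi_eq {N : ℕ} (hN : 1 ≤ N) {τ : ℂ} (hτ : 0 < τ.im) :
    phi N τ = I / (2 * Real.pi) * (zetaSum (2 * N + 2) / τ + 2 * τ * ∑' p, cotTerms N τ p) := by
  have hπ : (Real.pi : ℂ) ≠ 0 := by exact_mod_cast Real.pi_ne_zero
  have hτ0 : τ ≠ 0 := fun h => by simp [h] at hτ
  have hs := summable_cotTerms hN hτ
  rw [hs.tsum_prod, zetaSum, div_eq_mul_inv _ τ, ← tsum_mul_right, ← tsum_mul_left (a := 2 * τ),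
    ← Summable.tsum_add ((summable_zetaSum (by omega)).mul_right _) (hs.prod.mul_left _), phi,
    ← tsum_mul_left, ← tsum_mul_left]
  refine tsum_congr fun m => ?_
  have hm : (m : ℂ) + 1 ≠ 0 := by exact_mod_cast Nat.succ_ne_zero m
  have e : ∑' l, cotTerms N τ (m, l) = (1 / ((m : ℂ) + 1) ^ (2 * N) / (2 * (((m : ℂ) + 1) * τ))) *
      ∑' l : ℕ, 2 * (((m : ℂ) + 1) * τ) / ((((m : ℂ) + 1) * τ) ^ 2 - ((l : ℂ) + 1) ^ 2) := by
    rw [← tsum_mul_left]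
    refine tsum_congr fun l => ?_
    have h0 := sq_sub_sq_ne_zero hτ m l
    rw [cotTerms]
    field_simp
  have h := pi_mul_cot_eq hτ m
  rw [e]
  rw [← sub_eq_iff_eq_add'] at h
  rw [← h]
  field_simp
  ring

/-- Iterates 1/(A(A-B)) = 1/(B(A-B)) - 1/(AB). With A = (mτ)² and B = l² it moves the high power
from m to l, and the correction terms separate the two variables. -/
lemma one_div_partial_fraction {A B : ℂ} (hA : A ≠ 0) (hB : B ≠ 0) (hAB : A - B ≠ 0) (N : ℕ) :
    1 / (A ^ N * (A - B)) = 1 / (B ^ N * (A - B)) -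
      ∑ j ∈ Finset.range N, 1 / (A ^ (j + 1) * B ^ (N - j)) := by
  induction N with
  | zero => simp
  | succ N ih =>
    rw [Finset.sum_range_succ]
    have e : ∑ j ∈ Finset.range N, 1 / (A ^ (j + 1) * B ^ (N + 1 - j)) =
        1 / B * ∑ j ∈ Finset.range N, 1 / (A ^ (j + 1) * B ^ (N - j)) := by
      rw [Finset.mul_sum]
      refine Finset.sum_congr rfl fun j hj => ?_
      rw [show N + 1 - j = (N - j) + 1 by have := Finset.mem_range.mp hj; omega, pow_succ B]
      field_simp
    rw [e, show N + 1 - N = 1 by omega]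
    rw [eq_sub_iff_add_eq, ← eq_sub_iff_add_eq'] at ih
    rw [ih]
    field_simp
    ring

/-- The term of index (m, l) at τ becomes the term of index (l, m) at -1/τ, up to products of a
power of m by a power of l. After summation these products become products of even zeta values,
hence rational multiples of π^(2N+2). -/
lemma cotTerms_swap {τ : ℂ} (hτ : 0 < τ.im) (N m l : ℕ) :
    τ ^ 2 * cotTerms N τ (m, l) = -τ ^ (2 * N) * cotTerms N (-1 / τ) (l, m) -
      ∑ j ∈ Finset.range N, τ ^ (2 * (N - j)) *
        (1 / ((m : ℂ) + 1) ^ (2 * (j + 1)) * (1 / ((l : ℂ) + 1) ^ (2 * (N - j)))) := by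
  have hτ0 : τ ≠ 0 := fun h => by simp [h] at hτ
  have hm : (m : ℂ) + 1 ≠ 0 := by exact_mod_cast Nat.succ_ne_zero m
  have hl : (l : ℂ) + 1 ≠ 0 := by exact_mod_cast Nat.succ_ne_zero l
  have hA : (((m : ℂ) + 1) * τ) ^ 2 ≠ 0 := pow_ne_zero _ (mul_ne_zero hm hτ0)
  have hB : ((l : ℂ) + 1) ^ 2 ≠ 0 := pow_ne_zero _ hl
  have h0 := sq_sub_sq_ne_zero hτ m l
  have key := one_div_partial_fraction hA hB h0 N
  have e1 : τ ^ 2 * cotTerms N τ (m, l) = τ ^ 2 * τ ^ (2 * N) *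
      (1 / (((((m : ℂ) + 1) * τ) ^ 2) ^ N * ((((m : ℂ) + 1) * τ) ^ 2 - ((l : ℂ) + 1) ^ 2))) := by
    rw [cotTerms, ← pow_mul (_ * τ), mul_pow _ τ (2 * N)]
    field_simp
  have e2 : cotTerms N (-1 / τ) (l, m) = -τ ^ 2 * (1 / ((((l : ℂ) + 1) ^ 2) ^ N *
      ((((m : ℂ) + 1) * τ) ^ 2 - ((l : ℂ) + 1) ^ 2))) := by
    rw [cotTerms]
    have h1 : (((l : ℂ) + 1) * (-1 / τ)) ^ 2 - ((m : ℂ) + 1) ^ 2 =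
        -((((m : ℂ) + 1) * τ) ^ 2 - ((l : ℂ) + 1) ^ 2) / τ ^ 2 := by
      field_simp
      ring
    simp only [h1, ← pow_mul]
    field_simp
  rw [e1, e2, key, mul_sub, Finset.mul_sum]
  congr 1
  · ring
  · refine Finset.sum_congr rfl fun j hj => ?_
    have hj' := Finset.mem_range.mp hj
    have : τ ^ 2 * τ ^ (2 * N) = τ ^ (2 * (N - j)) * τ ^ (2 * (j + 1)) := by
      rw [← pow_add, ← pow_add]; congr 1; omega
    rw [this, ← pow_mul, ← pow_mul, mul_pow]
    field_simp

lemma neg_one_div_im_pos {τ : ℂ} (hτ : 0 < τ.im) : 0 < (-1 / τ).im := by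
  have h := (UpperHalfPlane.mk _ (UpperHalfPlane.im_inv_neg_coe_pos ⟨τ, hτ⟩)).im_pos
  have e : -1 / τ = (-τ)⁻¹ := by rw [inv_neg, neg_div, one_div]
  rw [e]
  exact h

lemma tsum_cotTerms_inv {N : ℕ} (hN : 1 ≤ N) {τ : ℂ} (hτ : 0 < τ.im) :
    τ ^ 2 * ∑' p, cotTerms N τ p = -τ ^ (2 * N) * ∑' p, cotTerms N (-1 / τ) p -
      ∑ j ∈ Finset.range N, τ ^ (2 * (N - j)) *
        (zetaSum (2 * (j + 1)) * zetaSum (2 * (N - j))) := by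
  have hs' := summable_cotTerms hN (neg_one_div_im_pos hτ)
  have hz : ∀ j ∈ Finset.range N, Summable fun p : ℕ × ℕ => τ ^ (2 * (N - j)) *
      (1 / ((p.1 : ℂ) + 1) ^ (2 * (j + 1)) * (1 / ((p.2 : ℂ) + 1) ^ (2 * (N - j)))) := by
    intro j hj
    have hj' := Finset.mem_range.mp hj
    exact (summable_mul_of_summable_norm (summable_zetaSum (by omega)).norm
      (summable_zetaSum (by omega)).norm).mul_left _
  have hsw : Summable fun p : ℕ × ℕ => cotTerms N (-1 / τ) (p.2, p.1) :=
    (Equiv.prodComm ℕ ℕ).summable_iff.mpr hs'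
  rw [← tsum_mul_left, tsum_congr (fun p : ℕ × ℕ => cotTerms_swap hτ N p.1 p.2),
    Summable.tsum_sub (hsw.mul_left _) (summable_sum hz), tsum_mul_left,
    Summable.tsum_finsetSum hz]
  congr 1
  · congr 1
    exact (Equiv.prodComm ℕ ℕ).tsum_eq (cotTerms N (-1 / τ))
  · refine Finset.sum_congr rfl fun j hj => ?_
    have hj' := Finset.mem_range.mp hj
    rw [tsum_mul_left, zetaSum, zetaSum, tsum_mul_tsum_of_summable_norm
      (summable_zetaSum (by omega)).norm (summable_zetaSum (by omega)).norm]

/-- `ζ(2j) / π²ʲ`. -/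
def zetaRat (j : ℕ) : ℚ := (-1) ^ (j + 1) * 2 ^ (2 * j - 1) * bernoulli (2 * j) / (2 * j).factorial

lemma zetaSum_two_mul {j : ℕ} (hj : j ≠ 0) :
    zetaSum (2 * j) = (zetaRat j : ℂ) * (Real.pi : ℂ) ^ (2 * j) := by
  have h := riemannZeta_two_mul_nat hj
  rw [zetaSum_eq (by omega)]
  push_cast
  rw [h, zetaRat]
  push_cast
  ring

/-- The period function of `phi N` divided by `i π^(2N+1)`. -/
def period (N : ℕ) (τ : ℂ) : ℂ :=
  (∑ j ∈ Finset.range N, (zetaRat (j + 1) * zetaRat (N - j) : ℚ) * τ ^ (2 * (N - j) - 1))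
    - (zetaRat (N + 1) / 2 : ℚ) * (1 / τ + τ ^ (2 * N + 1))

/-- Ramanujan's formula. -/
theorem phi_neg_one_div {N : ℕ} (hN : 1 ≤ N) {τ : ℂ} (hτ : 0 < τ.im) :
    τ ^ (2 * N) * phi N (-1 / τ) = phi N τ + I * (Real.pi : ℂ) ^ (2 * N + 1) * period N τ := by
  have hπ : (Real.pi : ℂ) ≠ 0 := by exact_mod_cast Real.pi_ne_zero
  have hτ0 : τ ≠ 0 := fun h => by simp [h] at hτ
  have h := tsum_cotTerms_inv hN hτ
  rw [phi_eq hN hτ, phi_eq hN (neg_one_div_im_pos hτ), period]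
  have e : ∑ j ∈ Finset.range N, τ ^ (2 * (N - j)) *
        (zetaSum (2 * (j + 1)) * zetaSum (2 * (N - j))) = (Real.pi : ℂ) ^ (2 * N + 2) * (τ *
      ∑ j ∈ Finset.range N, (zetaRat (j + 1) * zetaRat (N - j) : ℚ) * τ ^ (2 * (N - j) - 1)) := by
    rw [Finset.mul_sum, Finset.mul_sum]
    refine Finset.sum_congr rfl fun j hj => ?_
    have hj' := Finset.mem_range.mp hj
    rw [zetaSum_two_mul (by omega), zetaSum_two_mul (by omega),
      show 2 * N + 2 = 2 * (j + 1) + 2 * (N - j) by omega, pow_add]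
    obtain ⟨i, hi⟩ : ∃ i, 2 * (N - j) = i + 1 := ⟨2 * (N - j) - 1, by omega⟩
    rw [hi, Nat.add_sub_cancel]
    push_cast
    ring
  rw [e] at h
  have hz : zetaSum (2 * N + 2) = zetaRat (N + 1) * (Real.pi : ℂ) ^ (2 * N + 2) :=
    zetaSum_two_mul (j := N + 1) (by omega)
  rw [hz]
  -- The only relation needed between the two double series is `h`; once they are opaque, solving it
  -- for one of them leaves an identity of rational functions.
  generalize ∑' p, cotTerms N τ p = G at *
  generalize ∑' p, cotTerms N (-1 / τ) p = G' at *
  generalize ∑ j ∈ Finset.range N, ((zetaRat (j + 1) * zetaRat (N - j) : ℚ) : ℂ) *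
    τ ^ (2 * (N - j) - 1) = Q at *
  have hG : G = (-τ ^ (2 * N) * G' - (Real.pi : ℂ) ^ (2 * N + 2) * (τ * Q)) / τ ^ 2 := by
    rw [← h]; field_simp
  rw [hG]
  push_cast
  field_simp
  ring

/-! ### Translation and reflection symmetries of the Eichler integral -/

lemma phi_add_one (N : ℕ) (τ : ℂ) : phi N (τ + 1) = phi N τ := by
  rw [phi, phi]
  congr 1
  refine tsum_congr fun m => ?_
  congr 1
  have : (Real.pi : ℂ) * ((m + 1) * (τ + 1)) =
      Real.pi * ((m + 1) * τ) + ((m + 1 : ℕ) : ℂ) * Real.pi := by push_cast; ring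
  rw [this, cot, cot, cos_antiperiodic.add_nat_mul_eq,
    sin_antiperiodic.add_nat_mul_eq, mul_div_mul_left _ _ (pow_ne_zero _ (by norm_num))]

lemma phi_add_nat (N : ℕ) (τ : ℂ) (m : ℕ) : phi N (τ + m) = phi N τ := by
  induction m with
  | zero => simp
  | succ m ih => rw [Nat.cast_succ, ← add_assoc, phi_add_one, ih]

lemma phi_add_int (N : ℕ) (τ : ℂ) (m : ℤ) : phi N (τ + m) = phi N τ := by
  obtain ⟨j, rfl | rfl⟩ := m.eq_nat_or_neg
  · exact_mod_cast phi_add_nat N τ j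
  · have := phi_add_nat N (τ + ((-(j : ℤ) : ℤ) : ℂ)) j
    rw [← this]; push_cast; ring_nf

/-- The cotangent is odd, which compensates the sign produced by conjugating the prefactor i/2. On
the imaginary axis the reflection is trivial, so the values there are real. -/
lemma phi_neg_conj (N : ℕ) (τ : ℂ) :
    phi N (-(starRingEnd ℂ) τ) = (starRingEnd ℂ) (phi N τ) := by
  rw [phi, phi, map_mul, conj_tsum, ← tsum_mul_left, ← tsum_mul_left]
  refine tsum_congr fun m => ?_
  rw [map_div₀, map_div₀, map_pow, map_add, conj_I, map_one, conj_natCast, map_ofNat,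
    ← Complex.cot_conj]
  rw [map_mul, map_mul, conj_ofReal, map_add, map_one, conj_natCast, mul_neg, mul_neg, cot, cot,
    cos_neg, sin_neg]
  ring

/-- The partial-fraction computation behind `phi_eq`, read for convergence; the Hecke relation
splits and rearranges this series. -/
lemma summable_cot_div {N : ℕ} (hN : 1 ≤ N) {τ : ℂ} (hτ : 0 < τ.im) :
    Summable fun m : ℕ => cot (Real.pi * ((m + 1) * τ)) / ((m : ℂ) + 1) ^ (2 * N + 1) := by
  have hπ : (Real.pi : ℂ) ≠ 0 := by exact_mod_cast Real.pi_ne_zero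
  have hτ0 : τ ≠ 0 := fun h => by simp [h] at hτ
  have hs := summable_cotTerms hN hτ
  have h2 := (((summable_zetaSum (j := 2 * N + 2) (by omega)).mul_right τ⁻¹).add
    (hs.prod.mul_left (2 * τ))).mul_left (1 / (Real.pi : ℂ))
  refine h2.congr fun m => ?_
  have hm : (m : ℂ) + 1 ≠ 0 := by exact_mod_cast Nat.succ_ne_zero m
  have e : ∑' l, cotTerms N τ (m, l) = (1 / ((m : ℂ) + 1) ^ (2 * N) / (2 * (((m : ℂ) + 1) * τ))) *
      ∑' l : ℕ, 2 * (((m : ℂ) + 1) * τ) / ((((m : ℂ) + 1) * τ) ^ 2 - ((l : ℂ) + 1) ^ 2) := by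
    rw [← tsum_mul_left]
    refine tsum_congr fun l => ?_
    have h0 := sq_sub_sq_ne_zero hτ m l
    rw [cotTerms]
    field_simp
  have h := pi_mul_cot_eq hτ m
  rw [e]
  rw [← sub_eq_iff_eq_add'] at h
  rw [← h]
  field_simp
  ring

/-! ### Hecke operators -/

lemma exp_two_pi_ne_one {z : ℂ} (hz : 0 < z.im) : exp (2 * Real.pi * I * z) ≠ 1 := by
  intro h
  have := Complex.norm_exp (2 * Real.pi * I * z)
  rw [h, norm_one] at this
  have h2 : (2 * Real.pi * I * z).re = -(2 * Real.pi * z.im) := by simp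
  rw [h2] at this
  have h3 : 0 < 2 * Real.pi * z.im := by have := Real.pi_pos; positivity
  have := Real.exp_lt_one_iff.mpr (neg_lt_zero.mpr h3)
  linarith

lemma cot_pi_eq {z : ℂ} (hz : 0 < z.im) :
    cot (Real.pi * z) = -I * (2 / (1 - exp (2 * Real.pi * I * z)) - 1) := by
  have h : 1 - exp (2 * Real.pi * I * z) ≠ 0 := sub_ne_zero.mpr (exp_two_pi_ne_one hz).symm
  have hI := I_ne_zero
  rw [cot_pi_eq_exp_ratio]
  field_simp
  rw [I_sq]
  ring

/-- A finite geometric sum brings every term over the common denominator 1 - x^p, and orthogonality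
of the p-th roots of unity keeps only the exponent j = 0. -/
lemma sum_inv_one_sub_primitiveRoot {p : ℕ} (hp : p.Prime) {ζ x : ℂ} (hζ : IsPrimitiveRoot ζ p)
    (hx : x ^ p ≠ 1) : ∑ b ∈ Finset.range p, 1 / (1 - ζ ^ b * x) = p / (1 - x ^ p) := by
  have hx' : 1 - x ^ p ≠ 0 := sub_ne_zero.mpr hx.symm
  have h1 : ∀ b ∈ Finset.range p, 1 / (1 - ζ ^ b * x) =
      (∑ j ∈ Finset.range p, (ζ ^ j) ^ b * x ^ j) / (1 - x ^ p) := by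
    intro b _
    have hb : (ζ ^ b * x) ^ p = x ^ p := by
      rw [mul_pow, ← pow_mul, mul_comm b p, pow_mul, hζ.pow_eq_one, one_pow, one_mul]
    have hb' : 1 - ζ ^ b * x ≠ 0 := by
      intro h0
      apply hx
      rw [← hb, (sub_eq_zero.mp h0).symm, one_pow]
    rw [div_eq_div_iff hb' hx', one_mul, ← hb, ← geom_sum_mul_neg (ζ ^ b * x) p]
    congr 1
    refine Finset.sum_congr rfl fun j _ => ?_
    rw [mul_pow, ← pow_mul, ← pow_mul, mul_comm b j]
  rw [Finset.sum_congr rfl h1, ← Finset.sum_div, Finset.sum_comm]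
  congr 1
  have h2 : ∀ j ∈ Finset.range p, ∑ b ∈ Finset.range p, (ζ ^ j) ^ b * x ^ j =
      if j = 0 then (p : ℂ) else 0 := by
    intro j hj
    split_ifs with h
    · subst h; simp
    · have hc : j.Coprime p := (hp.coprime_iff_not_dvd.mpr
        (Nat.not_dvd_of_pos_of_lt (Nat.pos_of_ne_zero h) (Finset.mem_range.mp hj))).symm
      rw [← Finset.sum_mul, (hζ.pow_of_coprime j hc).geom_sum_eq_zero hp.one_lt, zero_mul]
  rw [Finset.sum_congr rfl h2]
  simp [hp.pos]

/-- The distribution relation of the cotangent. As p does not divide m, exp(2πim/p) is still a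
primitive p-th root of unity. -/
lemma sum_cot_of_not_dvd {p m : ℕ} (hp : p.Prime) (hm : ¬ p ∣ m) {τ : ℂ} (hτ : 0 < τ.im) :
    ∑ b ∈ Finset.range p, cot (Real.pi * (m * ((τ + b) / p))) = p * cot (Real.pi * (m * τ)) := by
  have hp0 : (p : ℂ) ≠ 0 := by exact_mod_cast hp.ne_zero
  have hm0 : 0 < m := Nat.pos_of_ne_zero fun h => hm (h ▸ dvd_zero p)
  have hζ := (isPrimitiveRoot_exp p hp.ne_zero).pow_of_coprime m
    ((Nat.Prime.coprime_iff_not_dvd hp).mpr hm).symm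
  have hmτ : 0 < ((m : ℂ) * τ).im := by
    rw [← ofReal_natCast, im_ofReal_mul]
    positivity
  set x := exp (2 * Real.pi * I * (m * (τ / p))) with hxdef
  have hxp : x ^ p = exp (2 * Real.pi * I * (m * τ)) := by
    rw [hxdef, ← exp_nat_mul]; congr 1; field_simp
  have hx : x ^ p ≠ 1 := by
    rw [hxp]
    exact exp_two_pi_ne_one hmτ
  have h := sum_inv_one_sub_primitiveRoot hp hζ hx
  have h1 : ∀ b ∈ Finset.range p, cot (Real.pi * (m * ((τ + b) / p))) =
      -I * (2 * (1 / (1 - (exp (2 * Real.pi * I / p) ^ m) ^ b * x)) - 1) := by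
    intro b _
    have him : 0 < ((m : ℂ) * ((τ + b) / p)).im := by
      rw [← ofReal_natCast m, im_ofReal_mul, ← ofReal_natCast p, div_ofReal_im, add_im, natCast_im,
        add_zero]
      have : (0 : ℝ) < p := by exact_mod_cast hp.pos
      positivity
    rw [cot_pi_eq him]
    have : exp (2 * Real.pi * I * (m * ((τ + b) / p))) =
      (exp (2 * Real.pi * I / p) ^ m) ^ b * x := by
      rw [hxdef, ← exp_nat_mul, ← exp_nat_mul, ← exp_add]; congr 1; field_simp; ring
    rw [this, mul_one_div]
  rw [Finset.sum_congr rfl h1, ← Finset.mul_sum, Finset.sum_sub_distrib, ← Finset.mul_sum, h,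
    cot_pi_eq hmτ, hxp]
  simp
  ring

/-- Index m stands for the integer m + 1, so the multiples of p sit at the indices p(m+1) - 1. -/
lemma tsum_mul_sub_one {p : ℕ} (hp : 0 < p) (f : ℕ → ℂ) (hf : ∀ m, ¬ p ∣ m + 1 → f m = 0) :
    ∑' m, f m = ∑' m, f (p * (m + 1) - 1) := by
  have hinj : Function.Injective fun m : ℕ => p * (m + 1) - 1 := by
    intro a b hab
    have h1 : 0 < p * (a + 1) := by positivity
    have h2 : 0 < p * (b + 1) := by positivity
    have : p * (a + 1) = p * (b + 1) := by simp only at hab; omega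
    have := Nat.eq_of_mul_eq_mul_left hp this
    omega
  refine (hinj.tsum_eq fun m hm => ?_).symm
  have hd : p ∣ m + 1 := by
    by_contra h
    exact hm (hf m h)
  obtain ⟨c, hc⟩ := hd
  have hc0 : c ≠ 0 := by rintro rfl; simp at hc
  refine ⟨c - 1, ?_⟩
  simp only [Nat.sub_add_cancel (Nat.one_le_iff_ne_zero.mpr hc0), ← hc, Nat.add_sub_cancel]

/-- The Lambert series is an eigenfunction of the Hecke operators. -/
theorem phi_hecke {N p : ℕ} (hN : 1 ≤ N) (hp : p.Prime) {τ : ℂ} (hτ : 0 < τ.im) :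
    phi N (p * τ) + (p : ℂ) ^ (2 * N) * ∑ b ∈ Finset.range p, phi N ((τ + b) / p) =
      ((p : ℂ) ^ (2 * N + 1) + 1) * phi N τ := by
  have hp0 : (p : ℂ) ≠ 0 := by exact_mod_cast hp.ne_zero
  have hpR : (0 : ℝ) < p := by exact_mod_cast hp.pos
  have hs := summable_cot_div hN hτ
  have hpτ : 0 < ((p : ℂ) * τ).im := by
    rw [← ofReal_natCast, im_ofReal_mul]; positivity
  have hsp := summable_cot_div hN hpτ
  have hb : ∀ b : ℕ, 0 < ((τ + b) / p).im := by
    intro b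
    rw [← ofReal_natCast p, div_ofReal_im, add_im, natCast_im, add_zero]
    positivity
  set f : ℕ → ℂ := fun m => cot (Real.pi * ((m + 1) * τ)) / ((m : ℂ) + 1) ^ (2 * N + 1) with hf
  set g : ℕ → ℂ := fun m => ∑ b ∈ Finset.range p,
    cot (Real.pi * ((m + 1) * ((τ + b) / p))) / ((m : ℂ) + 1) ^ (2 * N + 1) with hg
  have hgs : Summable g := summable_sum fun b _ => summable_cot_div hN (hb b)
  -- Indices prime to p: the distribution relation cancels the two series term by term.
  have h0 : ∀ m, ¬ p ∣ m + 1 → g m - p * f m = 0 := by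
    intro m hm
    have h := sum_cot_of_not_dvd hp hm hτ
    push_cast at h
    rw [hg, hf]
    simp only
    rw [← Finset.sum_div, h]
    ring
  -- Indices divisible by p: the p shifts move the argument by integral multiples of π, so the p
  -- cotangents coincide.
  have h1 : ∀ m, g (p * (m + 1) - 1) - p * f (p * (m + 1) - 1) =
      1 / (p : ℂ) ^ (2 * N) * (f m -
        cot (Real.pi * ((m + 1) * (p * τ))) / ((m : ℂ) + 1) ^ (2 * N + 1)) := by
    intro m
    have hm : (m : ℂ) + 1 ≠ 0 := by exact_mod_cast Nat.succ_ne_zero m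
    have e : ((p * (m + 1) - 1 : ℕ) : ℂ) + 1 = p * (m + 1) := by
      have : 1 ≤ p * (m + 1) := Nat.mul_pos hp.pos (Nat.succ_pos m)
      push_cast [this]; ring
    have e2 : ∀ b : ℕ, cot (Real.pi * (p * (m + 1) * ((τ + b) / p))) =
        cot (Real.pi * ((m + 1) * τ)) := by
      intro b
      have : (Real.pi : ℂ) * (p * (m + 1) * ((τ + b) / p)) =
          Real.pi * ((m + 1) * τ) + (((m + 1) * b : ℕ) : ℂ) * Real.pi := by
        push_cast; field_simp
      rw [this, cot, cot, cos_antiperiodic.add_nat_mul_eq, sin_antiperiodic.add_nat_mul_eq,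
        mul_div_mul_left _ _ (pow_ne_zero _ (by norm_num))]
    rw [hg, hf]
    simp only
    rw [e]
    simp only [e2, Finset.sum_const, Finset.card_range, nsmul_eq_mul]
    rw [mul_pow, show (p : ℂ) * (m + 1) * τ = (m + 1) * (p * τ) by ring]
    field_simp
    ring
  have h2 := tsum_mul_sub_one hp.pos (fun m => g m - p * f m) h0
  rw [tsum_congr h1, tsum_mul_left, Summable.tsum_sub hs hsp,
    Summable.tsum_sub hgs (hs.mul_left _), tsum_mul_left] at h2
  have h3 : ∑' m, g m = ∑ b ∈ Finset.range p, ∑' m : ℕ,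
      cot (Real.pi * ((m + 1) * ((τ + b) / p))) / ((m : ℂ) + 1) ^ (2 * N + 1) :=
    Summable.tsum_finsetSum fun b _ => summable_cot_div hN (hb b)
  simp only [phi]
  rw [← Finset.mul_sum, ← h3]
  have h4 : ∑' m, g m = p * ∑' m, f m + 1 / (p : ℂ) ^ (2 * N) * (∑' m, f m -
    ∑' m : ℕ, cot (Real.pi * ((m + 1) * (p * τ))) / ((m : ℂ) + 1) ^ (2 * N + 1)) := by
    rw [← h2]; ring
  rw [h4]
  generalize (∑' m : ℕ, cot (Real.pi * ((m + 1) * (p * τ))) / ((m : ℂ) + 1) ^ (2 * N + 1)) = A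
  generalize (∑' m, f m) = B
  field_simp
  ring

/-! ### Values of the Lambert series -/

lemma summable_lambertSummand {q : ℝ} (h0 : 0 < q) (h1 : q < 1) (k : ℕ) :
    Summable fun m => lambertSummand k q (m + 1) := by
  have hg := ((summable_nat_add_iff 1).mpr (summable_geometric_of_lt_one h0.le h1)).mul_right
    (1 / (1 - q))
  refine Summable.of_nonneg_of_le (fun m => ?_) (fun m => ?_) hg
  · have : q ^ (m + 1) < 1 := pow_lt_one₀ h0.le h1 (by omega)
    have : 0 < 1 - q ^ (m + 1) := by linarith
    rw [lambertSummand]; positivity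
  · have h2 : q ^ (m + 1) ≤ q := pow_le_of_le_one h0.le h1.le (by omega)
    have h3 : 0 < 1 - q := by linarith
    have h4 : (1 : ℝ) ≤ ((m + 1 : ℕ) : ℝ) ^ k :=
      one_le_pow₀ (by push_cast; linarith [Nat.cast_nonneg (α := ℝ) m])
    rw [lambertSummand]
    calc _ ≤ 1 * (q ^ (m + 1) / (1 - q)) := by
          refine mul_le_mul (div_le_one_of_le₀ h4 (by positivity)) ?_ ?_ zero_le_one
          · exact div_le_div_of_nonneg_left (by positivity) h3 (by linarith)
          · have : 0 < 1 - q ^ (m + 1) := by linarith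
            positivity
      _ = _ := by ring

/-- With w = exp(2πiz) one has (i/2) cot(πz) = 1/2 + w/(1-w). The constant 1/2 sums to ζ(k)/2 and
the rest to the Lambert series. -/
lemma phi_I_mul {N : ℕ} (hN : 1 ≤ N) {y : ℝ} (hy : 0 < y) :
    phi N (I * y) = riemannZeta ((2 * N + 1 : ℕ) : ℂ) / 2 +
      (lambertS (2 * N + 1) (Real.exp (-(2 * Real.pi * y))) : ℝ) := by
  have hq0 := Real.exp_pos (-(2 * Real.pi * y))
  have hq1 : Real.exp (-(2 * Real.pi * y)) < 1 :=
    Real.exp_lt_one_iff.mpr (neg_lt_zero.mpr (by have := Real.pi_pos; positivity))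
  set q := Real.exp (-(2 * Real.pi * y)) with hq
  have hs := summable_lambertSummand hq0 hq1 (2 * N + 1)
  rw [← zetaSum_eq (by omega), zetaSum, lambertS, ofReal_tsum, phi, ← tsum_mul_left,
    div_eq_mul_inv (tsum _), ← tsum_mul_right, ← Summable.tsum_add
      ((summable_zetaSum (by omega)).mul_right _) (summable_ofReal.mpr hs)]
  refine tsum_congr fun m => ?_
  have hm : (m : ℂ) + 1 ≠ 0 := by exact_mod_cast Nat.succ_ne_zero m
  have e : exp (2 * Real.pi * I * ((m + 1) * (I * y))) = ((q ^ (m + 1) : ℝ) : ℂ) := by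
    rw [hq, ← Real.exp_nat_mul, ofReal_exp]
    congr 1
    push_cast
    linear_combination (2 * Real.pi * (m + 1) * y : ℂ) * I_sq
  have hne : (1 : ℂ) - (q ^ (m + 1) : ℝ) ≠ 0 := by
    have : q ^ (m + 1) < 1 := pow_lt_one₀ hq0.le hq1 (by omega)
    have h : (1 : ℝ) - q ^ (m + 1) ≠ 0 := by linarith
    exact_mod_cast h
  rw [cot_pi_eq (im_succ_mul_pos (by simpa using hy) m), e, lambertSummand]
  push_cast at hne ⊢
  field_simp
  rw [I_sq]
  ring

lemma lambertTerm_arg_eq (t : LambertTerm) :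
    t.arg = Real.exp (-(Real.pi * (t.d * Real.sqrt t.s))) := by
  rw [LambertTerm.arg, nome, ← Real.exp_mul]
  congr 1
  ring

/-- The ratio of successive summands is (n/(n+1))^k · q · (1-q^n)/(1-q^(n+1)), which tends to q, and
q = exp(-π√(d²s)). -/
lemma hasMerit_of_pos (t : LambertTerm) (hs : 0 < t.s) (hd : 0 < t.d) (k : ℕ) :
    Summable (fun m => lambertSummand k t.arg (m + 1)) ∧
      HasMerit (lambertSummand k t.arg) (t.merit : ℝ) := by
  have hsR : (0 : ℝ) < t.s := by exact_mod_cast hs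
  have hdR : (0 : ℝ) < t.d := by exact_mod_cast hd
  have hq0 : 0 < t.arg := by rw [lambertTerm_arg_eq]; exact Real.exp_pos _
  have hq1 : t.arg < 1 := by
    rw [lambertTerm_arg_eq]
    exact Real.exp_lt_one_iff.mpr (neg_lt_zero.mpr (by have := Real.pi_pos; positivity))
  refine ⟨summable_lambertSummand hq0 hq1 k, ?_⟩
  have hm : Real.exp (-Real.pi * Real.sqrt (t.merit : ℝ)) = t.arg := by
    rw [lambertTerm_arg_eq, LambertTerm.merit]
    push_cast
    rw [Real.sqrt_mul (by positivity), Real.sqrt_sq hdR.le]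
    congr 1
    ring
  rw [HasMerit, hm]
  set q := t.arg
  have hpow : Tendsto (fun n : ℕ => q ^ n) atTop (nhds 0) :=
    tendsto_pow_atTop_nhds_zero_of_lt_one hq0.le hq1
  have hpow1 : Tendsto (fun n : ℕ => q ^ (n + 1)) atTop (nhds 0) :=
    hpow.comp (tendsto_add_atTop_nat 1)
  have h1 : Tendsto (fun n : ℕ => (n : ℝ) / ((n : ℝ) + 1)) atTop (nhds 1) :=
    tendsto_natCast_div_add_atTop 1
  have h2 : Tendsto (fun n : ℕ => ((n : ℝ) / ((n : ℝ) + 1)) ^ k * (q * ((1 - q ^ n) /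
      (1 - q ^ (n + 1))))) atTop (nhds (1 ^ k * (q * ((1 - 0) / (1 - 0))))) :=
    (h1.pow k).mul (((hpow.const_sub 1).div (hpow1.const_sub 1) (by norm_num)).const_mul q)
  rw [one_pow, one_mul, sub_zero, div_one, mul_one] at h2
  refine h2.congr' ?_
  -- At n = 0 the summand is a junk value because its denominator 1 - q^0 vanishes, so the closed
  -- form of the ratio starts at n = 1.
  filter_upwards [eventually_ge_atTop 1] with n hn
  have hn0 : (n : ℝ) ≠ 0 := by exact_mod_cast (by omega : n ≠ 0)
  have hn1 : (n : ℝ) + 1 ≠ 0 := by positivity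
  have hqn : 1 - q ^ n ≠ 0 := by
    have : q ^ n < 1 := pow_lt_one₀ hq0.le hq1 (by omega)
    linarith
  have hqn1 : 1 - q ^ (n + 1) ≠ 0 := by
    have : q ^ (n + 1) < 1 := pow_lt_one₀ hq0.le hq1 (by omega)
    linarith
  rw [lambertSummand, lambertSummand]
  push_cast
  rw [div_pow, pow_succ q n]
  field_simp

/-! ### Quadratic points -/

lemma sqrtNeg_sq (D : ℕ) : sqrtNeg D ^ 2 = -D := by
  rw [sqrtNeg, mul_pow, I_sq, ← ofReal_pow, Real.sq_sqrt (Nat.cast_nonneg D)]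
  simp

/-- The value of `phi N` at `a + b √(-D)`. -/
def ph (N D : ℕ) (a b : ℚ) : ℂ := phi N (a + b * sqrtNeg D)

/-- The period function at `a + b √(-D)`. -/
def qper (N D : ℕ) (a b : ℚ) : ℂ := period N (a + b * sqrtNeg D)

/-- `i π^(2N+1)`. -/
def ipi (N : ℕ) : ℂ := I * (Real.pi : ℂ) ^ (2 * N + 1)

lemma quad_im (D : ℕ) (a b : ℚ) : ((a : ℂ) + b * sqrtNeg D).im = b * Real.sqrt D := by
  rw [← ofReal_ratCast a, ← ofReal_ratCast b, sqrtNeg, ← mul_assoc, ← ofReal_mul]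
  simp

lemma quad_im_pos {D : ℕ} (hD : 0 < D) (a : ℚ) {b : ℚ} (hb : 0 < b) :
    0 < ((a : ℂ) + b * sqrtNeg D).im := by
  rw [quad_im]
  have h1 : (0 : ℝ) < D := by exact_mod_cast hD
  have h2 : (0 : ℝ) < b := by exact_mod_cast hb
  positivity

/-- Congruence of real parts modulo 1 is expressed by `den = 1`, which `norm_num` decides for
explicit rationals. -/
lemma ph_congr {N D : ℕ} {a b a' b' : ℚ} (hb : b' = b) (ha : (a' - a).den = 1) :
    ph N D a' b' = ph N D a b := by
  have h : a' = a + (a' - a).num := by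
    rw [Rat.den_eq_one_iff] at ha
    rw [ha]; ring
  rw [ph, ph, h, hb]
  push_cast
  rw [show (a : ℂ) + ((a' - a).num : ℂ) + b * sqrtNeg D =
    a + b * sqrtNeg D + ((a' - a).num : ℂ) by ring, phi_add_int]

lemma sqrtNeg_conj (D : ℕ) : (starRingEnd ℂ) (sqrtNeg D) = -sqrtNeg D := by
  rw [sqrtNeg, map_mul, conj_ofReal, conj_I, mul_neg]

lemma ph_neg (N D : ℕ) (a b : ℚ) : ph N D (-a) b = (starRingEnd ℂ) (ph N D a b) := by
  rw [ph, ph, ← phi_neg_conj, map_add, map_mul, sqrtNeg_conj, ← ofReal_ratCast a,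
    ← ofReal_ratCast b, conj_ofReal, conj_ofReal]
  congr 1
  push_cast
  ring

lemma ph_zero_im (N D : ℕ) (b : ℚ) : (ph N D 0 b).im = 0 := by
  rw [← conj_eq_iff_im, ← ph_neg, neg_zero]

/-- One inversion followed by a translation, at τ = a + b√-D. The hypotheses on a' and b' say that
the target is -1/τ modulo 1, and `hz` says z = cτ². The scalar c is free: it clears denominators, so
that c^N and z^N are N-th powers of integers of the field, in a shape that lets several steps be
combined linearly. -/
lemma ph_step {N D : ℕ} (hN : 1 ≤ N) (hD : 0 < D) (a b a' b' : ℚ) (c z : ℂ)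
    (hz : z = c * ((a : ℂ) ^ 2 - D * (b : ℂ) ^ 2 + 2 * a * b * sqrtNeg D))
    (hb : 0 < b := by norm_num) (hb' : b' * (a ^ 2 + D * b ^ 2) = b := by norm_num)
    (ha' : (a' + a / (a ^ 2 + D * b ^ 2)).den = 1 := by norm_num) :
    z ^ N * ph N D a' b' = c ^ N * (ph N D a b + ipi N * qper N D a b) := by
  have him := quad_im_pos hD a hb
  have h0 : (a : ℂ) + b * sqrtNeg D ≠ 0 := fun h => by rw [h] at him; simp at him
  have hn : a ^ 2 + D * b ^ 2 ≠ 0 := fun h => by rw [h] at hb'; linarith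
  have hnC : (a : ℂ) ^ 2 + D * (b : ℂ) ^ 2 ≠ 0 := by exact_mod_cast hn
  have h1 : -1 / ((a : ℂ) + b * sqrtNeg D) =
      ((-a / (a ^ 2 + D * b ^ 2) : ℚ) : ℂ) + (b' : ℂ) * sqrtNeg D := by
    have : b' = b / (a ^ 2 + D * b ^ 2) := by rw [eq_div_iff hn, hb']
    rw [this]
    push_cast
    rw [div_eq_iff h0]
    field_simp
    linear_combination (-(b : ℂ) ^ 2) * sqrtNeg_sq D
  have h2 : ph N D a' b' = phi N (-1 / ((a : ℂ) + b * sqrtNeg D)) := by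
    rw [h1]
    refine ph_congr rfl ?_
    rwa [neg_div, sub_neg_eq_add]
  have h3 := phi_neg_one_div hN him
  have h4 : z = c * ((a : ℂ) + b * sqrtNeg D) ^ 2 := by
    rw [hz]
    linear_combination (-c * (b : ℂ) ^ 2) * sqrtNeg_sq D
  rw [h4, mul_pow, ← pow_mul, h2, mul_assoc, h3, ph, ipi, qper]

/-- The factor p^(2N) is written as (p²)^N, an N-th power like the factors in `ph_step`, so that
both kinds of relation can enter one linear combination. -/
lemma ph_hecke {N D p : ℕ} (hN : 1 ≤ N) (hD : 0 < D) (hp : p.Prime) (a : ℚ) {b : ℚ} (hb : 0 < b) :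
    ph N D (p * a) (p * b) + ((p : ℂ) ^ 2) ^ N *
        ∑ j ∈ Finset.range p, ph N D ((a + j) / p) (b / p) =
      (p * ((p : ℂ) ^ 2) ^ N + 1) * ph N D a b := by
  have h := phi_hecke hN hp (quad_im_pos hD a hb)
  rw [pow_succ, pow_mul, mul_comm _ (p : ℂ)] at h
  rw [ph, ph, ← h]
  congr 1
  · congr 1; push_cast; ring
  · congr 1
    refine Finset.sum_congr rfl fun j _ => ?_
    rw [ph]; congr 1; push_cast; ring

/-- The real parts are arbitrary representatives modulo 1, so that each use can name its points as
the neighbouring relations do. The same holds for the primes below. -/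
lemma ph_hecke_two {N D : ℕ} (hN : 1 ≤ N) (hD : 0 < D) (a b a' b' a₀ a₁ b₁ : ℚ)
    (hb : 0 < b := by norm_num) (h' : b' = 2 * b := by norm_num) (h₁ : b₁ = b / 2 := by norm_num)
    (e' : (a' - 2 * a).den = 1 := by norm_num) (e₀ : (a₀ - a / 2).den = 1 := by norm_num)
    (e₁ : (a₁ - (a + 1) / 2).den = 1 := by norm_num) :
    ph N D a' b' + 4 ^ N * (ph N D a₀ b₁ + ph N D a₁ b₁) = (2 * 4 ^ N + 1) * ph N D a b := by
  have h := ph_hecke hN hD Nat.prime_two a hb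
  simp only [Finset.sum_range_succ, Finset.sum_range_zero, zero_add, Nat.cast_ofNat, Nat.cast_zero,
    Nat.cast_one, add_zero] at h
  rw [ph_congr h' e', ph_congr h₁ e₀, ph_congr h₁ e₁]
  norm_num at h ⊢
  exact h

lemma ph_hecke_three {N D : ℕ} (hN : 1 ≤ N) (hD : 0 < D) (a b a' b' a₀ a₁ a₂ b₁ : ℚ)
    (hb : 0 < b := by norm_num) (h' : b' = 3 * b := by norm_num) (h₁ : b₁ = b / 3 := by norm_num)
    (e' : (a' - 3 * a).den = 1 := by norm_num) (e₀ : (a₀ - a / 3).den = 1 := by norm_num)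
    (e₁ : (a₁ - (a + 1) / 3).den = 1 := by norm_num)
    (e₂ : (a₂ - (a + 2) / 3).den = 1 := by norm_num) :
    ph N D a' b' + 9 ^ N * (ph N D a₀ b₁ + ph N D a₁ b₁ + ph N D a₂ b₁) =
      (3 * 9 ^ N + 1) * ph N D a b := by
  have h := ph_hecke hN hD Nat.prime_three a hb
  simp only [Finset.sum_range_succ, Finset.sum_range_zero, zero_add, Nat.cast_ofNat, Nat.cast_zero,
    Nat.cast_one, add_zero] at h
  rw [ph_congr h' e', ph_congr h₁ e₀, ph_congr h₁ e₁, ph_congr h₁ e₂]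
  norm_num at h ⊢
  exact h

lemma ph_hecke_five {N D : ℕ} (hN : 1 ≤ N) (hD : 0 < D) (a b a' b' a₀ a₁ a₂ a₃ a₄ b₁ : ℚ)
    (hb : 0 < b := by norm_num) (h' : b' = 5 * b := by norm_num) (h₁ : b₁ = b / 5 := by norm_num)
    (e' : (a' - 5 * a).den = 1 := by norm_num) (e₀ : (a₀ - a / 5).den = 1 := by norm_num)
    (e₁ : (a₁ - (a + 1) / 5).den = 1 := by norm_num)
    (e₂ : (a₂ - (a + 2) / 5).den = 1 := by norm_num)
    (e₃ : (a₃ - (a + 3) / 5).den = 1 := by norm_num)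
    (e₄ : (a₄ - (a + 4) / 5).den = 1 := by norm_num) :
    ph N D a' b' + 25 ^ N * (ph N D a₀ b₁ + ph N D a₁ b₁ + ph N D a₂ b₁ + ph N D a₃ b₁ +
      ph N D a₄ b₁) = (5 * 25 ^ N + 1) * ph N D a b := by
  have h := ph_hecke hN hD Nat.prime_five a hb
  simp only [Finset.sum_range_succ, Finset.sum_range_zero, zero_add, Nat.cast_ofNat, Nat.cast_zero,
    Nat.cast_one, add_zero] at h
  rw [ph_congr h' e', ph_congr h₁ e₀, ph_congr h₁ e₁, ph_congr h₁ e₂, ph_congr h₁ e₃,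
    ph_congr h₁ e₄]
  norm_num at h ⊢
  exact h

lemma ph_hecke_seven {N D : ℕ} (hN : 1 ≤ N) (hD : 0 < D) (a b a' b' a₀ a₁ a₂ a₃ a₄ a₅ a₆ b₁ : ℚ)
    (hb : 0 < b := by norm_num) (h' : b' = 7 * b := by norm_num) (h₁ : b₁ = b / 7 := by norm_num)
    (e' : (a' - 7 * a).den = 1 := by norm_num) (e₀ : (a₀ - a / 7).den = 1 := by norm_num)
    (e₁ : (a₁ - (a + 1) / 7).den = 1 := by norm_num)
    (e₂ : (a₂ - (a + 2) / 7).den = 1 := by norm_num)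
    (e₃ : (a₃ - (a + 3) / 7).den = 1 := by norm_num)
    (e₄ : (a₄ - (a + 4) / 7).den = 1 := by norm_num)
    (e₅ : (a₅ - (a + 5) / 7).den = 1 := by norm_num)
    (e₆ : (a₆ - (a + 6) / 7).den = 1 := by norm_num) :
    ph N D a' b' + 49 ^ N * (ph N D a₀ b₁ + ph N D a₁ b₁ + ph N D a₂ b₁ + ph N D a₃ b₁ +
      ph N D a₄ b₁ + ph N D a₅ b₁ + ph N D a₆ b₁) = (7 * 49 ^ N + 1) * ph N D a b := by
  have h := ph_hecke hN hD (by norm_num : Nat.Prime 7) a hb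
  simp only [Finset.sum_range_succ, Finset.sum_range_zero, zero_add, Nat.cast_ofNat, Nat.cast_zero,
    Nat.cast_one, add_zero] at h
  rw [ph_congr h' e', ph_congr h₁ e₀, ph_congr h₁ e₁, ph_congr h₁ e₂, ph_congr h₁ e₃,
    ph_congr h₁ e₄, ph_congr h₁ e₅, ph_congr h₁ e₆]
  norm_num at h ⊢
  exact h

/-- The Hecke operator of index six at a purely imaginary point `b √(-D)`. -/
lemma ph_hecke_six {N D : ℕ} (hN : 1 ≤ N) (hD : 0 < D)
    (b b₂ b₃ b₆ b₃₂ b₂₃ c₂ c₃ c₆ : ℚ)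
    (hb : 0 < b := by norm_num) (h₂ : b₂ = 2 * b := by norm_num) (h₃ : b₃ = 3 * b := by norm_num)
    (h₆ : b₆ = 6 * b := by norm_num) (h₃₂ : b₃₂ = 3 * b / 2 := by norm_num)
    (h₂₃ : b₂₃ = 2 * b / 3 := by norm_num) (k₂ : c₂ = b / 2 := by norm_num)
    (k₃ : c₃ = b / 3 := by norm_num) (k₆ : c₆ = b / 6 := by norm_num) :
    ph N D 0 b₆ + 4 ^ N * ph N D 0 b₃₂ + 9 ^ N * ph N D 0 b₂₃ + 36 ^ N * ph N D 0 c₆ =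
      (3 * 9 ^ N + 1) * (ph N D 0 b₂ + 4 ^ N * ph N D 0 c₂) +
      (2 * 4 ^ N + 1) * (ph N D 0 b₃ + 9 ^ N * ph N D 0 c₃) -
      (2 * 4 ^ N + 1) * (3 * 9 ^ N + 1) * ph N D 0 b +
      36 ^ N * (ph N D (1 / 6) c₆ + ph N D (-1 / 6) c₆) := by
  subst h₂ h₃ h₆ h₃₂ h₂₃ k₂ k₃ k₆
  have e : (36 : ℂ) ^ N = 4 ^ N * 9 ^ N := by rw [← mul_pow]; norm_num
  -- T_6 as a composite of T_2 and T_3. The representatives ±2/3 make the points of `t3a` and `t3b`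
  -- agree with those that T_2 produces at ±1/3; the points ±1/3 are removed by `t3`, and only ±1/6
  -- remain off the imaginary axis.
  have t3 := ph_hecke_three (N := N) hN hD 0 b 0 (3 * b) 0 (1 / 3) (-1 / 3) (b / 3) hb rfl rfl
  have t3a := ph_hecke_three (N := N) hN hD 0 (2 * b) 0 (6 * b) 0 (-2 / 3) (2 / 3) (2 * b / 3)
    (by linarith) (by ring) (by ring)
  have t3b := ph_hecke_three (N := N) hN hD 0 (b / 2) 0 (3 * b / 2) 0 (-2 / 3) (2 / 3) (b / 6)
    (by linarith) (by ring) (by ring)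
  have t2a := ph_hecke_two (N := N) hN hD (1 / 3) (b / 3) (2 / 3) (2 * b / 3) (1 / 6) (2 / 3)
    (b / 6)
    (by linarith) (by ring) (by ring)
  have t2b := ph_hecke_two (N := N) hN hD (-1 / 3) (b / 3) (-2 / 3) (2 * b / 3) (-1 / 6) (-2 / 3)
    (b / 6) (by linarith) (by ring) (by ring)
  rw [e]
  linear_combination t3a + 4 ^ N * t3b - 9 ^ N * t2a - 9 ^ N * t2b - (2 * 4 ^ N + 1) * t3

/-! ### The field `ℚ(√-D)` -/

/-- The field `ℚ(√-D)` as a subfield of the complex numbers. -/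
def quadField (D : ℕ) : Subfield ℂ where
  carrier := {z | ∃ a b : ℚ, z = a + b * sqrtNeg D}
  zero_mem' := ⟨0, 0, by simp⟩
  one_mem' := ⟨1, 0, by simp⟩
  add_mem' := by
    rintro _ _ ⟨a, b, rfl⟩ ⟨a', b', rfl⟩
    exact ⟨a + a', b + b', by push_cast; ring⟩
  neg_mem' := by
    rintro _ ⟨a, b, rfl⟩
    exact ⟨-a, -b, by push_cast; ring⟩
  mul_mem' := by
    rintro _ _ ⟨a, b, rfl⟩ ⟨a', b', rfl⟩
    refine ⟨a * a' - D * b * b', a * b' + b * a', ?_⟩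
    push_cast
    linear_combination ((b : ℂ) * b') * sqrtNeg_sq D
  inv_mem' := by
    rintro _ ⟨a, b, rfl⟩
    by_cases h0 : (a : ℂ) + b * sqrtNeg D = 0
    · exact ⟨0, 0, by simp [h0]⟩
    refine ⟨a / (a ^ 2 + D * b ^ 2), -b / (a ^ 2 + D * b ^ 2), ?_⟩
    -- A vanishing norm forces a = 0 and b√D = 0, also in the degenerate case D = 0.
    have hn : (a : ℂ) ^ 2 + D * (b : ℂ) ^ 2 ≠ 0 := by
      intro h
      have h' : (a : ℝ) ^ 2 + D * (b : ℝ) ^ 2 = 0 := by exact_mod_cast h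
      have hD : (0 : ℝ) ≤ D := Nat.cast_nonneg D
      have ha : (a : ℝ) = 0 := by nlinarith [sq_nonneg (a : ℝ), mul_nonneg hD (sq_nonneg (b : ℝ))]
      have hb : (b : ℝ) * Real.sqrt D = 0 := by
        have : ((b : ℝ) * Real.sqrt D) ^ 2 = 0 := by
          rw [mul_pow, Real.sq_sqrt hD]
          rw [ha] at h'
          linarith
        exact pow_eq_zero_iff two_ne_zero |>.mp this
      apply h0
      rw [sqrtNeg, ← ofReal_ratCast a, ← ofReal_ratCast b, ← mul_assoc, ← ofReal_mul, hb, ha]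
      simp
    refine inv_eq_of_mul_eq_one_right ?_
    push_cast
    rw [show ((a : ℂ) + b * sqrtNeg D) * (a / (a ^ 2 + D * b ^ 2) +
      -b / (a ^ 2 + D * b ^ 2) * sqrtNeg D) = (a + b * sqrtNeg D) * (a - b * sqrtNeg D) /
      (a ^ 2 + D * b ^ 2) by ring, div_eq_one_iff_eq hn]
    linear_combination (-(b : ℂ) ^ 2) * sqrtNeg_sq D

lemma quad_mem (D : ℕ) (a b : ℚ) : (a : ℂ) + b * sqrtNeg D ∈ quadField D := ⟨a, b, rfl⟩

lemma sqrtNeg_mem (D : ℕ) : sqrtNeg D ∈ quadField D := ⟨0, 1, by simp⟩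

lemma ratCast_mem_quadField (D : ℕ) (a : ℚ) : (a : ℂ) ∈ quadField D := ⟨a, 0, by simp⟩

/-- The period function is a Laurent polynomial with rational coefficients. -/
lemma qper_mem (N D : ℕ) (a b : ℚ) : qper N D a b ∈ quadField D := by
  have h := quad_mem D a b
  rw [qper, period]
  refine sub_mem (sum_mem fun j _ => mul_mem (ratCast_mem_quadField _ _) (pow_mem h _))
    (mul_mem (ratCast_mem_quadField _ _) (add_mem (div_mem (one_mem _) h) (pow_mem h _)))

/-! ### From relations between values of `phi` to evaluations of `ζ` -/

/-- The argument of the Lambert series of `t` is `exp (2πi r √(-D))`. -/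
structure IsPoint (D : ℕ) (t : LambertTerm) (r : ℚ) : Prop where
  pos : 0 < r
  s_pos : 0 < t.s
  d_pos : 0 < t.d
  eq : t.d ^ 2 * t.s = 4 * D * r ^ 2

lemma lambertS_eq_ph {N D : ℕ} (hN : 1 ≤ N) {t : LambertTerm} {r : ℚ} (hD : 0 < D)
    (h : IsPoint D t r) :
    ((lambertS (2 * N + 1) t.arg : ℝ) : ℂ) =
      ph N D 0 r - riemannZeta ((2 * N + 1 : ℕ) : ℂ) / 2 := by
  have hr : (0 : ℝ) < r := by exact_mod_cast h.pos
  have hs : (0 : ℝ) < t.s := by exact_mod_cast h.s_pos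
  have hd : (0 : ℝ) < t.d := by exact_mod_cast h.d_pos
  have hDR : (0 : ℝ) < D := by exact_mod_cast hD
  have e : (t.d : ℝ) * Real.sqrt t.s = 2 * ((r : ℝ) * Real.sqrt D) := by
    have h1 : (t.d : ℝ) ^ 2 * t.s = 4 * D * (r : ℝ) ^ 2 := by exact_mod_cast h.eq
    rw [← sq_eq_sq₀ (by positivity) (by positivity), mul_pow, mul_pow, mul_pow,
      Real.sq_sqrt hs.le, Real.sq_sqrt hDR.le, h1]
    ring
  have h2 := phi_I_mul hN (y := (r : ℝ) * Real.sqrt D) (by positivity)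
  rw [lambertTerm_arg_eq, e, ph]
  have e3 : ((0 : ℚ) : ℂ) + r * sqrtNeg D = I * (((r : ℝ) * Real.sqrt D : ℝ) : ℂ) := by
    rw [sqrtNeg]; push_cast; ring
  rw [e3, h2, show Real.pi * (2 * ((r : ℝ) * Real.sqrt D)) =
    2 * Real.pi * (r * Real.sqrt D) by ring]
  ring

/-- `∑ c · phi(r √(-D))` over a list of terms and the list of their points. -/
def relSum (N D : ℕ) (T : List LambertTerm) (L : List ℚ) : ℂ :=
  (List.zipWith (fun t r => (t.c : ℂ) * ph N D 0 r) T L).sum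

lemma lambertSum_eq {N D : ℕ} (hN : 1 ≤ N) (hD : 0 < D) {T : List LambertTerm} {L : List ℚ}
    (h : List.Forall₂ (IsPoint D) T L) :
    ((lambertSum (2 * N + 1) T : ℝ) : ℂ) = relSum N D T L -
      (((T.map LambertTerm.c).sum : ℝ) : ℂ) * (riemannZeta ((2 * N + 1 : ℕ) : ℂ) / 2) := by
  induction h with
  | nil => simp [lambertSum, relSum]
  | @cons t r T L h _ ih =>
    rw [lambertSum] at ih ⊢
    rw [relSum] at ih ⊢
    simp only [List.map_cons, List.sum_cons, List.zipWith_cons_cons]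
    rw [ofReal_add, ofReal_mul, ih, lambertS_eq_ph hN hD h]
    push_cast
    ring

/-- Every point of the list lies on the imaginary axis, where `phi` is real. -/
lemma relSum_im (N D : ℕ) (T : List LambertTerm) (L : List ℚ) : (relSum N D T L).im = 0 := by
  induction T generalizing L with
  | nil => simp [relSum]
  | cons t T ih =>
    cases L with
    | nil => simp [relSum]
    | cons r L =>
      have h := ih L
      rw [relSum] at h ⊢
      simp only [List.zipWith_cons_cons, List.sum_cons, add_im, h, im_ofReal_mul, ph_zero_im,
        mul_zero, add_zero]

/-- Each Lambert series is a value of `phi` minus ζ/2, so the coefficient of ζ is minus half the sum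
of the coefficients. The power of π comes from iπ^k · β√-D = -βπ^k√D. -/
theorem evaluates_of_relSum {N D : ℕ} (hN : 1 ≤ N) (hD : 0 < D) {T : List LambertTerm} {L : List ℚ}
    (h : List.Forall₂ (IsPoint D) T L) {v : ℝ} (hv : 2 * v = -(T.map LambertTerm.c).sum) {β : ℚ}
    (hE : relSum N D T L = ipi N * (β * sqrtNeg D)) :
    Evaluates (2 * N + 1) v (β * Real.sqrt D * Real.pi ^ (2 * N + 1)) T := by
  rw [Evaluates, ofReal_add, lambertSum_eq hN hD h, hE, sqrtNeg, ipi]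
  have hv' : (T.map LambertTerm.c).sum = -(2 * v) := by rw [hv, neg_neg]
  rw [hv']
  push_cast
  linear_combination (-(β : ℂ) * Real.sqrt D * (Real.pi : ℂ) ^ (2 * N + 1)) * I_sq

/-- For E = a + b√-D the imaginary part of iπ^k E is aπ^k, and the relation is real, so a = 0.
Membership of E in the field thus suffices: the rational factor of √D π^k need not be computed. -/
theorem exists_evaluates_of_relSum {N D : ℕ} (hN : 1 ≤ N) (hD : 0 < D) {T : List LambertTerm}
    {L : List ℚ} (h : List.Forall₂ (IsPoint D) T L) {v : ℝ}
    (hv : 2 * v = -(T.map LambertTerm.c).sum) {E : ℂ} (hEK : E ∈ quadField D)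
    (hE : relSum N D T L = ipi N * E) :
    ∃ r : ℚ, Evaluates (2 * N + 1) v (r * Real.sqrt D * Real.pi ^ (2 * N + 1)) T := by
  obtain ⟨a, b, rfl⟩ := hEK
  refine ⟨b, evaluates_of_relSum hN hD h hv ?_⟩
  have h0 := relSum_im N D T L
  have e : ipi N * (a + b * sqrtNeg D) =
      ((Real.pi ^ (2 * N + 1) : ℝ) : ℂ) * (((a : ℝ) : ℂ) * I + ((-(b * Real.sqrt D) : ℝ) : ℂ)) := by
    rw [sqrtNeg, ipi]
    push_cast
    linear_combination ((Real.pi : ℂ) ^ (2 * N + 1) * b * Real.sqrt D) * I_sq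
  rw [hE, e, im_ofReal_mul] at h0
  have ha : (a : ℝ) = 0 := by
    have : Real.pi ^ (2 * N + 1) ≠ 0 := pow_ne_zero _ Real.pi_ne_zero
    simpa [this] using h0
  have ha' : a = 0 := by exact_mod_cast ha
  rw [hE, ha']
  simp

/-! ### Explicit periods -/

lemma zetaRat_one : zetaRat 1 = 1 / 6 := by
  rw [zetaRat]; norm_num [bernoulli_two]

lemma bernoulli_four_eq : bernoulli 4 = -1 / 30 := by
  rw [bernoulli_eq_bernoulli'_of_ne_one (by norm_num), bernoulli'_four]

lemma bernoulli'_six_eq : bernoulli' 6 = 1 / 42 := by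
  have h5 : bernoulli' 5 = 0 := bernoulli'_eq_zero_of_odd (by decide) (by norm_num)
  rw [bernoulli'_def]
  norm_num [Finset.sum_range_succ, Finset.sum_range_zero, h5, Nat.choose]

lemma bernoulli'_eight_eq : bernoulli' 8 = -1 / 30 := by
  have h5 : bernoulli' 5 = 0 := bernoulli'_eq_zero_of_odd (by decide) (by norm_num)
  have h7 : bernoulli' 7 = 0 := bernoulli'_eq_zero_of_odd (by decide) (by norm_num)
  rw [bernoulli'_def]
  norm_num [Finset.sum_range_succ, Finset.sum_range_zero, h5, h7, bernoulli'_six_eq, Nat.choose]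

lemma zetaRat_two : zetaRat 2 = 1 / 90 := by
  rw [zetaRat]; norm_num [bernoulli_four_eq, Nat.factorial]

lemma zetaRat_three : zetaRat 3 = 1 / 945 := by
  rw [zetaRat]
  norm_num [bernoulli_eq_bernoulli'_of_ne_one, bernoulli'_six_eq, Nat.factorial]

lemma zetaRat_four : zetaRat 4 = 1 / 9450 := by
  rw [zetaRat]
  norm_num [bernoulli_eq_bernoulli'_of_ne_one, bernoulli'_eight_eq, Nat.factorial]

lemma one_div_quad {D : ℕ} {a b n : ℚ} (hn : n ≠ 0) (h : a ^ 2 + D * b ^ 2 = n) :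
    1 / ((a : ℂ) + b * sqrtNeg D) = (a / n - b / n * sqrtNeg D) := by
  have hn' : (n : ℂ) ≠ 0 := by exact_mod_cast hn
  have e : ((a : ℂ) + b * sqrtNeg D) * (a - b * sqrtNeg D) = n := by
    rw [← h]; push_cast
    linear_combination (-(b : ℂ) ^ 2) * sqrtNeg_sq D
  have h0 : (a : ℂ) + b * sqrtNeg D ≠ 0 := fun h0 => hn' (by rw [← e, h0, zero_mul])
  rw [div_eq_iff h0]
  field_simp
  rw [← e]; ring

lemma period_one (τ : ℂ) : period 1 τ = τ / 36 - (1 / τ + τ ^ 3) / 180 := by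
  norm_num [period, Finset.sum_range_succ, zetaRat_one, zetaRat_two]
  ring

lemma period_two (τ : ℂ) : period 2 τ = (τ + τ ^ 3) / 540 - (1 / τ + τ ^ 5) / 1890 := by
  norm_num [period, Finset.sum_range_succ, zetaRat_one, zetaRat_two, zetaRat_three]
  ring

lemma period_three (τ : ℂ) :
    period 3 τ = (τ + τ ^ 5) / 5670 + τ ^ 3 / 8100 - (1 / τ + τ ^ 7) / 18900 := by
  norm_num [period, Finset.sum_range_succ, zetaRat_one, zetaRat_two, zetaRat_three, zetaRat_four]
  ring

lemma quad_sq (D : ℕ) {a b p q : ℚ} (hp : p = a ^ 2 - D * b ^ 2) (hq : q = 2 * a * b) :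
    ((a : ℂ) + b * sqrtNeg D) ^ 2 = p + q * sqrtNeg D := by
  rw [hp, hq]; push_cast; linear_combination ((b : ℂ) ^ 2) * sqrtNeg_sq D

/-- Here n is the norm of τ = a + b√-D and p + q√-D is its square. Supplying these intermediate
values and the result as numerals reduces each evaluation to rational checks by `norm_num`; the next
two lemmas follow the same scheme with further powers. -/
lemma qper_one {D : ℕ} (a b n p q x y : ℚ) (hn : n ≠ 0 := by norm_num)
    (h : a ^ 2 + D * b ^ 2 = n := by norm_num)
    (hp : p = a ^ 2 - D * b ^ 2 := by norm_num) (hq : q = 2 * a * b := by norm_num)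
    (hx : x = a / 36 - (a / n + a * p - D * b * q) / 180 := by norm_num)
    (hy : y = b / 36 - (-b / n + b * p + a * q) / 180 := by norm_num) :
    qper 1 D a b = x + y * sqrtNeg D := by
  rw [qper, period_one, pow_succ _ 2, quad_sq D hp hq, one_div_quad hn h, hx, hy]
  push_cast
  linear_combination (-(b : ℂ) * q / 180) * sqrtNeg_sq D

lemma qper_two {D : ℕ} (a b n p q p₂ q₂ x y : ℚ) (hn : n ≠ 0 := by norm_num)
    (h : a ^ 2 + D * b ^ 2 = n := by norm_num)
    (hp : p = a ^ 2 - D * b ^ 2 := by norm_num) (hq : q = 2 * a * b := by norm_num)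
    (hp₂ : p₂ = p ^ 2 - D * q ^ 2 := by norm_num) (hq₂ : q₂ = 2 * p * q := by norm_num)
    (hx : x = (a * (1 + p) - D * b * q) / 540 - (a / n + a * p₂ - D * b * q₂) / 1890 := by norm_num)
    (hy : y = (b * (1 + p) + a * q) / 540 - (-b / n + b * p₂ + a * q₂) / 1890 := by norm_num) :
    qper 2 D a b = x + y * sqrtNeg D := by
  rw [qper, period_two, pow_succ _ 2, pow_succ _ 4, show (4 : ℕ) = 2 * 2 by rfl, pow_mul,
    quad_sq D hp hq, quad_sq D hp₂ hq₂, one_div_quad hn h, hx, hy]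
  push_cast
  linear_combination ((b : ℂ) * q / 540 - (b : ℂ) * q₂ / 1890) * sqrtNeg_sq D

lemma qper_three {D : ℕ} (a b n p q p₂ q₂ p₃ q₃ x y : ℚ) (hn : n ≠ 0 := by norm_num)
    (h : a ^ 2 + D * b ^ 2 = n := by norm_num)
    (hp : p = a ^ 2 - D * b ^ 2 := by norm_num) (hq : q = 2 * a * b := by norm_num)
    (hp₂ : p₂ = p ^ 2 - D * q ^ 2 := by norm_num) (hq₂ : q₂ = 2 * p * q := by norm_num)
    (hp₃ : p₃ = p * p₂ - D * q * q₂ := by norm_num) (hq₃ : q₃ = p * q₂ + q * p₂ := by norm_num)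
    (hx : x = (a * (1 + p₂) - D * b * q₂) / 5670 + (a * p - D * b * q) / 8100 -
      (a / n + a * p₃ - D * b * q₃) / 18900 := by norm_num)
    (hy : y = (b * (1 + p₂) + a * q₂) / 5670 + (b * p + a * q) / 8100 -
      (-b / n + b * p₃ + a * q₃) / 18900 := by norm_num) :
    qper 3 D a b = x + y * sqrtNeg D := by
  have e : ((a : ℂ) + b * sqrtNeg D) ^ 6 = p₃ + q₃ * sqrtNeg D := by
    rw [show (6 : ℕ) = 2 + 2 * 2 by rfl, pow_add, pow_mul, quad_sq D hp hq, quad_sq D hp₂ hq₂,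
      hp₃, hq₃]
    push_cast
    linear_combination (q * q₂ : ℂ) * sqrtNeg_sq D
  rw [qper, period_three, pow_succ _ 2, pow_succ _ 4, pow_succ _ 6, e, show (4 : ℕ) = 2 * 2 by rfl,
    pow_mul, quad_sq D hp hq, quad_sq D hp₂ hq₂, one_div_quad hn h, hx, hy]
  push_cast
  linear_combination ((b : ℂ) * q₂ / 5670 + (b : ℂ) * q / 8100 - (b : ℂ) * q₃ / 18900) *
    sqrtNeg_sq D

/-! ### Building families -/

lemma X_cast (n : ℕ) : ((X (2 * n + 1) : ℝ) : ℂ) = 2 * 4 ^ n + 1 := by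
  rw [X, pow_succ, pow_mul]; push_cast; norm_num; ring

lemma Y_cast (n : ℕ) : ((Y (2 * n + 1) : ℝ) : ℂ) = 3 * 9 ^ n + 1 := by
  rw [Y, pow_succ, pow_mul]; push_cast; norm_num; ring

lemma X_eq (n : ℕ) : X (2 * n + 1) = 2 * 4 ^ n + 1 := by
  rw [X, pow_succ, pow_mul]; norm_num; ring

lemma Y_eq (n : ℕ) : Y (2 * n + 1) = 3 * 9 ^ n + 1 := by
  rw [Y, pow_succ, pow_mul]; norm_num; ring

lemma two_re_cast (z : ℂ) : ((2 * z.re : ℝ) : ℂ) = z + (starRingEnd ℂ) z := by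
  rw [add_conj]

/-- The real numbers whose product with a power of two is an integer. -/
def dyadic : Subring ℝ where
  carrier := {x | ∃ (j : ℕ) (z : ℤ), 2 ^ j * x = z}
  zero_mem' := ⟨0, 0, by simp⟩
  one_mem' := ⟨0, 1, by simp⟩
  add_mem' := by
    rintro x y ⟨i, a, ha⟩ ⟨j, b, hb⟩
    refine ⟨i + j, 2 ^ j * a + 2 ^ i * b, ?_⟩
    push_cast
    rw [← ha, ← hb]
    ring
  neg_mem' := by
    rintro x ⟨i, a, ha⟩
    refine ⟨i, -a, ?_⟩
    push_cast
    rw [← ha]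
    ring
  mul_mem' := by
    rintro x y ⟨i, a, ha⟩ ⟨j, b, hb⟩
    refine ⟨i + j, a * b, ?_⟩
    push_cast
    rw [← ha, ← hb]
    ring

lemma div_two_pow_mem_dyadic {x : ℝ} (hx : x ∈ dyadic) (m : ℕ) : x / 2 ^ m ∈ dyadic := by
  obtain ⟨j, z, h⟩ := hx
  refine ⟨j + m, z, ?_⟩
  rw [← h, pow_add]
  field_simp

lemma div_four_pow_mem_dyadic {x : ℝ} (hx : x ∈ dyadic) (m : ℕ) : x / 4 ^ m ∈ dyadic := by
  have := div_two_pow_mem_dyadic hx (2 * m)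
  rw [pow_mul] at this
  norm_num at this
  exact this

lemma X_mem_dyadic (k : ℕ) : X k ∈ dyadic :=
  add_mem (pow_mem (ofNat_mem _ 2) _) (one_mem _)

lemma Y_mem_dyadic (k : ℕ) : Y k ∈ dyadic :=
  add_mem (pow_mem (ofNat_mem _ 3) _) (one_mem _)

lemma X_pos (k : ℕ) : 0 < X k := by rw [X]; positivity

lemma Y_pos (k : ℕ) : 0 < Y k := by rw [Y]; positivity

lemma isPoint_iff {D : ℕ} {t : LambertTerm} {r : ℚ} : IsPoint D t r ↔
    0 < r ∧ 0 < t.s ∧ 0 < t.d ∧ t.d ^ 2 * t.s = 4 * D * r ^ 2 :=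
  ⟨fun h => ⟨h.1, h.2, h.3, h.4⟩, fun h => ⟨h.1, h.2.1, h.2.2.1, h.2.2.2⟩⟩

lemma exists_point_of_mem {D : ℕ} {T : List LambertTerm} {L : List ℚ} {t : LambertTerm}
    (h : List.Forall₂ (IsPoint D) T L) (ht : t ∈ T) : ∃ r, IsPoint D t r := by
  induction h with
  | nil => simp at ht
  | @cons x y _ _ hxy _ ih =>
    rcases List.mem_cons.mp ht with rfl | ht
    · exact ⟨y, hxy⟩
    · exact ih ht

/-- The list of points does not depend on n, only the coefficients do. A family is reduced to a
relation with period in the field, the sum of its coefficients, and arithmetic statements about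
them. The bound on the merits is asked of all terms, including those whose coefficient may vanish;
nonvanishing is needed only for one term of least merit. -/
theorem isFamily_of_relSum {I : Set ℕ} {k : ℕ → ℕ} {D : ℕ} {a : ℚ} {v : ℕ → ℝ}
    {T : ℕ → List LambertTerm} (N : ℕ → ℕ) (L : List ℚ) (hD : 0 < D) (hN : ∀ n ∈ I, 1 ≤ N n)
    (hk : ∀ n, k n = 2 * N n + 1) (hL : ∀ n, List.Forall₂ (IsPoint D) (T n) L)
    (hrel : ∀ n ∈ I, ∃ E ∈ quadField D, relSum (N n) D (T n) L = ipi (N n) * E)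
    (hv : ∀ n ∈ I, 2 * v n = -((T n).map LambertTerm.c).sum)
    (hz : ∀ n ∈ I, ∃ z : ℤ, z ≠ 0 ∧ 2 * v n = z) (hc : ∀ n ∈ I, ∀ t ∈ T n, t.c ∈ dyadic)
    (hle : ∀ n ∈ I, ∀ t ∈ T n, a ≤ t.merit) (hmem : ∀ n ∈ I, ∃ t ∈ T n, t.c ≠ 0 ∧ t.merit = a)
    (ha : 4 < a) : IsFamily I k D a v T where
  evaluates n hn := by
    obtain ⟨E, hE, h⟩ := hrel n hn
    simp only [hk]
    exact exists_evaluates_of_relSum (hN n hn) hD (hL n) (hv n hn) hE h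
  denominator := hz
  coefficient n hn t ht := hc n hn t ht
  hasMerit n hn t ht := by
    obtain ⟨r, hr⟩ := exists_point_of_mem (hL n) ht
    exact hasMerit_of_pos t hr.s_pos hr.d_pos _
  least n hn := by
    refine ⟨hmem n hn, ?_⟩
    rintro x ⟨t, ht, -, rfl⟩
    exact hle n hn t ht
  four_lt := ha

/-! ### Discriminant `-8` -/

lemma tauTwo_cast (n : ℕ) :
    ((tauTwo n : ℝ) : ℂ) = ((-1 + 2 * sqrtNeg 2) ^ n + (-1 - 2 * sqrtNeg 2) ^ n) / 2 := by
  have h1 : (1 + sqrtNeg 2) ^ 2 = -1 + 2 * sqrtNeg 2 := by linear_combination sqrtNeg_sq 2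
  have h2 : ((2 * tauTwo n : ℝ) : ℂ) = (-1 + 2 * sqrtNeg 2) ^ n + (-1 - 2 * sqrtNeg 2) ^ n := by
    rw [tauTwo, two_re_cast, pow_mul, h1, map_pow, map_add, map_mul, sqrtNeg_conj, map_neg, map_one,
      map_ofNat]
    ring
  rw [← h2]
  push_cast
  ring

/-- The period of the relation of discriminant `-8`. -/
def famGPeriod (n : ℕ) : ℂ :=
  2 * 9 ^ n * (qper n 2 0 (2 / 3) + qper n 2 (-2 / 3) (2 / 3) + qper n 2 (2 / 3) (2 / 3)) -
    2 * ((-1 + 2 * sqrtNeg 2) ^ n + (-1 - 2 * sqrtNeg 2) ^ n) * 4 ^ n * qper n 2 0 (1 / 2)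

/-- T_3 at 2√-2 leaves the points (±2+2√-2)/3, which both invert to (1+√-2)/2 with conjugate
factors, whose sum is rational. T_2 at √-2 expresses the value there by imaginary points, √-2/2
being inverted to √-2. -/
theorem famG_relSum {n : ℕ} (hn : 1 ≤ n) :
    relSum n 2 (famG n) [3 / 4, 1, 2, 6] = ipi n * famGPeriod n := by
  have t3 := ph_hecke_three hn two_pos 0 2 0 6 0 (-2 / 3) (2 / 3) (2 / 3)
  have t2 := ph_hecke_two hn two_pos 0 1 0 2 0 (1 / 2) (1 / 2)
  have s1 := ph_step hn two_pos 0 (2 / 3) 0 (3 / 4) 9 (-8) (by push_cast; ring)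
  have s2 := ph_step hn two_pos (-2 / 3) (2 / 3) (1 / 2) (1 / 2) 9 (4 * (-1 - 2 * sqrtNeg 2))
    (by push_cast; ring)
  have s3 := ph_step hn two_pos (2 / 3) (2 / 3) (1 / 2) (1 / 2) 9 (4 * (-1 + 2 * sqrtNeg 2))
    (by push_cast; ring)
  have s4 := ph_step hn two_pos 0 (1 / 2) 0 1 4 (-2) (by push_cast; ring)
  rw [mul_pow] at s2 s3
  simp only [relSum, famG, List.zipWith_cons_cons, List.zipWith_nil_left, List.sum_cons,
    List.sum_nil]
  push_cast
  rw [tauTwo_cast, X_cast, Y_cast, famGPeriod]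
  linear_combination 2 * t3 + 2 * s1 + 2 * s2 + 2 * s3 -
    2 * ((-1 + 2 * sqrtNeg 2) ^ n + (-1 - 2 * sqrtNeg 2) ^ n) * (t2 + s4)

lemma famGPeriod_mem (n : ℕ) : famGPeriod n ∈ quadField 2 := by
  rw [famGPeriod]
  repeat' first
    | exact qper_mem _ _ _ _ | exact sqrtNeg_mem _ | exact one_mem _ | exact ofNat_mem _ _
    | apply add_mem | apply sub_mem | apply mul_mem | apply neg_mem | apply pow_mem

lemma famG_isPoint (n : ℕ) : List.Forall₂ (IsPoint 2) (famG n) [3 / 4, 1, 2, 6] := by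
  simp only [famG, List.forall₂_cons, isPoint_iff, List.Forall₂.nil, and_true]
  norm_num

lemma two_mul_tSeq (n : ℕ) : 2 * tSeq n = -((famG n).map LambertTerm.c).sum := by
  simp only [famG, List.map_cons, List.map_nil, List.sum_cons, List.sum_nil, X_eq, Y_eq]
  rw [tSeq, ← tauTwo, pow_mul (-2 : ℝ), pow_succ (3 : ℝ), pow_mul (3 : ℝ), pow_add (2 : ℝ),
    pow_mul (2 : ℝ)]
  norm_num
  ring

lemma famGPeriod_one : famGPeriod 1 = (181 / 120 : ℚ) * sqrtNeg 2 := by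
  rw [famGPeriod, qper_one 0 (2 / 3) (8 / 9) (-8 / 9) 0 0 (101 / 3888),
    qper_one (-2 / 3) (2 / 3) (4 / 3) (-4 / 9) (-8 / 9) (-233 / 9720) (191 / 9720),
    qper_one (2 / 3) (2 / 3) (4 / 3) (-4 / 9) (8 / 9) (233 / 9720) (191 / 9720),
    qper_one 0 (1 / 2) (1 / 2) (-1 / 2) 0 0 (1 / 48)]
  push_cast
  ring

lemma famGPeriod_two : famGPeriod 2 = (5171 / 3780 : ℚ) * sqrtNeg 2 := by
  have h : (-1 + 2 * sqrtNeg 2) ^ 2 + (-1 - 2 * sqrtNeg 2) ^ 2 = -14 := by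
    linear_combination 8 * sqrtNeg_sq 2
  rw [famGPeriod, h, qper_two 0 (2 / 3) (8 / 9) (-8 / 9) 0 (64 / 81) 0 0 (67 / 262440),
    qper_two (-2 / 3) (2 / 3) (4 / 3) (-4 / 9) (-8 / 9) (-112 / 81) (64 / 81) (1693 / 918540)
      (517 / 183708),
    qper_two (2 / 3) (2 / 3) (4 / 3) (-4 / 9) (8 / 9) (-112 / 81) (-64 / 81) (-1693 / 918540)
      (517 / 183708),
    qper_two 0 (1 / 2) (1 / 2) (-1 / 2) 0 (1 / 4) 0 0 (1 / 1080)]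
  push_cast
  ring

/-- Normalizes the smallest members of the families to the printed evaluations. -/
lemma Evaluates.scale {k : ℕ} {v p : ℝ} {T : List LambertTerm} (h : Evaluates k v p T) (c : ℝ)
    {v' p' : ℝ} {T' : List LambertTerm} (hv : v' = c * v) (hp : p' = c * p)
    (hT : T' = T.map fun t => ⟨t.s, t.d, c * t.c⟩) : Evaluates k v' p' T' := by
  have e : lambertSum k T' = c * lambertSum k T := by
    subst hT
    simp only [lambertSum, List.map_map]
    rw [← List.sum_map_mul_left]
    congr 1
    refine List.map_congr_left fun t _ => ?_
    simp only [Function.comp, LambertTerm.arg]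
    ring
  rw [Evaluates] at h ⊢
  rw [hv, hp, e, ← mul_add, ofReal_mul, ofReal_mul, ← h, mul_assoc]

lemma tauTwo_one : tauTwo 1 = -1 := by
  have h := tauTwo_cast 1
  norm_num at h
  exact_mod_cast h

lemma tSeq_one : tSeq 1 = 55 := by
  rw [tSeq, ← tauTwo, tauTwo_one]; norm_num

theorem evaluates_three_disc_eight : Evaluates 3 1 (181 * √2 / 6600 * Real.pi ^ 3)
    [⟨1/2, 3, -16/55⟩, ⟨2, 2, -4/5⟩, ⟨2, 4, -52/55⟩, ⟨2, 12, 2/55⟩] := by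
  have h := evaluates_of_relSum le_rfl two_pos (famG_isPoint 1) (two_mul_tSeq 1)
    (by rw [famG_relSum le_rfl, famGPeriod_one])
  refine h.scale (1 / 55) (by rw [tSeq_one]; norm_num) (by push_cast; ring) ?_
  simp only [famG, List.map_cons, List.map_nil, tauTwo_one, X_eq, Y_eq]
  norm_num

/-! ### Discriminant `-3`, merit `16/3` -/

lemma cubeRoot_pow (n : ℕ) : ((-1 + sqrtNeg 3) / 2) ^ (3 * n) = 1 := by
  have h : ((-1 + sqrtNeg 3) / 2) ^ 3 = 1 := by
    linear_combination ((sqrtNeg 3 - 3) / 8) * sqrtNeg_sq 3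
  rw [pow_mul, h, one_pow]

lemma cubeRoot'_pow (n : ℕ) : ((-1 - sqrtNeg 3) / 2) ^ (3 * n) = 1 := by
  have h : ((-1 - sqrtNeg 3) / 2) ^ 3 = 1 := by
    linear_combination ((-sqrtNeg 3 - 3) / 8) * sqrtNeg_sq 3
  rw [pow_mul, h, one_pow]

lemma sqrtNeg_re (D : ℕ) : (sqrtNeg D).re = 0 := by simp [sqrtNeg]

/-- The factor by which inversion acts at the elliptic point (1+√-3)/2 is nontrivial exactly when 3
does not divide n. -/
lemma cubeRoot_pow_ne_one {n : ℕ} (hn : ¬ 3 ∣ n) : ((-1 + sqrtNeg 3) / 2) ^ n - 1 ≠ 0 := by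
  have h1 : (-1 + sqrtNeg 3) / 2 ≠ 1 := by
    intro h
    have h2 := congrArg Complex.re h
    have h3 : ((-1 + sqrtNeg 3) / 2).re = -1 / 2 := by
      rw [show (2 : ℂ) = ((2 : ℝ) : ℂ) by norm_num, div_ofReal_re, add_re, sqrtNeg_re]; simp
    rw [h3] at h2
    norm_num at h2
  have h3 := cubeRoot_pow 1
  rw [mul_one] at h3
  intro h
  apply hn
  have : orderOf ((-1 + sqrtNeg 3) / 2) = 3 := orderOf_eq_prime h3 h1
  rw [← this]
  exact orderOf_dvd_of_pow_eq_one (sub_eq_zero.mp h)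

/-- The period of the relation of discriminant `-3` for `k = 2n+1`. -/
def famHPeriod (n : ℕ) : ℂ :=
  2 * 4 ^ n * (qper n 3 0 (1 / 2) - qper n 3 (1 / 2) (1 / 2) / (((-1 + sqrtNeg 3) / 2) ^ n - 1))

/-- Modulo translation, (1+√-3)/2 is fixed by inversion with factor ρ, a primitive cube root of
unity, so (ρ^n - 1) φ is a period there. When ρ^n ≠ 1 this determines the value, and T_2 at √-3
involves no other point off the axis. -/
theorem famH_relSum {n : ℕ} (hn : 1 ≤ n) (h3 : ¬ 3 ∣ n) :
    relSum n 3 (famH n) [2 / 3, 1, 2] = ipi n * famHPeriod n := by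
  have t2 := ph_hecke_two hn three_pos 0 1 0 2 0 (1 / 2) (1 / 2)
  have s1 := ph_step hn three_pos 0 (1 / 2) 0 (2 / 3) 4 (-3) (by push_cast; ring)
  have s2 := ph_step hn three_pos (1 / 2) (1 / 2) (1 / 2) (1 / 2) 1 ((-1 + sqrtNeg 3) / 2)
    (by push_cast; ring)
  have hr := cubeRoot_pow_ne_one h3
  simp only [relSum, famH, List.zipWith_cons_cons, List.zipWith_nil_left, List.sum_cons,
    List.sum_nil]
  push_cast
  rw [X_cast, famHPeriod]
  have e : ph n 3 (1 / 2) (1 / 2) =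
      ipi n * (qper n 3 (1 / 2) (1 / 2) / (((-1 + sqrtNeg 3) / 2) ^ n - 1)) := by
    field_simp
    rw [one_pow] at s2
    linear_combination s2
  rw [e] at t2
  linear_combination 2 * t2 + 2 * s1

lemma famHPeriod_mem (n : ℕ) : famHPeriod n ∈ quadField 3 := by
  rw [famHPeriod]
  repeat' first
    | exact qper_mem _ _ _ _ | exact sqrtNeg_mem _ | exact one_mem _ | exact ofNat_mem _ _
    | apply div_mem | apply add_mem | apply sub_mem | apply mul_mem | apply neg_mem | apply pow_mem

lemma famH_isPoint (n : ℕ) : List.Forall₂ (IsPoint 3) (famH n) [2 / 3, 1, 2] := by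
  simp only [famH, List.forall₂_cons, isPoint_iff, List.Forall₂.nil, and_true]
  norm_num

lemma famH_sum (n : ℕ) :
    2 * ((2 : ℝ) ^ (2 * n + 1) - (-3) ^ n) = -((famH n).map LambertTerm.c).sum := by
  simp only [famH, List.map_cons, List.map_nil, List.sum_cons, List.sum_nil, X]
  ring

/-- The period of the relation of discriminant `-3` for `k = 6n+1`. -/
def famHSixPeriod (n : ℕ) : ℂ :=
  2 / 3 * (2 * 4 ^ (3 * n) + 1) * 4 ^ (3 * n) * qper (3 * n) 3 0 (1 / 2) +
    2 / 3 * 4 ^ (3 * n) * 4 ^ (3 * n) *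
      (qper (3 * n) 3 (1 / 4) (1 / 4) + qper (3 * n) 3 (-1 / 4) (1 / 4))

lemma X_six_cast (n : ℕ) : ((X (6 * n + 1) : ℝ) : ℂ) = 2 * 4 ^ (3 * n) + 1 := by
  rw [show 6 * n + 1 = 2 * (3 * n) + 1 by ring, X_cast]

/-- For N = 3n the fixed point (1+√-3)/2 gives no information. Instead, T_2 at that point produces
√-3 and (±1+√-3)/4, and the last two invert to √-3 with factor ρ^(3n) = 1. Hence X times the value
at (1+√-3)/2 is three times the value at √-3 plus periods, the origin of the factor 2/3. -/
theorem famHSix_relSum {n : ℕ} (hn : 1 ≤ n) :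
    relSum (3 * n) 3 (famHSix n) [2 / 3, 1, 2] = ipi (3 * n) * famHSixPeriod n := by
  have hN : 1 ≤ 3 * n := by omega
  have t2 := ph_hecke_two hN three_pos 0 1 0 2 0 (1 / 2) (1 / 2)
  have t2' := ph_hecke_two hN three_pos (1 / 2) (1 / 2) 0 1 (1 / 4) (-1 / 4) (1 / 4)
  have s1 := ph_step hN three_pos 0 (1 / 2) 0 (2 / 3) 4 (-3) (by push_cast; ring)
  have s3 := ph_step hN three_pos (1 / 4) (1 / 4) 0 1 4 ((-1 + sqrtNeg 3) / 2) (by push_cast; ring)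
  have s4 := ph_step hN three_pos (-1 / 4) (1 / 4) 0 1 4 ((-1 - sqrtNeg 3) / 2) (by push_cast; ring)
  rw [cubeRoot_pow] at s3
  rw [cubeRoot'_pow] at s4
  have e1 : (-27 : ℂ) ^ n = (-3) ^ (3 * n) := by rw [pow_mul]; norm_num
  have e2 : (64 : ℂ) ^ n = 4 ^ (3 * n) := by rw [pow_mul]; norm_num
  simp only [relSum, famHSix, List.zipWith_cons_cons, List.zipWith_nil_left, List.sum_cons,
    List.sum_nil]
  push_cast
  rw [X_six_cast, famHSixPeriod, mul_comm 2 n, pow_mul (64 : ℂ), e1, e2]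
  linear_combination (2 / 3 * (2 * 4 ^ (3 * n) + 1)) * (t2 + s1) +
    (2 / 3 * 4 ^ (3 * n)) * (t2' + s3 + s4)

lemma famHSixPeriod_mem (n : ℕ) : famHSixPeriod n ∈ quadField 3 := by
  rw [famHSixPeriod]
  repeat' first
    | exact qper_mem _ _ _ _ | exact sqrtNeg_mem _ | exact one_mem _ | exact ofNat_mem _ _
    | apply div_mem | apply add_mem | apply sub_mem | apply mul_mem | apply neg_mem | apply pow_mem

lemma famHSix_isPoint (n : ℕ) : List.Forall₂ (IsPoint 3) (famHSix n) [2 / 3, 1, 2] := by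
  simp only [famHSix, List.forall₂_cons, isPoint_iff, List.Forall₂.nil, and_true]
  norm_num

lemma two_mul_sSeq (n : ℕ) : 2 * sSeq n = -((famHSix n).map LambertTerm.c).sum := by
  have e2 : (2 : ℝ) ^ (6 * n) = 64 ^ n := by rw [pow_mul]; norm_num
  have e3 : (-3 : ℝ) ^ (3 * n) = (-27) ^ n := by rw [pow_mul]; norm_num
  simp only [famHSix, List.map_cons, List.map_nil, List.sum_cons, List.sum_nil, X]
  rw [sSeq, pow_add, pow_add, e2, e3, mul_comm 2 n, pow_mul (64 : ℝ)]
  ring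

/-! ### Discriminant `-20` -/

lemma trSigma_cast (n : ℕ) : ((trSigma n : ℝ) : ℂ) =
    (-2 + sqrtNeg 5) ^ n + (-2 - sqrtNeg 5) ^ n := by
  rw [trSigma, two_re_cast, sigma, map_pow, map_add, sqrtNeg_conj, map_neg, map_ofNat]
  ring

/-- The period of the relation of discriminant `-20` and merit `5`. -/
def famIPeriod (n : ℕ) : ℂ :=
  9 ^ n * (qper n 5 0 (1 / 3) + qper n 5 (1 / 3) (1 / 3) + qper n 5 (-1 / 3) (1 / 3))

/-- T_3 at √-5 leaves (±1+√-5)/3, which invert to (1+√-5)/2 with the factors 2(-2±√-5). T_2 at √-5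
eliminates that point. -/
theorem famI_relSum {n : ℕ} (hn : 1 ≤ n) :
    relSum n 5 (famI n) [1 / 2, 3 / 5, 1, 2, 3] = ipi n * famIPeriod n := by
  have hD : 0 < 5 := by norm_num
  have t2 := ph_hecke_two hn hD 0 1 0 2 0 (1 / 2) (1 / 2)
  have t3 := ph_hecke_three hn hD 0 1 0 3 0 (1 / 3) (-1 / 3) (1 / 3)
  have s1 := ph_step hn hD 0 (1 / 3) 0 (3 / 5) 9 (-5) (by push_cast; ring)
  have s2 := ph_step hn hD (1 / 3) (1 / 3) (1 / 2) (1 / 2) 9 (2 * (-2 + sqrtNeg 5))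
    (by push_cast; ring)
  have s3 := ph_step hn hD (-1 / 3) (1 / 3) (1 / 2) (1 / 2) 9 (2 * (-2 - sqrtNeg 5))
    (by push_cast; ring)
  have e : (4 : ℂ) ^ n = 2 ^ n * 2 ^ n := by rw [← mul_pow]; norm_num
  have h2 : (2 : ℂ) ^ n ≠ 0 := pow_ne_zero _ two_ne_zero
  rw [mul_pow] at s2 s3
  simp only [relSum, famI, List.zipWith_cons_cons, List.zipWith_nil_left, List.sum_cons,
    List.sum_nil]
  push_cast
  rw [trSigma_cast, X_cast, Y_cast, famIPeriod]
  generalize (-2 + sqrtNeg 5) ^ n = A at *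
  generalize (-2 - sqrtNeg 5) ^ n = A' at *
  rw [e] at t2 ⊢
  -- The factor to be matched is 2^n (A + A') whereas T_2 carries 4^n, so T_2 enters multiplied by
  -- (A + A')/2^n.
  have t2' : (A + A') / 2 ^ n * ph n 5 0 2 + 2 ^ n * (A + A') * (ph n 5 0 (1 / 2) +
      ph n 5 (1 / 2) (1 / 2)) = (2 * (2 ^ n * 2 ^ n) + 1) * (A + A') / 2 ^ n * ph n 5 0 1 := by
    field_simp
    linear_combination (A + A') * t2
  linear_combination t3 + s1 + s2 + s3 - t2'

lemma famIPeriod_mem (n : ℕ) : famIPeriod n ∈ quadField 5 := by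
  rw [famIPeriod]
  repeat' first
    | exact qper_mem _ _ _ _ | exact sqrtNeg_mem _ | exact one_mem _ | exact ofNat_mem _ _
    | apply add_mem | apply sub_mem | apply mul_mem | apply neg_mem | apply pow_mem

lemma famI_isPoint (n : ℕ) : List.Forall₂ (IsPoint 5) (famI n) [1 / 2, 3 / 5, 1, 2, 3] := by
  simp only [famI, List.forall₂_cons, isPoint_iff, List.Forall₂.nil, and_true]
  norm_num

lemma re_two_mul_sigma_pow (n : ℕ) : ((2 * sigma) ^ n).re = 2 ^ n * trSigma n / 2 := by
  have : ((2 : ℂ) * sigma) ^ n = ((2 ^ n : ℝ) : ℂ) * sigma ^ n := by push_cast; rw [mul_pow]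
  rw [this, re_ofReal_mul, trSigma]
  ring

lemma two_mul_uSeq (n : ℕ) : 2 * uSeq n = -((famI n).map LambertTerm.c).sum := by
  have e : (4 : ℝ) ^ n = 2 ^ n * 2 ^ n := by rw [← mul_pow]; norm_num
  simp only [famI, List.map_cons, List.map_nil, List.sum_cons, List.sum_nil, X_eq, Y_eq]
  rw [uSeq, re_two_mul_sigma_pow, pow_succ, pow_mul (3 : ℝ), e]
  norm_num
  field_simp
  ring

/-- The period of the relation of discriminant `-20` and merit `36/5`. -/
def famITildePeriod (n : ℕ) : ℂ :=
  ((-2 + sqrtNeg 5) ^ n + (-2 - sqrtNeg 5) ^ n) * 36 ^ n *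
      (qper n 5 (1 / 6) (1 / 6) + qper n 5 (-1 / 6) (1 / 6) - qper n 5 0 (1 / 6)) +
    2 ^ n * (3 * 9 ^ n + 1) * 9 ^ n * (qper n 5 (1 / 3) (1 / 3) + qper n 5 (-1 / 3) (1 / 3)) +
    (2 ^ n * (3 * 9 ^ n + 1) + (2 * 4 ^ n + 1) * ((-2 + sqrtNeg 5) ^ n + (-2 - sqrtNeg 5) ^ n)) *
      9 ^ n * qper n 5 0 (1 / 3)

lemma zI_cast (n : ℕ) : ((zI n : ℝ) : ℂ) = 2 ^ n * (3 * 9 ^ n + 1) +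
    (2 * 4 ^ n + 1) * ((-2 + sqrtNeg 5) ^ n + (-2 - sqrtNeg 5) ^ n) := by
  rw [zI, ofReal_add, ofReal_mul, ofReal_mul, X_cast, Y_cast, trSigma_cast]
  push_cast
  rfl

/-- T_6 at √-5 leaves (±1+√-5)/6, which invert to √-5 itself. The points √-5/2 and 2√-5 are removed
by T_2, which introduces (1+√-5)/2, and this in turn is removed by T_3. Disposing of √-5/2, of merit
5, is what raises the least merit to 36/5. -/
theorem famITilde_relSum {n : ℕ} (hn : 1 ≤ n) :
    relSum n 5 (famITilde n) [3 / 5, 6 / 5, 2 / 3, 1, 3 / 2, 3, 6] =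
      ipi n * famITildePeriod n := by
  have hD : 0 < 5 := by norm_num
  have h6 := ph_hecke_six hn hD 1 2 3 6 (3 / 2) (2 / 3) (1 / 2) (1 / 3) (1 / 6)
  have t2 := ph_hecke_two hn hD 0 1 0 2 0 (1 / 2) (1 / 2)
  have t3 := ph_hecke_three hn hD 0 1 0 3 0 (1 / 3) (-1 / 3) (1 / 3)
  have s1 := ph_step hn hD 0 (1 / 3) 0 (3 / 5) 9 (-5) (by push_cast; ring)
  have s2 := ph_step hn hD (1 / 3) (1 / 3) (1 / 2) (1 / 2) 9 (2 * (-2 + sqrtNeg 5))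
    (by push_cast; ring)
  have s3 := ph_step hn hD (-1 / 3) (1 / 3) (1 / 2) (1 / 2) 9 (2 * (-2 - sqrtNeg 5))
    (by push_cast; ring)
  have s4 := ph_step hn hD 0 (1 / 6) 0 (6 / 5) 36 (-5) (by push_cast; ring)
  have s5 := ph_step hn hD (1 / 6) (1 / 6) 0 1 36 (2 * (-2 + sqrtNeg 5)) (by push_cast; ring)
  have s6 := ph_step hn hD (-1 / 6) (1 / 6) 0 1 36 (2 * (-2 - sqrtNeg 5)) (by push_cast; ring)
  have e : (4 : ℂ) ^ n = 2 ^ n * 2 ^ n := by rw [← mul_pow]; norm_num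
  rw [mul_pow] at s2 s3 s5 s6
  simp only [relSum, famITilde, List.zipWith_cons_cons, List.zipWith_nil_left, List.sum_cons,
    List.sum_nil]
  push_cast
  rw [zI_cast, trSigma_cast, Y_cast, famITildePeriod]
  generalize (-2 + sqrtNeg 5) ^ n = A at *
  generalize (-2 - sqrtNeg 5) ^ n = A' at *
  rw [e] at t2 h6 ⊢
  linear_combination (-(A + A')) * (h6 + s4 - s5 - s6) - (A + A') * (3 * 9 ^ n + 1) * t2 +
    2 ^ n * (3 * 9 ^ n + 1) * (t3 + s2 + s3) +
    (2 ^ n * (3 * 9 ^ n + 1) + (2 * (2 ^ n * 2 ^ n) + 1) * (A + A')) * s1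

lemma famITildePeriod_mem (n : ℕ) : famITildePeriod n ∈ quadField 5 := by
  rw [famITildePeriod]
  repeat' first
    | exact qper_mem _ _ _ _ | exact sqrtNeg_mem _ | exact one_mem _ | exact ofNat_mem _ _
    | apply add_mem | apply sub_mem | apply mul_mem | apply neg_mem | apply pow_mem

lemma famITilde_isPoint (n : ℕ) :
    List.Forall₂ (IsPoint 5) (famITilde n) [3 / 5, 6 / 5, 2 / 3, 1, 3 / 2, 3, 6] := by
  simp only [famITilde, List.forall₂_cons, isPoint_iff, List.Forall₂.nil, and_true]
  norm_num

lemma two_mul_uTildeSeq (n : ℕ) : 2 * uTildeSeq n = -((famITilde n).map LambertTerm.c).sum := by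
  have e : (4 : ℂ) ^ n = 2 ^ n * 2 ^ n := by rw [← mul_pow]; norm_num
  have e9 : (9 : ℂ) ^ n = (-2 + sqrtNeg 5) ^ n * (-2 - sqrtNeg 5) ^ n := by
    rw [← mul_pow]; congr 1; linear_combination sqrtNeg_sq 5
  simp only [famITilde, List.map_cons, List.map_nil, List.sum_cons, List.sum_nil]
  apply ofReal_injective
  rw [uTildeSeq]
  push_cast
  rw [zI_cast, trSigma_cast, Y_cast, re_eq_add_conj, sigma,
    show 4 * n + 2 = (2 * n) * 2 + 2 by ring,
    pow_add (3 : ℂ), pow_mul (3 : ℂ) (2 * n), pow_succ (3 : ℂ) (2 * n), pow_succ (2 : ℂ) (2 * n),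
    pow_mul (3 : ℂ) 2, pow_mul (2 : ℂ) 2]
  simp only [map_mul, map_pow, map_add, map_sub, map_neg, map_ofNat, sqrtNeg_conj, mul_pow]
  norm_num
  rw [e, e9]
  ring

/-! ### Discriminant `-11`, merit `44/9` -/

lemma thirtySix_pow (n : ℕ) : (36 : ℂ) ^ n = 4 ^ n * 9 ^ n := by rw [← mul_pow]; norm_num

lemma bEleven_cast (n : ℕ) : ((bEleven n : ℝ) : ℂ) =
    ((-5 + sqrtNeg 11) / 2) ^ n + ((-5 - sqrtNeg 11) / 2) ^ n := by
  have h : mu ^ 2 = (-5 + sqrtNeg 11) / 2 := by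
    rw [mu]; linear_combination (1 / 4) * sqrtNeg_sq 11
  rw [bEleven, two_re_cast, pow_mul, h, map_pow, map_div₀, map_add, sqrtNeg_conj, map_neg,
    map_ofNat, map_ofNat]
  ring

/-- The period of the relation of discriminant `-11` and merit `44/9`. -/
def famFPeriod (n : ℕ) : ℂ :=
  36 ^ n * (qper n 11 (1 / 6) (1 / 6) + qper n 11 (-1 / 6) (1 / 6) - qper n 11 0 (1 / 6))

/-- T_6 at √-11 leaves (±1+√-11)/6, which invert to (1+√-11)/2 with conjugate factors; T_2 at √-11
eliminates that point. -/
theorem famF_relSum {n : ℕ} (hn : 1 ≤ n) :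
    relSum n 11 (famF n) [6 / 11, 1 / 3, 1 / 2, 2 / 3, 1, 3 / 2, 2, 3, 6] =
      ipi n * famFPeriod n := by
  have hD : 0 < 11 := by norm_num
  have h6 := ph_hecke_six hn hD 1 2 3 6 (3 / 2) (2 / 3) (1 / 2) (1 / 3) (1 / 6)
  have t2 := ph_hecke_two hn hD 0 1 0 2 0 (1 / 2) (1 / 2)
  have s1 := ph_step hn hD 0 (1 / 6) 0 (6 / 11) 36 (-11) (by push_cast; ring)
  have s2 := ph_step hn hD (1 / 6) (1 / 6) (1 / 2) (1 / 2) 36 (4 * ((-5 + sqrtNeg 11) / 2))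
    (by push_cast; ring)
  have s3 := ph_step hn hD (-1 / 6) (1 / 6) (1 / 2) (1 / 2) 36 (4 * ((-5 - sqrtNeg 11) / 2))
    (by push_cast; ring)
  rw [mul_pow] at s2 s3
  simp only [relSum, famF, block, List.map_cons, List.map_nil, List.zipWith_cons_cons,
    List.zipWith_nil_left, List.sum_cons, List.sum_nil]
  push_cast
  rw [bEleven_cast, X_cast, Y_cast, famFPeriod]
  generalize ((-5 + sqrtNeg 11) / 2) ^ n = A at *
  generalize ((-5 - sqrtNeg 11) / 2) ^ n = A' at *
  rw [thirtySix_pow] at *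
  linear_combination s2 + s3 - h6 - s1 - (A + A') * t2

lemma famFPeriod_mem (n : ℕ) : famFPeriod n ∈ quadField 11 := by
  rw [famFPeriod]
  repeat' first
    | exact qper_mem _ _ _ _ | exact ofNat_mem _ _
    | apply add_mem | apply sub_mem | apply mul_mem | apply pow_mem

lemma famF_isPoint (n : ℕ) : List.Forall₂ (IsPoint 11) (famF n)
    [6 / 11, 1 / 3, 1 / 2, 2 / 3, 1, 3 / 2, 2, 3, 6] := by
  simp only [famF, block, List.map_cons, List.map_nil, List.forall₂_cons, isPoint_iff,
    List.Forall₂.nil, and_true]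
  norm_num

lemma two_mul_vSeq (n : ℕ) :
    2 * (45 / 2 * vSeq n) = -((famF n).map LambertTerm.c).sum := by
  have h : (1 + sqrtNeg 11) ^ 2 = 4 * mu ^ 2 := by rw [mu]; ring
  have e : 2 * ((1 + sqrtNeg 11) ^ (2 * n)).re = 4 ^ n * bEleven n := by
    have : ((4 : ℂ) ^ n) = ((4 ^ n : ℝ) : ℂ) := by push_cast; rfl
    rw [bEleven, pow_mul, h, mul_pow, ← pow_mul, this, re_ofReal_mul]
    ring
  have e36 : (36 : ℝ) ^ n = 4 ^ n * 9 ^ n := by rw [← mul_pow]; norm_num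
  simp only [famF, block, List.map_cons, List.map_nil, List.sum_cons, List.sum_nil, X_eq, Y_eq]
  rw [vSeq, e, e36]
  ring

/-! ### Discriminant `-35` -/

lemma trOmega_cast (n : ℕ) : ((trOmega n : ℝ) : ℂ) =
    ((1 + sqrtNeg 35) / 2) ^ n + ((1 - sqrtNeg 35) / 2) ^ n := by
  rw [trOmega, two_re_cast, omega, map_pow, map_div₀, map_add, sqrtNeg_conj, map_one, map_ofNat]
  ring

/-- The period of the relation of discriminant `-35` and merit `144/35`. -/
def famWPeriod (n : ℕ) : ℂ :=
  -36 ^ n * qper n 35 0 (1 / 6) -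
    (-20) ^ n * ((((1 + sqrtNeg 35) / 2) ^ n + ((1 - sqrtNeg 35) / 2) ^ n) * qper n 35 0 (1 / 10) +
      ((1 + sqrtNeg 35) / 2) ^ n * qper n 35 (1 / 2) (1 / 10) +
      ((1 - sqrtNeg 35) / 2) ^ n * qper n 35 (-1 / 2) (1 / 10))

/-- The points (±1+√-35)/6 left by T_6 at √-35 are reached by inverting ±1/2 + √-35/10. These two
coincide modulo 1 and form the point off the axis of T_2 at √-35/5, which eliminates them. -/
theorem famW_relSum {n : ℕ} (hn : 1 ≤ n) :
    relSum n 35 (famW n) [6 / 35, 2 / 7, 1 / 5, 2 / 5, 1 / 3, 1 / 2, 2 / 3, 1, 3 / 2, 2, 3, 6] =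
      ipi n * famWPeriod n := by
  have hD : 0 < 35 := by norm_num
  have h6 := ph_hecke_six hn hD 1 2 3 6 (3 / 2) (2 / 3) (1 / 2) (1 / 3) (1 / 6)
  have t2 := ph_hecke_two hn hD 0 (1 / 5) 0 (2 / 5) 0 (1 / 2) (1 / 10)
  have s1 := ph_step hn hD 0 (1 / 6) 0 (6 / 35) 36 (-35) (by push_cast; ring)
  have s4 := ph_step hn hD 0 (1 / 10) 0 (2 / 7) (-20) 7 (by push_cast; ring)
  have s5 := ph_step hn hD (1 / 2) (1 / 10) (1 / 6) (1 / 6) (-20 * ((1 + sqrtNeg 35) / 2)) 36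
    (by push_cast; linear_combination sqrtNeg_sq 35)
  have s6 := ph_step hn hD (-1 / 2) (1 / 10) (-1 / 6) (1 / 6) (-20 * ((1 - sqrtNeg 35) / 2)) 36
    (by push_cast; linear_combination sqrtNeg_sq 35)
  have e : ph n 35 (-1 / 2) (1 / 10) = ph n 35 (1 / 2) (1 / 10) := ph_congr rfl (by norm_num)
  have e20 : (-20 : ℂ) ^ n = 4 ^ n * (-5) ^ n := by rw [← mul_pow]; norm_num
  rw [mul_pow] at s5 s6
  rw [e] at s6
  simp only [relSum, famW, block, List.map_cons, List.map_nil, List.cons_append, List.nil_append,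
    List.zipWith_cons_cons, List.zipWith_nil_left, List.sum_cons, List.sum_nil]
  push_cast
  rw [trOmega_cast, X_cast, Y_cast, famWPeriod]
  generalize ((1 + sqrtNeg 35) / 2) ^ n = A at *
  generalize ((1 - sqrtNeg 35) / 2) ^ n = A' at *
  rw [thirtySix_pow] at *
  rw [e20] at s4 s5 s6 ⊢
  linear_combination -h6 - s1 - s5 - s6 - (-5) ^ n * (A + A') * t2 - (A + A') * s4

lemma famWPeriod_mem (n : ℕ) : famWPeriod n ∈ quadField 35 := by
  rw [famWPeriod]
  repeat' first
    | exact qper_mem _ _ _ _ | exact sqrtNeg_mem _ | exact one_mem _ | exact ofNat_mem _ _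
    | apply div_mem | apply add_mem | apply sub_mem | apply mul_mem | apply neg_mem | apply pow_mem

lemma famW_isPoint (n : ℕ) : List.Forall₂ (IsPoint 35) (famW n)
    [6 / 35, 2 / 7, 1 / 5, 2 / 5, 1 / 3, 1 / 2, 2 / 3, 1, 3 / 2, 2, 3, 6] := by
  simp only [famW, block, List.map_cons, List.map_nil, List.cons_append, List.nil_append,
    List.forall₂_cons, isPoint_iff, List.Forall₂.nil, and_true]
  norm_num

lemma trOmega_smul (c : ℝ) (n : ℕ) : (((c : ℂ) * omega) ^ n).re = c ^ n * trOmega n / 2 := by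
  rw [mul_pow, ← ofReal_pow, re_ofReal_mul, trOmega]
  ring

lemma wSeq_eq (n : ℕ) : wSeq n =
    1 / 3 * (36 ^ n + (-35) ^ n - (2 * 4 ^ n * (-5) ^ n - 7 ^ n) * trOmega n) := by
  have h5 := trOmega_smul (-5) n
  have h7 := trOmega_smul 7 n
  push_cast at h5 h7
  have h : (2 : ℂ) ^ (2 * n + 1) = ((2 * 4 ^ n : ℝ) : ℂ) := by
    push_cast; rw [pow_succ, pow_mul]; norm_num [mul_comm]
  rw [wSeq, sub_re, h, re_ofReal_mul, h5, h7]
  ring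

lemma two_mul_wSeq (n : ℕ) : 2 * (3 / 2 * wSeq n) = -((famW n).map LambertTerm.c).sum := by
  have e36 : (36 : ℝ) ^ n = 4 ^ n * 9 ^ n := by rw [← mul_pow]; norm_num
  simp only [famW, block, List.map_cons, List.map_nil, List.cons_append, List.nil_append,
    List.sum_cons, List.sum_nil, X_eq, Y_eq]
  rw [wSeq_eq, e36]
  ring

/-- The period of the relation of discriminant `-35` and merit `28/5`. -/
def famWTildePeriod (n : ℕ) : ℂ :=
  180 ^ n * (qper n 35 (1 / 6) (1 / 30) + qper n 35 (-1 / 6) (1 / 30) - qper n 35 0 (1 / 30)) -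
    45 ^ n * qper n 35 0 (2 / 15) + (3 * 9 ^ n + 1) * 20 ^ n * qper n 35 0 (1 / 10) +
    (2 * 4 ^ n + 1) * 45 ^ n * qper n 35 0 (1 / 15)

/-- T_6 at √-35/5 leaves ±1/6 + √-35/30, which invert to (1+√-35)/2, eliminated by T_2 at √-35. The
four lowest imaginary points are inverted, which gives the series with s = 5/7. -/
theorem famWTilde_relSum {n : ℕ} (hn : 1 ≤ n) : relSum n 35 (famWTilde n)
    [1 / 5, 1 / 2, 1, 2, 3 / 10, 2 / 5, 3 / 5, 6 / 5, 3 / 14, 2 / 7, 3 / 7, 6 / 7] =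
      ipi n * famWTildePeriod n := by
  have hD : 0 < 35 := by norm_num
  have h6 := ph_hecke_six hn hD (1 / 5) (2 / 5) (3 / 5) (6 / 5) (3 / 10) (2 / 15) (1 / 10) (1 / 15)
    (1 / 30)
  have t2 := ph_hecke_two hn hD 0 1 0 2 0 (1 / 2) (1 / 2)
  have s1 := ph_step hn hD 0 (2 / 15) 0 (3 / 14) 45 (-28) (by push_cast; ring)
  have s2 := ph_step hn hD 0 (1 / 10) 0 (2 / 7) 20 (-7) (by push_cast; ring)
  have s3 := ph_step hn hD 0 (1 / 15) 0 (3 / 7) 45 (-7) (by push_cast; ring)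
  have s4 := ph_step hn hD 0 (1 / 30) 0 (6 / 7) 180 (-7) (by push_cast; ring)
  have s5 := ph_step hn hD (1 / 6) (1 / 30) (1 / 2) (1 / 2) 180 (-4 * ((1 - sqrtNeg 35) / 2))
    (by push_cast; ring)
  have s6 := ph_step hn hD (-1 / 6) (1 / 30) (1 / 2) (1 / 2) 180 (-4 * ((1 + sqrtNeg 35) / 2))
    (by push_cast; ring)
  have e4 : (-4 : ℂ) ^ n = (-1) ^ n * 4 ^ n := by rw [← mul_pow]; norm_num
  have e28 : (-28 : ℂ) ^ n = (-7) ^ n * 4 ^ n := by rw [← mul_pow]; norm_num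
  have e20 : (20 : ℂ) ^ n = 4 ^ n * 5 ^ n := by rw [← mul_pow]; norm_num
  have e45 : (45 : ℂ) ^ n = 9 ^ n * 5 ^ n := by rw [← mul_pow]; norm_num
  have e180 : (180 : ℂ) ^ n = 4 ^ n * 9 ^ n * 5 ^ n := by rw [← mul_pow, ← mul_pow]; norm_num
  rw [mul_pow, e4] at s5 s6
  rw [e28] at s1
  simp only [relSum, famWTilde, block, List.map_cons, List.map_nil, List.cons_append,
    List.nil_append, List.zipWith_cons_cons, List.zipWith_nil_left, List.sum_cons, List.sum_nil]
  push_cast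
  rw [trOmega_cast, X_cast, Y_cast, famWTildePeriod]
  generalize ((1 + sqrtNeg 35) / 2) ^ n = A at *
  generalize ((1 - sqrtNeg 35) / 2) ^ n = A' at *
  rw [thirtySix_pow] at h6
  rw [e45] at s1 s3
  rw [e20] at s2
  rw [e180] at s4 s5 s6
  rw [e45, e20, e180]
  linear_combination -5 ^ n * h6 - s1 - s4 + (3 * 9 ^ n + 1) * s2 + (2 * 4 ^ n + 1) * s3 + s5 + s6 -
    (-1) ^ n * (A + A') * t2

lemma famWTildePeriod_mem (n : ℕ) : famWTildePeriod n ∈ quadField 35 := by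
  rw [famWTildePeriod]
  repeat' first
    | exact qper_mem _ _ _ _ | exact one_mem _ | exact ofNat_mem _ _
    | apply add_mem | apply sub_mem | apply mul_mem | apply pow_mem

lemma famWTilde_isPoint (n : ℕ) : List.Forall₂ (IsPoint 35) (famWTilde n)
    [1 / 5, 1 / 2, 1, 2, 3 / 10, 2 / 5, 3 / 5, 6 / 5, 3 / 14, 2 / 7, 3 / 7, 6 / 7] := by
  simp only [famWTilde, block, List.map_cons, List.map_nil, List.cons_append, List.nil_append,
    List.forall₂_cons, isPoint_iff, List.Forall₂.nil, and_true]
  norm_num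

lemma two_mul_wTildeSeq (n : ℕ) :
    2 * (2 * wTildeSeq n) = -((famWTilde n).map LambertTerm.c).sum := by
  have e := trOmega_smul (-4) n
  push_cast at e
  have e4 : (-4 : ℝ) ^ n = (-1) ^ n * 4 ^ n := by rw [← mul_pow]; norm_num
  have e20 : (20 : ℝ) ^ n = 4 ^ n * 5 ^ n := by rw [← mul_pow]; norm_num
  have e180 : (180 : ℝ) ^ n = 4 ^ n * 9 ^ n * 5 ^ n := by rw [← mul_pow, ← mul_pow]; norm_num
  simp only [famWTilde, block, List.map_cons, List.map_nil, List.cons_append, List.nil_append,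
    List.sum_cons, List.sum_nil, X_eq, Y_eq]
  rw [wTildeSeq, e, e4, e20, e180, pow_succ, pow_mul, pow_mul]
  norm_num
  ring

/-! ### Discriminant `-7` -/

lemma vSeven_cast (n : ℕ) : ((vSeven n : ℝ) : ℂ) =
    2 * 4 ^ n + 1 + (((-3 + sqrtNeg 7) / 2) ^ n + ((-3 - sqrtNeg 7) / 2) ^ n) := by
  have h : ((1 + sqrtNeg 7) / 2) ^ 2 = (-3 + sqrtNeg 7) / 2 := by
    linear_combination (1 / 4) * sqrtNeg_sq 7
  rw [vSeven, ofReal_add, X_cast, two_re_cast, pow_mul, h, map_pow, map_div₀, map_add, sqrtNeg_conj,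
    map_neg, map_ofNat, map_ofNat]
  ring

lemma zSeven_cast (n : ℕ) :
    ((zSeven n : ℝ) : ℂ) = (2 * 4 ^ n + 1) * (vSeven n : ℝ) - 4 ^ n := by
  rw [zSeven, ofReal_sub, ofReal_mul, X_cast]
  push_cast
  rfl

/-- The period of the relation of discriminant `-7`. -/
def famSevenPeriod (n : ℕ) : ℂ :=
  (zSeven n : ℝ) * 9 ^ n * qper n 7 0 (1 / 3) - (vSeven n : ℝ) * 36 ^ n * qper n 7 0 (1 / 6) +
    4 ^ n * 36 ^ n * (qper n 7 (1 / 12) (1 / 12) + qper n 7 (-1 / 12) (1 / 12) +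
      qper n 7 (5 / 12) (1 / 12) + qper n 7 (-5 / 12) (1 / 12)) -
    36 ^ n * (((-3 - sqrtNeg 7) / 2) ^ n * qper n 7 (1 / 2) (1 / 6) +
      ((-3 + sqrtNeg 7) / 2) ^ n * qper n 7 (-1 / 2) (1 / 6))

/-- T_6 at √-7 leaves (±1+√-7)/6. Two more relations contain their sum: T_2 at these points, with
multiplier X, and T_3 at (1+√-7)/2, used with the trace A + A' as weight. Added up, they explain the
multiplier `vSeven` = X + A + A' of T_6. The inversions from ±1/12 and ±5/12 match the other points
of the two relations, T_3 at √-7 removes (±1+√-7)/3, and T_2 at √-7 removes (1+√-7)/2. -/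
theorem famSeven_relSum {n : ℕ} (hn : 1 ≤ n) :
    relSum n 7 (famSeven n) [3 / 7, 6 / 7, 2 / 3, 1 / 2, 1, 3 / 2, 2, 3, 6] =
      ipi n * famSevenPeriod n := by
  have hD : 0 < 7 := by norm_num
  have h6 := ph_hecke_six hn hD 1 2 3 6 (3 / 2) (2 / 3) (1 / 2) (1 / 3) (1 / 6)
  have t2 := ph_hecke_two hn hD 0 1 0 2 0 (1 / 2) (1 / 2)
  have t3 := ph_hecke_three hn hD 0 1 0 3 0 (1 / 3) (-1 / 3) (1 / 3)
  have t2q := ph_hecke_two hn hD (1 / 6) (1 / 6) (1 / 3) (1 / 3) (1 / 12) (-5 / 12) (1 / 12)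
  have t2q' := ph_hecke_two hn hD (-1 / 6) (1 / 6) (-1 / 3) (1 / 3) (-1 / 12) (5 / 12) (1 / 12)
  have t3w := ph_hecke_three hn hD (1 / 2) (1 / 2) (1 / 2) (3 / 2) (1 / 6) (1 / 2) (-1 / 6) (1 / 6)
  have s1 := ph_step hn hD 0 (1 / 3) 0 (3 / 7) 9 (-7) (by push_cast; ring)
  have s2 := ph_step hn hD 0 (1 / 6) 0 (6 / 7) 36 (-7) (by push_cast; ring)
  have su := ph_step hn hD (1 / 12) (1 / 12) (1 / 2) (3 / 2) 36 ((-3 + sqrtNeg 7) / 2)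
    (by push_cast; ring)
  have su' := ph_step hn hD (-1 / 12) (1 / 12) (1 / 2) (3 / 2) 36 ((-3 - sqrtNeg 7) / 2)
    (by push_cast; ring)
  have sa := ph_step hn hD (-5 / 12) (1 / 12) (-1 / 8) (3 / 8) 36 ((9 - 5 * sqrtNeg 7) / 2)
    (by push_cast; ring)
  have sa' := ph_step hn hD (5 / 12) (1 / 12) (1 / 8) (3 / 8) 36 ((9 + 5 * sqrtNeg 7) / 2)
    (by push_cast; ring)
  have sb := ph_step hn hD (1 / 2) (1 / 6) (-1 / 8) (3 / 8) (9 * ((-3 - sqrtNeg 7) / 2))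
    ((9 - 5 * sqrtNeg 7) / 2) (by push_cast; linear_combination (3 / 4) * sqrtNeg_sq 7)
  have sb' := ph_step hn hD (-1 / 2) (1 / 6) (1 / 8) (3 / 8) (9 * ((-3 + sqrtNeg 7) / 2))
    ((9 + 5 * sqrtNeg 7) / 2) (by push_cast; linear_combination (3 / 4) * sqrtNeg_sq 7)
  have e : ph n 7 (-1 / 2) (1 / 6) = ph n 7 (1 / 2) (1 / 6) := ph_congr rfl (by norm_num)
  have hA : ((-3 + sqrtNeg 7) / 2) ^ n * ((-3 - sqrtNeg 7) / 2) ^ n = 4 ^ n := by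
    rw [← mul_pow]; congr 1; linear_combination (-1 / 4) * sqrtNeg_sq 7
  rw [mul_pow] at sb sb'
  rw [e] at sb'
  simp only [relSum, famSeven, List.zipWith_cons_cons, List.zipWith_nil_left, List.sum_cons,
    List.sum_nil]
  push_cast
  rw [famSevenPeriod, zSeven_cast, vSeven_cast, X_cast, Y_cast]
  generalize ((-3 + sqrtNeg 7) / 2) ^ n = A at *
  generalize ((-3 - sqrtNeg 7) / 2) ^ n = A' at *
  generalize ((9 + 5 * sqrtNeg 7) / 2) ^ n = H at *
  generalize ((9 - 5 * sqrtNeg 7) / 2) ^ n = H' at *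
  rw [thirtySix_pow] at *
  linear_combination -(2 * 4 ^ n + 1 + (A + A')) * (h6 + s2) +
    ((2 * 4 ^ n + 1) * (2 * 4 ^ n + 1 + (A + A')) - 4 ^ n) * s1 - (A + A') * (3 * 9 ^ n + 1) * t2 -
    4 ^ n * t3 + 4 ^ n * 9 ^ n * (t2q + t2q') - 4 ^ n * (A + A') * t3w +
    4 ^ n * (su + su' + sa + sa' - sb - sb')

lemma vSeven_mem (n : ℕ) : ((vSeven n : ℝ) : ℂ) ∈ quadField 7 := by
  rw [vSeven_cast]
  repeat' first
    | exact sqrtNeg_mem _ | exact one_mem _ | exact ofNat_mem _ _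
    | apply div_mem | apply add_mem | apply sub_mem | apply mul_mem | apply neg_mem | apply pow_mem

lemma famSevenPeriod_mem (n : ℕ) : famSevenPeriod n ∈ quadField 7 := by
  rw [famSevenPeriod, zSeven_cast]
  repeat' first
    | exact qper_mem _ _ _ _ | exact sqrtNeg_mem _ | exact one_mem _ | exact ofNat_mem _ _
    | exact vSeven_mem _
    | apply div_mem | apply add_mem | apply sub_mem | apply mul_mem | apply neg_mem | apply pow_mem

lemma famSeven_isPoint (n : ℕ) : List.Forall₂ (IsPoint 7) (famSeven n)
    [3 / 7, 6 / 7, 2 / 3, 1 / 2, 1, 3 / 2, 2, 3, 6] := by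
  simp only [famSeven, List.forall₂_cons, isPoint_iff, List.Forall₂.nil, and_true]
  norm_num

lemma two_mul_sevenSeq (n : ℕ) : 2 * sevenSeq n = -((famSeven n).map LambertTerm.c).sum := by
  have e16 : (16 : ℝ) ^ n = 4 ^ n * 4 ^ n := by rw [← mul_pow]; norm_num
  simp only [famSeven, List.map_cons, List.map_nil, List.sum_cons, List.sum_nil, zSeven, X_eq, Y_eq]
  rw [sevenSeq, Y_eq, e16]
  ring

/-! ### Discriminant `-23` -/

lemma imPart_cast (z : ℂ) :
    ((imPart z : ℝ) : ℂ) = (z - (starRingEnd ℂ) z) * (sqrtNeg 23)⁻¹ := by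
  have h : ((Real.sqrt 23 : ℝ) : ℂ) ≠ 0 := by
    rw [Ne, ofReal_eq_zero]; positivity
  rw [imPart, sub_conj, sqrtNeg]
  push_cast
  field_simp

lemma alpha_eq (n : ℕ) : alpha n = 4 ^ n * ((-11 + sqrtNeg 23) / 2) ^ n := by
  have h : (1 + sqrtNeg 23) ^ 2 = 4 * ((-11 + sqrtNeg 23) / 2) := by
    linear_combination sqrtNeg_sq 23
  rw [alpha, pow_mul, h, mul_pow]

lemma beta_eq (n : ℕ) : beta n = 4 ^ n * ((1 - 5 * sqrtNeg 23) / 2) ^ n := by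
  have h : (5 - sqrtNeg 23) ^ 2 = 4 * ((1 - 5 * sqrtNeg 23) / 2) := by
    linear_combination sqrtNeg_sq 23
  rw [beta, pow_mul, h, mul_pow]

lemma conj_alpha (n : ℕ) : (starRingEnd ℂ) (alpha n) = 4 ^ n * ((-11 - sqrtNeg 23) / 2) ^ n := by
  rw [alpha_eq, map_mul, map_pow, map_pow, map_div₀, map_add, map_neg, sqrtNeg_conj, map_ofNat,
    map_ofNat, map_ofNat, sub_eq_add_neg]

lemma conj_beta (n : ℕ) : (starRingEnd ℂ) (beta n) = 4 ^ n * ((1 + 5 * sqrtNeg 23) / 2) ^ n := by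
  rw [beta_eq, map_mul, map_pow, map_pow, map_div₀, map_sub, map_mul, map_one, sqrtNeg_conj,
    map_ofNat, map_ofNat, map_ofNat, mul_neg, sub_neg_eq_add]

lemma kappaX_cast (n : ℕ) : ((kappaX n : ℝ) : ℂ) =
    (((1 - 5 * sqrtNeg 23) / 2) ^ n - ((1 + 5 * sqrtNeg 23) / 2) ^ n + (2 * 4 ^ n + 1) *
      (((-11 + sqrtNeg 23) / 2) ^ n - ((-11 - sqrtNeg 23) / 2) ^ n)) * (sqrtNeg 23)⁻¹ / 4 := by
  have h : (4 : ℂ) ^ n ≠ 0 := pow_ne_zero _ (by norm_num)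
  rw [kappaX]
  push_cast
  rw [imPart_cast, imPart_cast, X_cast, conj_alpha, conj_beta, alpha_eq, beta_eq,
    pow_succ]
  field_simp

lemma lambdaX_cast (n : ℕ) : ((lambdaX n : ℝ) : ℂ) = -(2 * 4 ^ n + 1) * (kappaX n : ℝ) +
    4 ^ n * (((-11 + sqrtNeg 23) / 2) ^ n - ((-11 - sqrtNeg 23) / 2) ^ n) *
      (sqrtNeg 23)⁻¹ / 4 := by
  rw [lambdaX]
  push_cast
  rw [imPart_cast, X_cast, conj_alpha, alpha_eq]
  ring

lemma rhoX_cast (n : ℕ) : 4 * 4 ^ n * (((rhoX n : ℝ) : ℂ) + (3 * 9 ^ n + 1) * (kappaX n : ℝ)) =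
    ((2 * 4 ^ n + 1) * (((-11 + sqrtNeg 23) / 2) ^ n * ((1 - 5 * sqrtNeg 23) / 2) ^ n -
      ((-11 - sqrtNeg 23) / 2) ^ n * ((1 + 5 * sqrtNeg 23) / 2) ^ n) +
      4 ^ n * ((((-11 + sqrtNeg 23) / 2) ^ n) ^ 2 - (((-11 - sqrtNeg 23) / 2) ^ n) ^ 2)) *
      (sqrtNeg 23)⁻¹ := by
  have h : (4 : ℂ) ^ n ≠ 0 := pow_ne_zero _ (by norm_num)
  have e16 : (16 : ℂ) ^ n = 4 ^ n * 4 ^ n := by rw [← mul_pow]; norm_num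
  rw [rhoX]
  push_cast
  rw [imPart_cast, imPart_cast, X_cast, Y_cast, map_mul, map_pow, conj_alpha, conj_beta, alpha_eq,
    beta_eq, e16, pow_succ]
  field_simp
  ring

lemma thetaX_cast (n : ℕ) : 4 * 4 ^ n * ((thetaX n : ℝ) : ℂ) =
    ((2 * 4 ^ n + 1) * (3 * 9 ^ n + 1) * 4 ^ n *
        (((1 - 5 * sqrtNeg 23) / 2) ^ n - ((1 + 5 * sqrtNeg 23) / 2) ^ n) -
      ((2 * 4 ^ n + 1) ^ 2 - 4 ^ n) * (((-11 + sqrtNeg 23) / 2) ^ n * ((1 - 5 * sqrtNeg 23) / 2) ^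
        n -
        ((-11 - sqrtNeg 23) / 2) ^ n * ((1 + 5 * sqrtNeg 23) / 2) ^ n) -
      (2 * 4 ^ n + 1) * 4 ^ n *
        ((((-11 + sqrtNeg 23) / 2) ^ n) ^ 2 - (((-11 - sqrtNeg 23) / 2) ^ n) ^ 2) +
      ((2 * 4 ^ n + 1) ^ 2 - 4 ^ n) * (3 * 9 ^ n + 1) * 4 ^ n *
        (((-11 + sqrtNeg 23) / 2) ^ n - ((-11 - sqrtNeg 23) / 2) ^ n)) * (sqrtNeg 23)⁻¹ := by
  have h : (4 : ℂ) ^ n ≠ 0 := pow_ne_zero _ (by norm_num)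
  have e16 : (16 : ℂ) ^ n = 4 ^ n * 4 ^ n := by rw [← mul_pow]; norm_num
  rw [thetaX]
  push_cast
  rw [imPart_cast, imPart_cast, imPart_cast, imPart_cast, X_cast, Y_cast, map_mul, map_pow,
    conj_alpha, conj_beta, alpha_eq, beta_eq, e16, pow_succ]
  field_simp
  ring

/-- The period of the relation of discriminant `-23`. -/
def famXPeriod (n : ℕ) : ℂ :=
  (kappaX n : ℝ) * 36 ^ n * qper n 23 0 (1 / 6) -
    (((-11 + sqrtNeg 23) / 2) ^ n - ((-11 - sqrtNeg 23) / 2) ^ n) * (sqrtNeg 23)⁻¹ / 4 * 4 ^ n *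
      (36 ^ n * (qper n 23 (1 / 12) (1 / 12) + qper n 23 (-1 / 12) (1 / 12) +
        qper n 23 (7 / 12) (1 / 12) + qper n 23 (-7 / 12) (1 / 12)) +
      ((13 + 7 * sqrtNeg 23) / 2) ^ n * qper n 23 (-1 / 6) (1 / 6) +
      ((13 - 7 * sqrtNeg 23) / 2) ^ n * qper n 23 (1 / 6) (1 / 6)) -
    (((1 - 5 * sqrtNeg 23) / 2) ^ n - ((1 + 5 * sqrtNeg 23) / 2) ^ n) * (sqrtNeg 23)⁻¹ / 4 *
      36 ^ n * (qper n 23 (1 / 6) (1 / 6) + qper n 23 (-1 / 6) (1 / 6))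

/-- Let p and p' be the values at (±1+√-23)/4. Up to periods and imaginary points, inversions turn
T_6 at √-23 into a relation for A'p + Ap', T_2 at (1+√-23)/2 into one for p + p', and T_2 at
(±1+√-23)/6 into one for Bp + B'p'. Three linear forms in two unknowns are dependent, with the 2×2
minors A - A', B - B' and AB - A'B' as coefficients up to sign. These are antisymmetric under
conjugation, hence rational after division by √-23, which is why the coefficients of the family are
imaginary parts. The points (1+√-23)/2 and (±1+√-23)/3 are removed by T_2 and T_3 at √-23. -/
theorem famX_relSum {n : ℕ} (hn : 1 ≤ n) :
    relSum n 23 (famX n) [6 / 23, 1 / 3, 1 / 2, 2 / 3, 1, 3 / 2, 2, 3, 6] =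
      ipi n * famXPeriod n := by
  have hD : 0 < 23 := by norm_num
  have h6 := ph_hecke_six hn hD 1 2 3 6 (3 / 2) (2 / 3) (1 / 2) (1 / 3) (1 / 6)
  have t2 := ph_hecke_two hn hD 0 1 0 2 0 (1 / 2) (1 / 2)
  have tw := ph_hecke_two hn hD (1 / 2) (1 / 2) 0 1 (1 / 4) (-1 / 4) (1 / 4)
  have t3 := ph_hecke_three hn hD 0 1 0 3 0 (1 / 3) (-1 / 3) (1 / 3)
  have t2q := ph_hecke_two hn hD (1 / 6) (1 / 6) (1 / 3) (1 / 3) (1 / 12) (7 / 12) (1 / 12)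
  have t2q' := ph_hecke_two hn hD (-1 / 6) (1 / 6) (-1 / 3) (1 / 3) (-1 / 12) (-7 / 12) (1 / 12)
  have s1 := ph_step hn hD 0 (1 / 6) 0 (6 / 23) 36 (-23) (by push_cast; ring)
  have sq := ph_step hn hD (1 / 6) (1 / 6) (-1 / 4) (1 / 4) 9 ((-11 + sqrtNeg 23) / 2)
    (by push_cast; ring)
  have sq' := ph_step hn hD (-1 / 6) (1 / 6) (1 / 4) (1 / 4) 9 ((-11 - sqrtNeg 23) / 2)
    (by push_cast; ring)
  have s12 := ph_step hn hD (1 / 12) (1 / 12) (1 / 2) (1 / 2) 36 ((-11 + sqrtNeg 23) / 2)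
    (by push_cast; ring)
  have s12' := ph_step hn hD (-1 / 12) (1 / 12) (1 / 2) (1 / 2) 36 ((-11 - sqrtNeg 23) / 2)
    (by push_cast; ring)
  have s7 := ph_step hn hD (7 / 12) (1 / 12) (-1 / 6) (1 / 6) 36 ((13 + 7 * sqrtNeg 23) / 2)
    (by push_cast; ring)
  have s7' := ph_step hn hD (-7 / 12) (1 / 12) (1 / 6) (1 / 6) 36 ((13 - 7 * sqrtNeg 23) / 2)
    (by push_cast; ring)
  have sb := ph_step hn hD (-1 / 6) (1 / 6) (1 / 4) (1 / 4) ((13 + 7 * sqrtNeg 23) / 2)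
    ((1 - 5 * sqrtNeg 23) / 2) (by push_cast; linear_combination (7 / 36) * sqrtNeg_sq 23)
  have sb' := ph_step hn hD (1 / 6) (1 / 6) (-1 / 4) (1 / 4) ((13 - 7 * sqrtNeg 23) / 2)
    ((1 + 5 * sqrtNeg 23) / 2) (by push_cast; linear_combination (7 / 36) * sqrtNeg_sq 23)
  have hk := kappaX_cast n
  have hl := lambdaX_cast n
  have hr := rhoX_cast n
  have ht := thetaX_cast n
  have h4 : 4 * (4 : ℂ) ^ n ≠ 0 := mul_ne_zero (by norm_num) (pow_ne_zero _ (by norm_num))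
  rw [famXPeriod]
  simp only [relSum, famX, block, List.map_cons, List.map_nil, List.zipWith_cons_cons,
    List.zipWith_nil_left, List.sum_cons, List.sum_nil]
  push_cast
  -- `rhoX` and `thetaX` are known through their multiples by 4·4^n, so the whole relation is
  -- multiplied by this factor.
  rw [hl, ← mul_right_inj' h4]
  generalize ((kappaX n : ℝ) : ℂ) = k at *
  generalize ((rhoX n : ℝ) : ℂ) = r at *
  generalize ((thetaX n : ℝ) : ℂ) = t at *
  subst hk
  generalize ((-11 + sqrtNeg 23) / 2) ^ n = A at *
  generalize ((-11 - sqrtNeg 23) / 2) ^ n = A' at *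
  generalize ((1 - 5 * sqrtNeg 23) / 2) ^ n = B at *
  generalize ((1 + 5 * sqrtNeg 23) / 2) ^ n = B' at *
  generalize ((13 + 7 * sqrtNeg 23) / 2) ^ n = H at *
  generalize ((13 - 7 * sqrtNeg 23) / 2) ^ n = H' at *
  generalize (sqrtNeg 23)⁻¹ = j at *
  rw [thirtySix_pow] at *
  linear_combination 4 ^ n * (B - B' + (2 * 4 ^ n + 1) * (A - A')) * j * (h6 + s1) +
    ((2 * 4 ^ n + 1) * (A * B - A' * B') + 4 ^ n * (A ^ 2 - A' ^ 2)) * j * t2 +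
    4 ^ n * (A * B - A' * B') * j * tw + 4 ^ n * 4 ^ n * (A - A') * j *
      (t3 - 9 ^ n * (t2q + t2q') - s12 - s12' - s7 - s7' - sb - sb') -
    4 ^ n * 4 ^ n * (B - B') * j * (sq + sq') +
    (4 ^ n * ph n 23 0 (1 / 2) + ph n 23 0 2) * hr + ph n 23 0 1 * ht

lemma famXPeriod_mem (n : ℕ) : famXPeriod n ∈ quadField 23 := by
  rw [famXPeriod, kappaX_cast]
  repeat' first
    | with_reducible exact qper_mem _ _ _ _ | with_reducible exact sqrtNeg_mem _
    | exact one_mem _ | exact ofNat_mem _ _ | with_reducible apply inv_mem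
    | with_reducible apply div_mem | with_reducible apply add_mem | with_reducible apply sub_mem
    | with_reducible apply mul_mem | with_reducible apply pow_mem | apply neg_mem

lemma famX_isPoint (n : ℕ) : List.Forall₂ (IsPoint 23) (famX n)
    [6 / 23, 1 / 3, 1 / 2, 2 / 3, 1, 3 / 2, 2, 3, 6] := by
  simp only [famX, block, List.map_cons, List.map_nil, List.forall₂_cons, isPoint_iff,
    List.Forall₂.nil, and_true]
  norm_num

lemma xSeq_eq (n : ℕ) : 8 * 4 ^ n * xSeq n =
    imPart (alpha n * (alpha n + 2 * beta n - 2 ^ (2 * n + 1) * gammaPlus n + gammaMinus n)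
      - beta n * gammaPlus n) := by
  have h : (2 : ℂ) ^ (2 * n + 2) * (Real.sqrt 23 : ℂ) =
    ((2 ^ (2 * n + 2) * Real.sqrt 23 : ℝ) : ℂ) := by
    push_cast; rfl
  rw [xSeq, h, div_ofReal_im, imPart, pow_add 2 (2 * n) 2, pow_mul (2 : ℝ)]
  generalize (alpha n * _ - _ : ℂ) = z
  norm_num
  field_simp
  ring

lemma two_mul_xSeq (n : ℕ) : 2 * xSeq n = -((famX n).map LambertTerm.c).sum := by
  have h4 : 4 * (4 : ℂ) ^ n ≠ 0 := mul_ne_zero (by norm_num) (pow_ne_zero _ (by norm_num))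
  have hk := kappaX_cast n
  have hr := rhoX_cast n
  have ht := thetaX_cast n
  have hx : ((8 * 4 ^ n * xSeq n : ℝ) : ℂ) = _ := congrArg ofReal (xSeq_eq n)
  have e : (2 : ℂ) ^ (2 * n + 1) = 2 * 4 ^ n := by rw [pow_succ, pow_mul, mul_comm]; norm_num
  rw [imPart_cast, gammaPlus, gammaMinus, e] at hx
  simp only [map_mul, map_pow, map_add, map_sub, map_neg, map_ofNat, conj_alpha, conj_beta] at hx
  rw [alpha_eq, beta_eq] at hx
  push_cast at hx
  simp only [famX, block, List.map_cons, List.map_nil, List.sum_cons, List.sum_nil]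
  apply ofReal_injective
  push_cast
  rw [lambdaX_cast, ← mul_right_inj' h4]
  generalize ((kappaX n : ℝ) : ℂ) = k at *
  generalize ((rhoX n : ℝ) : ℂ) = r at *
  generalize ((thetaX n : ℝ) : ℂ) = t at *
  generalize ((xSeq n : ℝ) : ℂ) = x at *
  subst hk
  generalize ((-11 + sqrtNeg 23) / 2) ^ n = A at *
  generalize ((-11 - sqrtNeg 23) / 2) ^ n = A' at *
  generalize ((1 - 5 * sqrtNeg 23) / 2) ^ n = B at *
  generalize ((1 + 5 * sqrtNeg 23) / 2) ^ n = B' at *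
  generalize (sqrtNeg 23)⁻¹ = j at *
  rw [thirtySix_pow] at *
  linear_combination hx + (4 ^ n + 1) * hr + ht

/-! ### Discriminant `-11`, merit `400/99` -/

lemma cEleven_cast (n : ℕ) : ((cEleven n : ℝ) : ℂ) =
    ((-1 + 3 * sqrtNeg 11) / 2) ^ n + ((-1 - 3 * sqrtNeg 11) / 2) ^ n := by
  have h : (1 + mu) ^ 2 = (-1 + 3 * sqrtNeg 11) / 2 := by
    rw [mu]; linear_combination (1 / 4) * sqrtNeg_sq 11
  rw [cEleven, two_re_cast, pow_mul, h, map_pow, map_div₀, map_add, map_mul, sqrtNeg_conj, map_neg,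
    map_one, map_ofNat, map_ofNat]
  ring

lemma gEleven_eq (n : ℕ) : gEleven n = Y (2 * n + 1) + bEleven n := by
  rw [gEleven, Y]; ring

lemma gEleven_cast (n : ℕ) : ((gEleven n : ℝ) : ℂ) = 3 * 9 ^ n + 1 + (bEleven n : ℝ) := by
  rw [gEleven_eq, ofReal_add, Y_cast]

lemma five_pow_eq {R : Type*} [CommSemiring R] (n : ℕ) : (5 : R) ^ (2 * n + 1) = 5 * 25 ^ n := by
  rw [pow_succ, pow_mul, mul_comm]; norm_num

lemma fEleven_cast (n : ℕ) : ((fEleven n : ℝ) : ℂ) =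
    (bEleven n : ℝ) * (5 * 25 ^ n + 1 - (cEleven n : ℝ)) := by
  rw [fEleven, five_pow_eq]
  push_cast
  rfl

/-- The period of the relation of discriminant `-11` and merit `400/99`. -/
def famFTildePeriod (n : ℕ) : ℂ :=
  -2 * (-1) ^ n * (100 ^ n * qper n 11 0 (3 / 10) + 225 ^ n * qper n 11 0 (2 / 15) +
    900 ^ n * qper n 11 0 (1 / 30) - (gEleven n : ℝ) * 100 ^ n * qper n 11 0 (1 / 10) -
    (2 * 4 ^ n + 1) * 225 ^ n * qper n 11 0 (1 / 15) +
    (2 * 4 ^ n + 1) * (gEleven n : ℝ) * 25 ^ n * qper n 11 0 (1 / 5) +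
    100 ^ n * (bEleven n : ℝ) * (qper n 11 (3 / 10) (1 / 10) + qper n 11 (-3 / 10) (1 / 10)) -
    4 ^ n * (9 ^ n * (qper n 11 (-5 / 6) (5 / 6) + qper n 11 (5 / 6) (5 / 6)) +
      225 ^ n * (qper n 11 (-1 / 6) (1 / 30) + qper n 11 (1 / 6) (1 / 30)) +
      ((7 - 5 * sqrtNeg 11) / 2) ^ n * qper n 11 (-5 / 6) (5 / 6) +
      ((7 + 5 * sqrtNeg 11) / 2) ^ n * qper n 11 (5 / 6) (5 / 6)))

/-- T_6 at 5√-11 plus 25^n times T_6 at √-11/5. The points left by the first invert to (±1+√-11)/10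
with one assignment of the conjugate factors A, A'; those left by the second arrive at the same
points in two steps with the opposite assignment. Only in the sum does each of the two values
acquire the rational factor A + A', so that T_5 at (1+√-11)/2 removes them. The points that T_5
brings in are removed by T_2 at 5√-11, √-11/5 and √-11. -/
theorem famFTilde_relSum {n : ℕ} (hn : 1 ≤ n) : relSum n 11 (famFTilde n)
    [10 / 33, 1 / 2, 1, 2, 5 / 11, 15 / 22, 10 / 11, 15 / 11, 30 / 11, 2 / 5, 3 / 5, 6 / 5,
      5 / 6, 5 / 3, 5 / 2, 10 / 3, 5, 15 / 2, 10, 15, 30] = ipi n * famFTildePeriod n := by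
  have hD : 0 < 11 := by norm_num
  have h6a := ph_hecke_six hn hD 5 10 15 30 (15 / 2) (10 / 3) (5 / 2) (5 / 3) (5 / 6)
  have h6b := ph_hecke_six hn hD (1 / 5) (2 / 5) (3 / 5) (6 / 5) (3 / 10) (2 / 15) (1 / 10) (1 / 15)
    (1 / 30)
  have t2a := ph_hecke_two hn hD 0 5 0 10 0 (1 / 2) (5 / 2)
  have t2b := ph_hecke_two hn hD 0 (1 / 5) 0 (2 / 5) 0 (1 / 2) (1 / 10)
  have t2 := ph_hecke_two hn hD 0 1 0 2 0 (1 / 2) (1 / 2)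
  have t5 := ph_hecke_five hn hD (1 / 2) (1 / 2) (1 / 2) (5 / 2) (1 / 10) (3 / 10) (1 / 2) (-3 / 10)
    (-1 / 10) (1 / 10)
  have s1 := ph_step hn hD 0 (3 / 10) 0 (10 / 33) 100 (-99) (by push_cast; ring)
  have s2 := ph_step hn hD 0 (2 / 15) 0 (15 / 22) 225 (-44) (by push_cast; ring)
  have s3 := ph_step hn hD 0 (1 / 30) 0 (30 / 11) 900 (-11) (by push_cast; ring)
  have s4 := ph_step hn hD 0 (1 / 10) 0 (10 / 11) 100 (-11) (by push_cast; ring)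
  have s5 := ph_step hn hD 0 (1 / 15) 0 (15 / 11) 225 (-11) (by push_cast; ring)
  have s6 := ph_step hn hD 0 (1 / 5) 0 (5 / 11) 25 (-11) (by push_cast; ring)
  have sa := ph_step hn hD (3 / 10) (1 / 10) (1 / 2) (1 / 2) 25 ((-1 + 3 * sqrtNeg 11) / 2)
    (by push_cast; ring)
  have sa' := ph_step hn hD (-3 / 10) (1 / 10) (1 / 2) (1 / 2) 25 ((-1 - 3 * sqrtNeg 11) / 2)
    (by push_cast; ring)
  have sc := ph_step hn hD (-5 / 6) (5 / 6) (1 / 10) (1 / 10) 9 (25 * ((-5 - sqrtNeg 11) / 2))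
    (by push_cast; ring)
  have sc' := ph_step hn hD (5 / 6) (5 / 6) (-1 / 10) (1 / 10) 9 (25 * ((-5 + sqrtNeg 11) / 2))
    (by push_cast; ring)
  have sd := ph_step hn hD (-1 / 6) (1 / 30) (-5 / 6) (5 / 6) 225 ((7 - 5 * sqrtNeg 11) / 2)
    (by push_cast; ring)
  have sd' := ph_step hn hD (1 / 6) (1 / 30) (5 / 6) (5 / 6) 225 ((7 + 5 * sqrtNeg 11) / 2)
    (by push_cast; ring)
  have se := ph_step hn hD (-5 / 6) (5 / 6) (1 / 10) (1 / 10) ((7 - 5 * sqrtNeg 11) / 2)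
    (25 * ((-5 + sqrtNeg 11) / 2)) (by push_cast; linear_combination (-125 / 36) * sqrtNeg_sq 11)
  have se' := ph_step hn hD (5 / 6) (5 / 6) (-1 / 10) (1 / 10) ((7 + 5 * sqrtNeg 11) / 2)
    (25 * ((-5 - sqrtNeg 11) / 2)) (by push_cast; linear_combination (-125 / 36) * sqrtNeg_sq 11)
  have e1 : ph n 11 (1 / 6) (5 / 6) = ph n 11 (-5 / 6) (5 / 6) := ph_congr rfl (by norm_num)
  have e2 : ph n 11 (-1 / 6) (5 / 6) = ph n 11 (5 / 6) (5 / 6) := ph_congr rfl (by norm_num)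
  have e44 : (-44 : ℂ) ^ n = 4 ^ n * (-11) ^ n := by rw [← mul_pow]; norm_num
  have e100 : (100 : ℂ) ^ n = 4 ^ n * 25 ^ n := by rw [← mul_pow]; norm_num
  have e225 : (225 : ℂ) ^ n = 9 ^ n * 25 ^ n := by rw [← mul_pow]; norm_num
  have e900 : (900 : ℂ) ^ n = 4 ^ n * 9 ^ n * 25 ^ n := by rw [← mul_pow, ← mul_pow]; norm_num
  rw [mul_pow] at sc sc' se se'
  rw [e1, e2] at h6a
  simp only [relSum, famFTilde, block, List.map_cons, List.map_nil, List.cons_append,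
    List.nil_append, List.zipWith_cons_cons, List.zipWith_nil_left, List.sum_cons, List.sum_nil]
  push_cast
  rw [famFTildePeriod, fEleven_cast, gEleven_cast, cEleven_cast, bEleven_cast, X_cast]
  generalize ((-5 + sqrtNeg 11) / 2) ^ n = A at *
  generalize ((-5 - sqrtNeg 11) / 2) ^ n = A' at *
  generalize ((-1 + 3 * sqrtNeg 11) / 2) ^ n = C at *
  generalize ((-1 - 3 * sqrtNeg 11) / 2) ^ n = C' at *
  generalize ((7 + 5 * sqrtNeg 11) / 2) ^ n = G at *
  generalize ((7 - 5 * sqrtNeg 11) / 2) ^ n = G' at *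
  rw [thirtySix_pow] at h6a h6b ⊢
  rw [e100] at s1 s4 ⊢
  rw [e225] at s2 s5 sd sd' ⊢
  rw [e44] at s2
  rw [e900] at s3 ⊢
  linear_combination -2 * (-1) ^ n * (h6a + 25 ^ n * h6b + s1 + s2 + s3 -
    (3 * 9 ^ n + 1 + (A + A')) * s4 - (2 * 4 ^ n + 1) * s5 +
    (2 * 4 ^ n + 1) * (3 * 9 ^ n + 1 + (A + A')) * s6 - (A + A') * t2a - 25 ^ n * (A + A') * t2b +
    (A + A') * (5 * 25 ^ n + 1 - (C + C')) * t2 + 4 ^ n * (A + A') * (t5 + sa + sa') -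
    4 ^ n * (sc + sc' + sd + sd' + se + se'))

lemma bEleven_mem (n : ℕ) : ((bEleven n : ℝ) : ℂ) ∈ quadField 11 := by
  rw [bEleven_cast]
  repeat' first
    | exact sqrtNeg_mem _ | exact ofNat_mem _ _
    | apply div_mem | apply add_mem | apply sub_mem | apply neg_mem | apply pow_mem

lemma famFTildePeriod_mem (n : ℕ) : famFTildePeriod n ∈ quadField 11 := by
  rw [famFTildePeriod, gEleven_cast]
  repeat' first
    | with_reducible exact qper_mem _ _ _ _ | exact sqrtNeg_mem _ | exact bEleven_mem _
    | exact one_mem _ | exact ofNat_mem _ _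
    | apply div_mem | apply add_mem | apply sub_mem | apply mul_mem | apply neg_mem | apply pow_mem

lemma famFTilde_isPoint (n : ℕ) : List.Forall₂ (IsPoint 11) (famFTilde n)
    [10 / 33, 1 / 2, 1, 2, 5 / 11, 15 / 22, 10 / 11, 15 / 11, 30 / 11, 2 / 5, 3 / 5, 6 / 5,
      5 / 6, 5 / 3, 5 / 2, 10 / 3, 5, 15 / 2, 10, 15, 30] := by
  simp only [famFTilde, block, List.map_cons, List.map_nil, List.cons_append, List.nil_append,
    List.forall₂_cons, isPoint_iff, List.Forall₂.nil, and_true]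
  norm_num

lemma two_mul_vTildeSeq (n : ℕ) : 2 * vTildeSeq n = -((famFTilde n).map LambertTerm.c).sum := by
  have e1 : (36 : ℝ) ^ n = 4 ^ n * 9 ^ n := by rw [← mul_pow]; norm_num
  have e2 : (44 : ℝ) ^ n = 4 ^ n * 11 ^ n := by rw [← mul_pow]; norm_num
  have e3 : (99 : ℝ) ^ n = 9 ^ n * 11 ^ n := by rw [← mul_pow]; norm_num
  have e4 : (2 : ℝ) ^ (2 * n + 1) = 2 * 4 ^ n := by rw [pow_succ, pow_mul, mul_comm]; norm_num
  simp only [famFTilde, block, List.map_cons, List.map_nil, List.cons_append, List.nil_append,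
    List.sum_cons, List.sum_nil, X_eq]
  rw [vTildeSeq, fEleven, gEleven_eq, Y_eq, five_pow_eq, neg_pow 99, neg_pow 11, neg_pow 25,
    neg_pow 9, neg_pow 4, e1, e2, e3, e4]
  rcases neg_one_pow_eq_or ℝ n with h | h <;> rw [h] <;> ring

/-! ### Discriminant `-4` -/

lemma lambdaC_cast (n : ℕ) :
    ((lambdaC n : ℝ) : ℂ) = 4 ^ n - (-1) ^ n * (2 * 4 ^ (2 * n) + 1) := by
  rw [lambdaC, show 4 * n + 1 = 2 * (2 * n) + 1 by ring, ofReal_sub, ofReal_mul, X_cast]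
  push_cast
  rfl

lemma two_re_three_add_four_I (n : ℕ) : ((2 * ((3 + 4 * I) ^ (2 * n)).re : ℝ) : ℂ) =
    (3 + 4 * sqrtNeg 1) ^ (2 * n) + (3 - 4 * sqrtNeg 1) ^ (2 * n) := by
  have h : I = sqrtNeg 1 := by simp [sqrtNeg]
  rw [h, two_re_cast, map_pow, map_add, map_mul, sqrtNeg_conj, map_ofNat, map_ofNat]
  ring

/-- The period of the relation of discriminant `-4`. -/
def famCPeriod (n : ℕ) : ℂ :=
  (lambdaC n : ℝ) * 36 ^ (2 * n) * qper (2 * n) 1 0 (5 / 6) +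
    (-4) ^ n * (lambdaC n : ℝ) * 25 ^ (2 * n) * (qper (2 * n) 1 0 (3 / 5) +
      qper (2 * n) 1 (-3 / 5) (3 / 5) + qper (2 * n) 1 (3 / 5) (3 / 5) +
      qper (2 * n) 1 (1 / 5) (3 / 5) + qper (2 * n) 1 (-1 / 5) (3 / 5)) -
    (lambdaC n : ℝ) * (-4) ^ n * (3 * 9 ^ (2 * n) + 1) / 2 * 25 ^ (2 * n) *
      (qper (2 * n) 1 0 (1 / 5) + qper (2 * n) 1 (1 / 5) (1 / 5) + qper (2 * n) 1 (-1 / 5) (1 / 5) +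
      qper (2 * n) 1 (2 / 5) (1 / 5) + qper (2 * n) 1 (-2 / 5) (1 / 5)) -
    (lambdaC n : ℝ) * (-4) ^ n *
      ((3 + 4 * sqrtNeg 1) ^ (2 * n) + (3 - 4 * sqrtNeg 1) ^ (2 * n)) / 2 * 9 ^
        (2 * n) * (qper (2 * n) 1 0 (1 / 3) + qper (2 * n) 1 (1 / 3) (1 / 3) +
      qper (2 * n) 1 (-1 / 3) (1 / 3)) -
    4 ^ n * (3 * 9 ^ (2 * n) + 1) * (5 * 25 ^ (2 * n) + 1) / 2 * 4 ^ (2 * n) *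
      (qper (2 * n) 1 0 (1 / 2) + qper (2 * n) 1 (1 / 2) (1 / 2))

lemma two_mul_sqrtNeg_one_pow (n : ℕ) : (2 * sqrtNeg 1) ^ (2 * n) = (-4) ^ n := by
  rw [pow_mul]; congr 1; linear_combination 4 * sqrtNeg_sq 1

/-- Here N = 2n is even, so the signs of the inversion factors disappear and (2i)^N = (-4)^n. The
points (±1+5i)/6 left by T_6 at 5i come from inverting points of T_5 at 3i. The points (1+5i)/2 and
(1+3i)/2 that arise are removed by T_2 at 5i, T_5 at i and T_3 at i. The remaining multiple of φ(i)
is converted by T_2 at i, which up to periods reads 2φ(2i) = (X - (-4)^n) φ(i); up to sign this is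
the source of the common factor `lambdaC`. -/
theorem famC_relSum {n : ℕ} (hn : 1 ≤ n) :
    relSum (2 * n) 1 (famC n) [6 / 5, 2, 3, 5 / 3, 10 / 3, 5, 15 / 2, 15, 30] =
      ipi (2 * n) * famCPeriod n := by
  have hD : 0 < 1 := one_pos
  have hN : 1 ≤ 2 * n := by omega
  have hev : Even (2 * n) := even_two_mul n
  have h6 := ph_hecke_six hN hD 5 10 15 30 (15 / 2) (10 / 3) (5 / 2) (5 / 3) (5 / 6)
  have t2b := ph_hecke_two hN hD 0 5 0 10 0 (1 / 2) (5 / 2)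
  have t5b := ph_hecke_five hN hD 0 3 0 15 0 (1 / 5) (-3 / 5) (3 / 5) (-1 / 5) (3 / 5)
  have t5 := ph_hecke_five hN hD 0 1 0 5 0 (1 / 5) (2 / 5) (-2 / 5) (-1 / 5) (1 / 5)
  have t3 := ph_hecke_three hN hD 0 1 0 3 0 (1 / 3) (-1 / 3) (1 / 3)
  have t2 := ph_hecke_two hN hD 0 1 0 2 0 (1 / 2) (1 / 2)
  have sk := ph_step hN hD 0 (5 / 6) 0 (6 / 5) 36 (-25) (by push_cast; ring)
  have sl := ph_step hN hD 0 (3 / 5) 0 (5 / 3) 25 (-9) (by push_cast; ring)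
  have sm := ph_step hN hD (-3 / 5) (3 / 5) (-1 / 6) (5 / 6) 25 (2 * sqrtNeg 1 * -9)
    (by push_cast; ring)
  have sn := ph_step hN hD (3 / 5) (3 / 5) (1 / 6) (5 / 6) 25 (2 * sqrtNeg 1 * 9)
    (by push_cast; ring)
  have so := ph_step hN hD (1 / 5) (3 / 5) (1 / 2) (3 / 2) 25 (2 * sqrtNeg 1 * (3 + 4 * sqrtNeg 1))
    (by push_cast; linear_combination 8 * sqrtNeg_sq 1)
  have sp := ph_step hN hD (-1 / 5) (3 / 5) (1 / 2) (3 / 2) 25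
    (2 * sqrtNeg 1 * -(3 - 4 * sqrtNeg 1)) (by push_cast; linear_combination 8 * sqrtNeg_sq 1)
  have sf := ph_step hN hD 0 (1 / 5) 0 5 25 (-1) (by push_cast; ring)
  have sg := ph_step hN hD (1 / 5) (1 / 5) (1 / 2) (5 / 2) 25 (2 * sqrtNeg 1) (by push_cast; ring)
  have sh := ph_step hN hD (-1 / 5) (1 / 5) (1 / 2) (5 / 2) 25 (-(2 * sqrtNeg 1))
    (by push_cast; ring)
  have si := ph_step hN hD (2 / 5) (1 / 5) 0 1 25 (3 + 4 * sqrtNeg 1) (by push_cast; ring)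
  have sj := ph_step hN hD (-2 / 5) (1 / 5) 0 1 25 (3 - 4 * sqrtNeg 1) (by push_cast; ring)
  have sc := ph_step hN hD 0 (1 / 3) 0 3 9 (-1) (by push_cast; ring)
  have sd := ph_step hN hD (1 / 3) (1 / 3) (1 / 2) (3 / 2) 9 (2 * sqrtNeg 1) (by push_cast; ring)
  have se := ph_step hN hD (-1 / 3) (1 / 3) (1 / 2) (3 / 2) 9 (-(2 * sqrtNeg 1))
    (by push_cast; ring)
  have sa := ph_step hN hD 0 (1 / 2) 0 2 4 (-1) (by push_cast; ring)
  have sb := ph_step hN hD (1 / 2) (1 / 2) 0 1 4 (2 * sqrtNeg 1) (by push_cast; ring)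
  rw [mul_pow, two_mul_sqrtNeg_one_pow] at sm sn so sp
  rw [two_mul_sqrtNeg_one_pow] at sg sd sb
  rw [hev.neg_pow] at sk sl sm sp sf sh sc se sa
  rw [two_mul_sqrtNeg_one_pow] at sh se
  have e5 : (5 : ℂ) ^ (4 * n) = 25 ^ (2 * n) := by
    rw [show 4 * n = 2 * (2 * n) by ring, pow_mul]; norm_num
  have e81 : (81 : ℂ) ^ n = 9 ^ (2 * n) := by rw [pow_mul]; norm_num
  have e16 : (16 : ℂ) ^ n = (4 ^ n) ^ 2 := by rw [← pow_mul, mul_comm, pow_mul]; norm_num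
  have e4 : (4 : ℂ) ^ (2 * n) = (4 ^ n) ^ 2 := by rw [mul_comm, pow_mul]
  have e36 := thirtySix_pow (2 * n)
  simp only [relSum, famC, block, List.map_cons, List.map_nil, List.cons_append, List.nil_append,
    List.zipWith_cons_cons, List.zipWith_nil_left, List.sum_cons, List.sum_nil]
  have hp := two_re_three_add_four_I n
  rw [famCPeriod, show 4 * n + 1 = 2 * (2 * n) + 1 by ring, five_pow_eq]
  push_cast at hp ⊢
  rw [hp, lambdaC_cast, X_cast, Y_cast, e5, e81, e16]
  generalize (3 + 4 * sqrtNeg 1) ^ (2 * n) = P at *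
  generalize (3 - 4 * sqrtNeg 1) ^ (2 * n) = P' at *
  rw [e36] at h6 sk ⊢
  rw [e4] at h6 t2b t2 sk sa sb ⊢
  rw [neg_pow 4] at *
  rw [one_pow] at *
  -- Products of two signs (-1)^n occur; fixing the parity of n makes the identity linear in the
  -- relations.
  have h := neg_one_pow_eq_or ℂ n
  generalize (-1 : ℂ) ^ n = s at *
  obtain rfl | rfl := h
  · linear_combination (4 ^ n - (2 * (4 ^ n) ^ 2 + 1)) * (h6 + sk + (3 * 9 ^ (2 * n) + 1) * t2b +
      4 ^ n * (t5b + sl + sm + sn + so + sp) - 4 ^ n * (3 * 9 ^ (2 * n) + 1) / 2 *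
      (t5 + sf + sg + sh + si + sj) - 4 ^ n * (P + P') / 2 * (t3 + sc + sd + se)) -
      4 ^ n * (3 * 9 ^ (2 * n) + 1) * (5 * 25 ^ (2 * n) + 1) / 2 * (t2 + sa + sb)
  · linear_combination (4 ^ n + (2 * (4 ^ n) ^ 2 + 1)) * (h6 + sk + (3 * 9 ^ (2 * n) + 1) * t2b -
      4 ^ n * (t5b + sl + sm + sn + so + sp) + 4 ^ n * (3 * 9 ^ (2 * n) + 1) / 2 *
      (t5 + sf + sg + sh + si + sj) + 4 ^ n * (P + P') / 2 * (t3 + sc + sd + se)) -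
      4 ^ n * (3 * 9 ^ (2 * n) + 1) * (5 * 25 ^ (2 * n) + 1) / 2 * (t2 + sa + sb)

lemma famCPeriod_mem (n : ℕ) : famCPeriod n ∈ quadField 1 := by
  rw [famCPeriod, lambdaC_cast]
  repeat' first
    | with_reducible exact qper_mem _ _ _ _ | exact sqrtNeg_mem _
    | exact one_mem _ | exact ofNat_mem _ _
    | apply div_mem | apply add_mem | apply sub_mem | apply mul_mem | apply neg_mem | apply pow_mem

lemma famC_isPoint (n : ℕ) : List.Forall₂ (IsPoint 1) (famC n)
    [6 / 5, 2, 3, 5 / 3, 10 / 3, 5, 15 / 2, 15, 30] := by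
  simp only [famC, block, List.map_cons, List.map_nil, List.cons_append, List.nil_append,
    List.forall₂_cons, isPoint_iff, List.Forall₂.nil, and_true]
  norm_num

lemma six_add_eight_I_pow (n : ℕ) : ((6 + 8 * I) ^ (2 * n) + (6 - 8 * I) ^ (2 * n)).re =
    4 ^ n * (2 * ((3 + 4 * I) ^ (2 * n)).re) := by
  apply ofReal_injective
  have h1 : (6 + 8 * I) ^ (2 * n) = 4 ^ n * (3 + 4 * I) ^ (2 * n) := by
    rw [show 6 + 8 * I = 2 * (3 + 4 * I) by ring, mul_pow, pow_mul 2]; norm_num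
  have h2 : (6 - 8 * I) ^ (2 * n) = 4 ^ n * (3 - 4 * I) ^ (2 * n) := by
    rw [show 6 - 8 * I = 2 * (3 - 4 * I) by ring, mul_pow, pow_mul 2]; norm_num
  rw [h1, h2, re_eq_add_conj, ofReal_mul, two_re_cast]
  simp only [map_mul, map_pow, map_add, map_sub, map_ofNat, conj_I]
  push_cast
  ring

lemma two_mul_cTildeSeq (n : ℕ) : 2 * (1 / 2 * cTildeSeq n) =
    -((famC n).map LambertTerm.c).sum := by
  have e1 : (2 : ℝ) ^ (4 * n) = (4 ^ n) ^ 2 := by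
    rw [← pow_mul, mul_comm n 2, pow_mul, pow_mul]; norm_num
  have e2 : (5 : ℝ) ^ (4 * n) = 625 ^ n := by rw [pow_mul]; norm_num
  have e3 : (3 : ℝ) ^ (4 * n) = 81 ^ n := by rw [pow_mul]; norm_num
  have e4 : (10 : ℝ) ^ (4 * n) = 2 ^ (4 * n) * 5 ^ (4 * n) := by rw [← mul_pow]; norm_num
  have e5 : (15 : ℝ) ^ (4 * n) = 3 ^ (4 * n) * 5 ^ (4 * n) := by rw [← mul_pow]; norm_num
  have e6 : (12 ^ 4 : ℝ) ^ n = (2 ^ (4 * n)) ^ 2 * 81 ^ n := by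
    rw [pow_mul (2 : ℝ) 4 n, ← pow_mul _ n 2, mul_comm n 2, pow_mul _ 2 n, ← mul_pow]; norm_num
  have e7 : (10 ^ 4 : ℝ) ^ n = 2 ^ (4 * n) * 625 ^ n := by rw [pow_mul, ← mul_pow]; norm_num
  have e8 : (4 ^ 4 : ℝ) ^ n = (2 ^ (4 * n)) ^ 2 := by
    rw [pow_mul (2 : ℝ) 4 n, ← pow_mul _ n 2, mul_comm n 2, pow_mul _ 2 n]; norm_num
  have e9 : (18 : ℝ) ^ (2 * n) = 4 ^ n * 81 ^ n := by rw [pow_mul, ← mul_pow]; norm_num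
  have e10 : (16 : ℝ) ^ n = (4 ^ n) ^ 2 := by rw [← pow_mul, mul_comm, pow_mul]; norm_num
  have e11 : (5 ^ 4 : ℝ) ^ n = 625 ^ n := by norm_num
  simp only [famC, block, List.map_cons, List.map_nil, List.cons_append, List.nil_append,
    List.sum_cons, List.sum_nil, X, Y, lambdaC]
  rw [cTildeSeq, six_add_eight_I_pow]
  generalize ((3 + 4 * I) ^ (2 * n)).re = p
  rw [neg_pow (12 ^ 4), neg_pow (10 ^ 4), neg_pow (5 ^ 4), neg_pow (4 ^ 4), neg_pow 4, e6, e7, e8,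
    e9, e10, e11, pow_succ 2, pow_succ 3, pow_succ 5, pow_succ 10, pow_succ 15, e5, e4, e1, e2, e3]
  rcases neg_one_pow_eq_or ℝ n with h | h <;> rw [h] <;> ring

/-! ### Discriminant `-3`, merits `25/3` and `49/3` -/

lemma sixthRoot_pow (n : ℕ) : ((3 + 3 * sqrtNeg 3) / 2) ^ (3 * n) = (-3) ^ (3 * n) := by
  rw [show (3 + 3 * sqrtNeg 3) / 2 = -3 * ((-1 - sqrtNeg 3) / 2) by ring, mul_pow, cubeRoot'_pow,
    mul_one]

lemma sixthRoot_pow' (n : ℕ) : ((3 - 3 * sqrtNeg 3) / 2) ^ (3 * n) = (-3) ^ (3 * n) := by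
  rw [show (3 - 3 * sqrtNeg 3) / 2 = -3 * ((-1 + sqrtNeg 3) / 2) by ring, mul_pow, cubeRoot_pow,
    mul_one]

/-- The period of the relation of discriminant `-3` and merit `25/3`. -/
def famYPeriod (n : ℕ) : ℂ :=
  (2 * 4 ^ (3 * n) + 1) / 3 * (25 ^ (3 * n) * (qper (3 * n) 3 (1 / 10) (1 / 10) +
      qper (3 * n) 3 (-1 / 10) (1 / 10) + qper (3 * n) 3 (3 / 10) (1 / 10) +
      qper (3 * n) 3 (-3 / 10) (1 / 10) + qper (3 * n) 3 (1 / 2) (1 / 10)) +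
      ((11 + 5 * sqrtNeg 3) / 2) ^ (3 * n) * qper (3 * n) 3 (3 / 14) (5 / 14)) -
    (5 * 25 ^ (3 * n) + 1) / 3 * 4 ^ (3 * n) *
      (qper (3 * n) 3 (1 / 4) (1 / 4) + qper (3 * n) 3 (-1 / 4) (1 / 4))

/-- In T_5 at (1+√-3)/2 with N = 3n the cube roots of unity drop out: up to periods its six points
give three copies each of φ(1/2 + 5√-3/2) and (-3)^N φ(1/2 + 5√-3/6), one copy of the latter by a
detour through (3+5√-3)/14. T_2 at 5√-3 and 5√-3/3 moves both to the axis, and T_2 at (1+√-3)/2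
replaces its value by that at √-3. -/
theorem famY_relSum {n : ℕ} (hn : 1 ≤ n) :
    relSum (3 * n) 3 (famY n) [1, 5 / 6, 5 / 3, 5 / 2, 10 / 3, 5, 10] =
      ipi (3 * n) * famYPeriod n := by
  have hN : 1 ≤ 3 * n := by omega
  have t2a := ph_hecke_two hN three_pos 0 5 0 10 0 (1 / 2) (5 / 2)
  have t2b := ph_hecke_two hN three_pos 0 (5 / 3) 0 (10 / 3) 0 (1 / 2) (5 / 6)
  have tw := ph_hecke_two hN three_pos (1 / 2) (1 / 2) 0 1 (1 / 4) (-1 / 4) (1 / 4)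
  have t5 := ph_hecke_five hN three_pos (1 / 2) (1 / 2) (1 / 2) (5 / 2) (1 / 10) (3 / 10) (1 / 2)
    (-3 / 10) (-1 / 10) (1 / 10)
  have s3 := ph_step hN three_pos (1 / 4) (1 / 4) 0 1 4 ((-1 + sqrtNeg 3) / 2) (by push_cast; ring)
  have s4 := ph_step hN three_pos (-1 / 4) (1 / 4) 0 1 4 ((-1 - sqrtNeg 3) / 2) (by push_cast; ring)
  have sa := ph_step hN three_pos (1 / 10) (1 / 10) (1 / 2) (5 / 2) 25 ((-1 + sqrtNeg 3) / 2)
    (by push_cast; ring)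
  have sa' := ph_step hN three_pos (-1 / 10) (1 / 10) (1 / 2) (5 / 2) 25 ((-1 - sqrtNeg 3) / 2)
    (by push_cast; ring)
  have sb := ph_step hN three_pos (3 / 10) (1 / 10) (1 / 2) (5 / 6) 25 ((3 + 3 * sqrtNeg 3) / 2)
    (by push_cast; ring)
  have sb' := ph_step hN three_pos (-3 / 10) (1 / 10) (1 / 2) (5 / 6) 25 ((3 - 3 * sqrtNeg 3) / 2)
    (by push_cast; ring)
  have sc := ph_step hN three_pos (1 / 2) (1 / 10) (3 / 14) (5 / 14) 25 ((11 + 5 * sqrtNeg 3) / 2)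
    (by push_cast; ring)
  have sd := ph_step hN three_pos (3 / 14) (5 / 14) (1 / 2) (5 / 6) ((11 + 5 * sqrtNeg 3) / 2) (-3)
    (by push_cast; linear_combination (-75 / 196) * sqrtNeg_sq 3)
  rw [cubeRoot_pow] at s3 sa
  rw [cubeRoot'_pow] at s4 sa'
  rw [sixthRoot_pow] at sb
  rw [sixthRoot_pow'] at sb'
  have e1 : (-27 : ℂ) ^ n = (-3) ^ (3 * n) := by rw [pow_mul]; norm_num
  have e2 : (64 : ℂ) ^ n = 4 ^ (3 * n) := by rw [pow_mul]; norm_num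
  -- The relations T_2 enter divided by 4^N; treating the inverse as a variable j with 4^N j = 1
  -- keeps the final identity polynomial.
  have hj : (4 : ℂ) ^ (3 * n) * (4 ^ (3 * n))⁻¹ = 1 :=
    mul_inv_cancel₀ (pow_ne_zero _ (by norm_num))
  simp only [relSum, famY, block, List.map_cons, List.map_nil, List.zipWith_cons_cons,
    List.zipWith_nil_left, List.sum_cons, List.sum_nil]
  rw [show 6 * n + 1 = 2 * (3 * n) + 1 by ring, five_pow_eq]
  push_cast
  rw [X_cast, famYPeriod, e1, e2, div_eq_mul_inv _ (4 ^ (3 * n))]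
  generalize ((4 : ℂ) ^ (3 * n))⁻¹ = j at *
  linear_combination -((2 * 4 ^ (3 * n) + 1) * j) * (t2a + (-3) ^ (3 * n) * t2b) +
    (2 * 4 ^ (3 * n) + 1) / 3 * (t5 + sa + sa' + sb + sb' + sc + sd) -
    (5 * 25 ^ (3 * n) + 1) / 3 * (tw + s3 + s4) +
    (2 * 4 ^ (3 * n) + 1) * (ph (3 * n) 3 (1 / 2) (5 / 2) +
      (-3) ^ (3 * n) * ph (3 * n) 3 (1 / 2) (5 / 6)) * hj

lemma famYPeriod_mem (n : ℕ) : famYPeriod n ∈ quadField 3 := by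
  rw [famYPeriod]
  repeat' first
    | with_reducible exact qper_mem _ _ _ _ | exact sqrtNeg_mem _
    | exact one_mem _ | exact ofNat_mem _ _
    | apply div_mem | apply add_mem | apply sub_mem | apply mul_mem | apply pow_mem

lemma famY_isPoint (n : ℕ) :
    List.Forall₂ (IsPoint 3) (famY n) [1, 5 / 6, 5 / 3, 5 / 2, 10 / 3, 5, 10] := by
  simp only [famY, block, List.map_cons, List.map_nil, List.forall₂_cons, isPoint_iff,
    List.Forall₂.nil, and_true]
  norm_num

lemma X_six_eq (n : ℕ) : X (6 * n + 1) = 2 * 64 ^ n + 1 := by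
  rw [X, pow_succ, pow_mul]; norm_num [mul_comm]

lemma two_mul_ySeq (n : ℕ) : 2 * (42 * ySeq n) = -((famY n).map LambertTerm.c).sum := by
  have e1 : (-3 : ℝ) ^ (3 * n) = (-27) ^ n := by rw [pow_mul]; norm_num
  have e2 : (2 : ℝ) ^ (6 * n + 1) = X (6 * n + 1) - 1 := by rw [X]; ring
  simp only [famY, block, List.map_cons, List.map_nil, List.sum_cons, List.sum_nil]
  rw [ySeq, e1, e2, X_six_eq]
  field_simp
  ring

/-- The period of the relation of discriminant `-3` and merit `49/3`. -/
def famZPeriod (n : ℕ) : ℂ :=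
  (kappaZ n : ℝ) / 3 * (49 ^ (3 * n) * (qper (3 * n) 3 (1 / 14) (1 / 14) +
      qper (3 * n) 3 (-1 / 14) (1 / 14) + qper (3 * n) 3 (3 / 14) (1 / 14) +
      qper (3 * n) 3 (-3 / 14) (1 / 14) + qper (3 * n) 3 (5 / 14) (1 / 14) +
      qper (3 * n) 3 (-5 / 14) (1 / 14) + qper (3 * n) 3 (1 / 2) (1 / 14)) +
      ((23 + 7 * sqrtNeg 3) / 2) ^ (3 * n) * qper (3 * n) 3 (3 / 26) (7 / 26)) -
    (muZ n : ℝ) / 3 * 9 ^ (3 * n) * (qper (3 * n) 3 (1 / 6) (1 / 6) +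
      qper (3 * n) 3 (-1 / 6) (1 / 6) + qper (3 * n) 3 (1 / 2) (1 / 6))

lemma kappaZ_cast (n : ℕ) :
    ((kappaZ n : ℝ) : ℂ) = 3 * 9 ^ (3 * n) + 1 - (-3) ^ (3 * n) := by
  have e1 : (-27 : ℂ) ^ n = (-3) ^ (3 * n) := by rw [pow_mul]; norm_num
  have h : kappaZ n = Y (2 * (3 * n) + 1) - (-27) ^ n := by
    rw [kappaZ, Y, show 6 * n + 1 = 2 * (3 * n) + 1 by ring]
  rw [h, ofReal_sub, Y_cast, ← e1]
  push_cast
  rfl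

lemma muZ_cast (n : ℕ) : ((muZ n : ℝ) : ℂ) = 7 * 49 ^ (3 * n) + 1 -
    ((1 + 4 * sqrtNeg 3) ^ (3 * n) + (1 - 4 * sqrtNeg 3) ^ (3 * n)) := by
  have h : (2 + sqrtNeg 3) ^ 2 = 1 + 4 * sqrtNeg 3 := by linear_combination sqrtNeg_sq 3
  have e : (7 : ℂ) ^ (2 * (3 * n) + 1) = 7 * 49 ^ (3 * n) := by
    rw [pow_succ, pow_mul, mul_comm]; norm_num
  rw [muZ, show 6 * n = 2 * (3 * n) by ring, ofReal_sub, two_re_cast, pow_mul, h, map_pow, map_add,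
    map_mul, sqrtNeg_conj, map_one, map_ofNat]
  push_cast
  rw [e]
  ring

/-- At w = (1+√-3)/2, up to periods, T_3 reads `kappaZ` · φ(w) = 3φ(1/2 + 3√-3/2), and T_7 expresses
`muZ` · φ(w) by three copies each of the points of heights 7/2 and 7/6 (in units of √-3).
Cross-multiplying by `kappaZ` and `muZ` eliminates φ(w), and T_2 moves the remaining points to the
axis. -/
theorem famZ_relSum {n : ℕ} (hn : 1 ≤ n) :
    relSum (3 * n) 3 (famZ n) [7 / 6, 7 / 3, 14 / 3, 3 / 2, 3, 6, 7 / 2, 7, 14] =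
      ipi (3 * n) * famZPeriod n := by
  have hN : 1 ≤ 3 * n := by omega
  have t2a := ph_hecke_two hN three_pos 0 (7 / 3) 0 (14 / 3) 0 (1 / 2) (7 / 6)
  have t2b := ph_hecke_two hN three_pos 0 3 0 6 0 (1 / 2) (3 / 2)
  have t2c := ph_hecke_two hN three_pos 0 7 0 14 0 (1 / 2) (7 / 2)
  have t3 := ph_hecke_three hN three_pos (1 / 2) (1 / 2) (1 / 2) (3 / 2) (1 / 6) (1 / 2) (-1 / 6)
    (1 / 6)
  have t7 := ph_hecke_seven hN three_pos (1 / 2) (1 / 2) (1 / 2) (7 / 2) (1 / 14) (3 / 14) (5 / 14)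
    (1 / 2) (-5 / 14) (-3 / 14) (-1 / 14) (1 / 14)
  have sa := ph_step hN three_pos (1 / 6) (1 / 6) (1 / 2) (3 / 2) 9 ((-1 + sqrtNeg 3) / 2)
    (by push_cast; ring)
  have sa' := ph_step hN three_pos (-1 / 6) (1 / 6) (1 / 2) (3 / 2) 9 ((-1 - sqrtNeg 3) / 2)
    (by push_cast; ring)
  have sb := ph_step hN three_pos (1 / 2) (1 / 6) (1 / 2) (1 / 2) 9 ((3 + 3 * sqrtNeg 3) / 2)
    (by push_cast; ring)
  have sc := ph_step hN three_pos (1 / 14) (1 / 14) (1 / 2) (7 / 2) 49 ((-1 + sqrtNeg 3) / 2)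
    (by push_cast; ring)
  have sc' := ph_step hN three_pos (-1 / 14) (1 / 14) (1 / 2) (7 / 2) 49 ((-1 - sqrtNeg 3) / 2)
    (by push_cast; ring)
  have sd := ph_step hN three_pos (3 / 14) (1 / 14) (1 / 2) (7 / 6) 49 ((3 + 3 * sqrtNeg 3) / 2)
    (by push_cast; ring)
  have sd' := ph_step hN three_pos (-3 / 14) (1 / 14) (1 / 2) (7 / 6) 49 ((3 - 3 * sqrtNeg 3) / 2)
    (by push_cast; ring)
  have se := ph_step hN three_pos (5 / 14) (1 / 14) (1 / 2) (1 / 2) 49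
    ((1 - 4 * sqrtNeg 3) * ((-1 + sqrtNeg 3) / 2))
    (by push_cast; linear_combination (-2) * sqrtNeg_sq 3)
  have se' := ph_step hN three_pos (-5 / 14) (1 / 14) (1 / 2) (1 / 2) 49
    ((1 + 4 * sqrtNeg 3) * ((-1 - sqrtNeg 3) / 2))
    (by push_cast; linear_combination (-2) * sqrtNeg_sq 3)
  have sf := ph_step hN three_pos (1 / 2) (1 / 14) (3 / 26) (7 / 26) 49 ((23 + 7 * sqrtNeg 3) / 2)
    (by push_cast; ring)
  have sg := ph_step hN three_pos (3 / 26) (7 / 26) (1 / 2) (7 / 6) ((23 + 7 * sqrtNeg 3) / 2) (-3)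
    (by push_cast; linear_combination (-147 / 676) * sqrtNeg_sq 3)
  rw [cubeRoot_pow] at sa sc
  rw [cubeRoot'_pow] at sa' sc'
  rw [sixthRoot_pow] at sb sd
  rw [sixthRoot_pow'] at sd'
  rw [mul_pow, cubeRoot_pow] at se
  rw [mul_pow, cubeRoot'_pow] at se'
  have e1 : (-27 : ℂ) ^ n = (-3) ^ (3 * n) := by rw [pow_mul]; norm_num
  have e2 : (64 : ℂ) ^ n = 4 ^ (3 * n) := by rw [pow_mul]; norm_num
  have hj : (4 : ℂ) ^ (3 * n) * (4 ^ (3 * n))⁻¹ = 1 :=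
    mul_inv_cancel₀ (pow_ne_zero _ (by norm_num))
  simp only [relSum, famZ, block, List.map_cons, List.map_nil, List.cons_append, List.nil_append,
    List.zipWith_cons_cons, List.zipWith_nil_left, List.sum_cons, List.sum_nil]
  rw [show 6 * n + 1 = 2 * (3 * n) + 1 by ring]
  push_cast
  rw [X_cast, famZPeriod, kappaZ_cast, muZ_cast, e1, e2, div_eq_mul_inv _ (4 ^ (3 * n)),
    div_eq_mul_inv _ (4 ^ (3 * n))]
  generalize ((4 : ℂ) ^ (3 * n))⁻¹ = j at *
  generalize (1 + 4 * sqrtNeg 3) ^ (3 * n) = P at *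
  generalize (1 - 4 * sqrtNeg 3) ^ (3 * n) = P' at *
  linear_combination -((-3) ^ (3 * n) * (3 * 9 ^ (3 * n) + 1 - (-3) ^ (3 * n)) * j) * t2a +
    (7 * 49 ^ (3 * n) + 1 - (P + P')) * j * t2b -
    (3 * 9 ^ (3 * n) + 1 - (-3) ^ (3 * n)) * j * t2c +
    (3 * 9 ^ (3 * n) + 1 - (-3) ^ (3 * n)) / 3 *
      (t7 + sc + sc' + sd + sd' + se + se' + sf + sg) -
    (7 * 49 ^ (3 * n) + 1 - (P + P')) / 3 * (t3 + sa + sa' + sb) +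
    ((-3) ^ (3 * n) * (3 * 9 ^ (3 * n) + 1 - (-3) ^ (3 * n)) *
        (ph (3 * n) 3 0 (7 / 6) + ph (3 * n) 3 (1 / 2) (7 / 6)) -
      (7 * 49 ^ (3 * n) + 1 - (P + P')) *
        (ph (3 * n) 3 0 (3 / 2) + ph (3 * n) 3 (1 / 2) (3 / 2)) +
      (3 * 9 ^ (3 * n) + 1 - (-3) ^ (3 * n)) *
        (ph (3 * n) 3 0 (7 / 2) + ph (3 * n) 3 (1 / 2) (7 / 2))) * hj

lemma famZPeriod_mem (n : ℕ) : famZPeriod n ∈ quadField 3 := by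
  rw [famZPeriod, kappaZ_cast, muZ_cast]
  repeat' first
    | with_reducible exact qper_mem _ _ _ _ | exact sqrtNeg_mem _
    | exact one_mem _ | exact ofNat_mem _ _
    | apply div_mem | apply add_mem | apply sub_mem | apply mul_mem | apply neg_mem | apply pow_mem

lemma famZ_isPoint (n : ℕ) : List.Forall₂ (IsPoint 3) (famZ n)
    [7 / 6, 7 / 3, 14 / 3, 3 / 2, 3, 6, 7 / 2, 7, 14] := by
  simp only [famZ, block, List.map_cons, List.map_nil, List.cons_append, List.nil_append,
    List.forall₂_cons, isPoint_iff, List.Forall₂.nil, and_true]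
  norm_num

lemma two_mul_zSeq (n : ℕ) : 2 * (10 * zSeq n) = -((famZ n).map LambertTerm.c).sum := by
  have e1 : (-3 : ℝ) ^ (3 * n) = (-27) ^ n := by rw [pow_mul]; norm_num
  have e2 : (3 : ℝ) ^ (6 * n) = ((-27) ^ n) ^ 2 := by
    rw [← pow_mul, mul_comm n 2, pow_mul, pow_mul]; norm_num
  simp only [famZ, block, List.map_cons, List.map_nil, List.cons_append, List.nil_append,
    List.sum_cons, List.sum_nil, kappaZ, muZ]
  rw [zSeq, pow_succ (-3 : ℝ), e1, pow_succ (3 : ℝ), e2, X_six_eq]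
  field_simp
  ring

/-! ### Lucas sequences -/

/-- The Lucas sequence of the second kind, `aⁿ + bⁿ` with `a + b = P` and `a b = Q`. -/
def luc (P Q : ℤ) : ℕ → ℤ
  | 0 => 2
  | 1 => P
  | n + 2 => P * luc P Q (n + 1) - Q * luc P Q n

/-- The Lucas sequence of the first kind, `(aⁿ - bⁿ) / (a - b)` with `a + b = P`, `a b = Q`. -/
def lucU (P Q : ℤ) : ℕ → ℤ
  | 0 => 0
  | 1 => 1
  | n + 2 => P * lucU P Q (n + 1) - Q * lucU P Q n

/-- Stated over any commutative ring: over ℂ it identifies traces of powers with integers, and over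
ℤ/m it evaluates a Lucas sequence from roots of its characteristic polynomial modulo m. -/
lemma luc_eq {R : Type*} [CommRing R] {P Q : ℤ} (a b : R) (hs : a + b = P) (hp : a * b = Q) :
    ∀ n, a ^ n + b ^ n = (luc P Q n : R)
  | 0 => by rw [luc]; norm_num
  | 1 => by rw [luc, pow_one, pow_one, hs]
  | n + 2 => by
    rw [luc, Int.cast_sub, Int.cast_mul, Int.cast_mul, ← luc_eq a b hs hp n,
      ← luc_eq a b hs hp (n + 1), ← hs, ← hp]
    ring

lemma lucU_eq {R : Type*} [CommRing R] {P Q : ℤ} (a b : R) (hs : a + b = P) (hp : a * b = Q) :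
    ∀ n, a ^ n - b ^ n = (a - b) * (lucU P Q n : R)
  | 0 => by rw [lucU]; norm_num
  | 1 => by rw [lucU]; norm_num
  | n + 2 => by
    have h0 := lucU_eq a b hs hp n
    have h1 := lucU_eq a b hs hp (n + 1)
    rw [lucU, Int.cast_sub, Int.cast_mul, Int.cast_mul, ← hs, ← hp]
    linear_combination (a + b) * h1 - a * b * h0

/-- Multiplying the roots by c multiplies the sum by c and the product by c². It lets a product of a
geometric and a Lucas sequence satisfy a recurrence of order two. -/
lemma luc_smul (c P Q : ℤ) : ∀ n, luc (c * P) (c ^ 2 * Q) n = c ^ n * luc P Q n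
  | 0 => by simp [luc]
  | 1 => by simp [luc]
  | n + 2 => by
    rw [luc, luc, luc_smul c P Q n, luc_smul c P Q (n + 1)]
    ring

lemma two_dvd_luc {P Q : ℤ} (hP : 2 ∣ P) : ∀ n, 2 ∣ luc P Q n
  | 0 => dvd_refl 2
  | 1 => hP
  | n + 2 => dvd_sub (hP.mul_right _) ((two_dvd_luc hP n).mul_left _)

lemma trSigma_eq (n : ℕ) : trSigma n = luc (-4) 9 n := by
  apply ofReal_injective
  rw [trSigma_cast, ofReal_intCast, ← luc_eq (-2 + sqrtNeg 5) (-2 - sqrtNeg 5)]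
  · push_cast; ring
  · push_cast; linear_combination -sqrtNeg_sq 5

lemma two_mul_tauTwo (n : ℕ) : 2 * tauTwo n = luc (-2) 9 n := by
  apply ofReal_injective
  rw [ofReal_mul, tauTwo_cast, ofReal_intCast, ← luc_eq (-1 + 2 * sqrtNeg 2) (-1 - 2 * sqrtNeg 2)]
  · push_cast; ring
  · push_cast; ring
  · push_cast; linear_combination -4 * sqrtNeg_sq 2

lemma bEleven_eq (n : ℕ) : bEleven n = luc (-5) 9 n := by
  apply ofReal_injective
  rw [bEleven_cast, ofReal_intCast, ← luc_eq ((-5 + sqrtNeg 11) / 2) ((-5 - sqrtNeg 11) / 2)]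
  · push_cast; ring
  · push_cast; linear_combination (-1 / 4) * sqrtNeg_sq 11

lemma cEleven_eq (n : ℕ) : cEleven n = luc (-1) 25 n := by
  apply ofReal_injective
  rw [cEleven_cast, ofReal_intCast,
    ← luc_eq ((-1 + 3 * sqrtNeg 11) / 2) ((-1 - 3 * sqrtNeg 11) / 2)]
  · push_cast; ring
  · push_cast; linear_combination (-9 / 4) * sqrtNeg_sq 11

lemma trOmega_eq (n : ℕ) : trOmega n = luc 1 9 n := by
  apply ofReal_injective
  rw [trOmega_cast, ofReal_intCast, ← luc_eq ((1 + sqrtNeg 35) / 2) ((1 - sqrtNeg 35) / 2)]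
  · push_cast; ring
  · push_cast; linear_combination (-1 / 4) * sqrtNeg_sq 35

lemma vSeven_eq (n : ℕ) : vSeven n = 2 * 4 ^ n + 1 + luc (-3) 4 n := by
  apply ofReal_injective
  rw [vSeven_cast, ofReal_add, ofReal_intCast,
    ← luc_eq ((-3 + sqrtNeg 7) / 2) ((-3 - sqrtNeg 7) / 2)]
  · push_cast; ring
  · push_cast; ring
  · push_cast; linear_combination (-1 / 4) * sqrtNeg_sq 7

lemma trThreeFourI_eq (n : ℕ) : 2 * ((3 + 4 * I) ^ (2 * n)).re = luc (-14) 625 n := by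
  apply ofReal_injective
  rw [two_re_three_add_four_I, ofReal_intCast, pow_mul, pow_mul,
    ← luc_eq ((3 + 4 * sqrtNeg 1) ^ 2) ((3 - 4 * sqrtNeg 1) ^ 2)]
  · push_cast; linear_combination 32 * sqrtNeg_sq 1
  · push_cast; linear_combination (256 * sqrtNeg 1 ^ 2 - 544) * sqrtNeg_sq 1

lemma two_re_two_add_pow (n : ℕ) : 2 * ((2 + sqrtNeg 3) ^ (6 * n)).re = luc (-286) 117649 n := by
  apply ofReal_injective
  have h : (2 + sqrtNeg 3) ^ 6 = -143 - 180 * sqrtNeg 3 := by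
    linear_combination (sqrtNeg 3 ^ 4 + 12 * sqrtNeg 3 ^ 3 + 57 * sqrtNeg 3 ^ 2 +
      124 * sqrtNeg 3 + 69) * sqrtNeg_sq 3
  rw [two_re_cast, ofReal_intCast, pow_mul, h,
    ← luc_eq (-143 - 180 * sqrtNeg 3) (-143 + 180 * sqrtNeg 3)]
  · simp only [map_pow, map_sub, map_mul, map_neg, map_ofNat, sqrtNeg_conj]
    ring
  · push_cast; ring
  · push_cast; linear_combination -32400 * sqrtNeg_sq 3

lemma sqrtNeg_ne_zero {D : ℕ} (hD : 0 < D) : sqrtNeg D ≠ 0 := by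
  intro h
  have := sqrtNeg_sq D
  rw [h] at this
  have h' : (D : ℂ) = 0 := by linear_combination this
  exact hD.ne' (by exact_mod_cast h')

/-! ### The imaginary parts of discriminant -23 as Lucas sequences of the first kind -/

lemma imPart_alpha (n : ℕ) : imPart (alpha n) = 4 ^ n * lucU (-11) 36 n := by
  apply ofReal_injective
  have h := lucU_eq (P := -11) (Q := 36) ((-11 + sqrtNeg 23) / 2) ((-11 - sqrtNeg 23) / 2)
    (by push_cast; ring) (by push_cast; linear_combination (-1 / 4) * sqrtNeg_sq 23) n
  have h0 := sqrtNeg_ne_zero (D := 23) (by norm_num)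
  rw [imPart_cast, conj_alpha, alpha_eq, ← mul_sub, h]
  push_cast
  field_simp
  ring

lemma imPart_beta (n : ℕ) : imPart (beta n) = -5 * 4 ^ n * lucU 1 144 n := by
  apply ofReal_injective
  have h := lucU_eq (P := 1) (Q := 144) ((1 - 5 * sqrtNeg 23) / 2) ((1 + 5 * sqrtNeg 23) / 2)
    (by push_cast; ring) (by push_cast; linear_combination (-25 / 4) * sqrtNeg_sq 23) n
  have h0 := sqrtNeg_ne_zero (D := 23) (by norm_num)
  rw [imPart_cast, conj_beta, beta_eq, ← mul_sub, h]
  push_cast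
  field_simp
  ring

lemma imPart_alpha_mul_beta (n : ℕ) :
    imPart (alpha n * beta n) = 28 * 16 ^ n * lucU 52 5184 n := by
  apply ofReal_injective
  have e1 : ((-11 + sqrtNeg 23) / 2) * ((1 - 5 * sqrtNeg 23) / 2) = 26 + 14 * sqrtNeg 23 := by
    linear_combination (-5 / 4) * sqrtNeg_sq 23
  have e2 : ((-11 - sqrtNeg 23) / 2) * ((1 + 5 * sqrtNeg 23) / 2) = 26 - 14 * sqrtNeg 23 := by
    linear_combination (-5 / 4) * sqrtNeg_sq 23
  have h := lucU_eq (P := 52) (Q := 5184) (26 + 14 * sqrtNeg 23) (26 - 14 * sqrtNeg 23)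
    (by push_cast; ring) (by push_cast; linear_combination (-196) * sqrtNeg_sq 23) n
  have h0 := sqrtNeg_ne_zero (D := 23) (by norm_num)
  have e16 : (16 : ℂ) ^ n = 4 ^ n * 4 ^ n := by rw [← mul_pow]; norm_num
  have h1 : 4 ^ n * ((-11 + sqrtNeg 23) / 2) ^ n * (4 ^ n * ((1 - 5 * sqrtNeg 23) / 2) ^ n) =
      16 ^ n * (26 + 14 * sqrtNeg 23) ^ n := by rw [e16, ← e1, mul_pow]; ring
  have h2 : 4 ^ n * ((-11 - sqrtNeg 23) / 2) ^ n * (4 ^ n * ((1 + 5 * sqrtNeg 23) / 2) ^ n) =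
      16 ^ n * (26 - 14 * sqrtNeg 23) ^ n := by rw [e16, ← e2, mul_pow]; ring
  rw [imPart_cast, map_mul, conj_alpha, conj_beta, alpha_eq, beta_eq, h1, h2, ← mul_sub, h]
  push_cast
  field_simp
  ring

lemma imPart_alpha_sq (n : ℕ) : imPart (alpha n ^ 2) = -11 * 16 ^ n * lucU 49 1296 n := by
  apply ofReal_injective
  have e1 : ((-11 + sqrtNeg 23) / 2) ^ 2 = (49 - 11 * sqrtNeg 23) / 2 := by
    linear_combination (1 / 4) * sqrtNeg_sq 23
  have e2 : ((-11 - sqrtNeg 23) / 2) ^ 2 = (49 + 11 * sqrtNeg 23) / 2 := by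
    linear_combination (1 / 4) * sqrtNeg_sq 23
  have h := lucU_eq (P := 49) (Q := 1296) ((49 - 11 * sqrtNeg 23) / 2) ((49 + 11 * sqrtNeg 23) / 2)
    (by push_cast; ring) (by push_cast; linear_combination (-121 / 4) * sqrtNeg_sq 23) n
  have h0 := sqrtNeg_ne_zero (D := 23) (by norm_num)
  have e16 : (16 : ℂ) ^ n = (4 ^ n) ^ 2 := by rw [← pow_mul, mul_comm, pow_mul]; norm_num
  have h1 : (4 ^ n * ((-11 + sqrtNeg 23) / 2) ^ n) ^ 2 =
      16 ^ n * ((49 - 11 * sqrtNeg 23) / 2) ^ n := by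
    rw [e16, ← e1, ← pow_mul _ 2 n, mul_comm 2 n, pow_mul, mul_pow]
  have h2 : (4 ^ n * ((-11 - sqrtNeg 23) / 2) ^ n) ^ 2 =
      16 ^ n * ((49 + 11 * sqrtNeg 23) / 2) ^ n := by
    rw [e16, ← e2, ← pow_mul _ 2 n, mul_comm 2 n, pow_mul, mul_pow]
  rw [imPart_cast, map_pow, conj_alpha, alpha_eq, h1, h2, ← mul_sub, h]
  push_cast
  field_simp
  ring

/-! ### The denominator sequences as integer sequences -/

/-- A separate integer-valued numerator lets divisibility be checked in ℤ/m and the listed values be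
computed by the kernel. -/
lemma isIntegerSequence_of_numerator {f : ℕ → ℝ} {l : List ℤ} {m : ℤ} {num : ℕ → ℤ} (hm : m ≠ 0)
    (h : ∀ n, m * f n = num n) (hd : ∀ n, m ∣ num n)
    (hv : ∀ (i : ℕ) (hi : i < l.length), num (i + 1) = m * l[i]) : IsIntegerSequence f l := by
  have hm' : (m : ℝ) ≠ 0 := by exact_mod_cast hm
  constructor
  · intro n
    obtain ⟨z, hz⟩ := hd n
    refine ⟨z, mul_left_cancel₀ hm' ?_⟩
    rw [h, hz]
    push_cast
    rfl
  · intro i hi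
    apply mul_left_cancel₀ hm'
    rw [h, hv i hi]
    push_cast
    rfl

/-- `3 s_n`. -/
def sNum (n : ℕ) : ℤ := 4 * 4096 ^ n - 64 ^ n - 2 * (-1728) ^ n - (-27) ^ n

lemma three_mul_sSeq (n : ℕ) : 3 * sSeq n = sNum n := by
  rw [sSeq, sNum, pow_add, pow_add, pow_mul, pow_mul]
  push_cast
  rw [show (4096 : ℝ) = 64 * 64 by norm_num, show (-1728 : ℝ) = 64 * (-27) by norm_num, mul_pow,
    mul_pow]
  norm_num
  ring

lemma twentyOne_dvd_sNum (n : ℕ) : 21 ∣ sNum n := by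
  rw [show (21 : ℤ) = (21 : ℕ) by rfl, ← ZMod.intCast_zmod_eq_zero_iff_dvd, sNum]
  push_cast
  rcases n with _ | n
  · rfl
  -- Modulo 21 both -1728 and -27 are 15, an idempotent, while 4096 and 64 are 1. For positive n the
  -- numerator is therefore 4 - 1 - 30 - 15 = -42.
  have h : IsIdempotentElem (15 : ZMod 21) := rfl
  have h' := h.pow_succ_eq n
  reduce_mod_char
  simp [h']
  rfl

/-- `t_n`. -/
def tNum (n : ℕ) : ℤ := 3 * 9 ^ n - (-8) ^ n - (2 * 4 ^ n - (-2) ^ n) * luc (-2) 9 n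

lemma tSeq_eq (n : ℕ) : tSeq n = tNum n := by
  have h := two_mul_tauTwo n
  rw [tSeq, ← tauTwo, tNum, pow_succ, pow_mul, pow_mul, pow_add, pow_mul, pow_succ]
  push_cast
  rw [← h]
  norm_num
  ring

/-- `2 u_n`. -/
def uNum (n : ℕ) : ℤ := 3 * 9 ^ n - (-5) ^ n - 2 ^ n * luc (-4) 9 n

lemma two_mul_uSeq_eq (n : ℕ) : 2 * uSeq n = uNum n := by
  rw [uSeq, re_two_mul_sigma_pow, trSigma_eq, uNum, pow_succ, pow_mul]
  push_cast
  norm_num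
  ring

/-- Twice the value at `n` of the denominator sequence of discriminant `-20` and merit `36/5`. -/
def uTildeNum (n : ℕ) : ℤ :=
  9 * 162 ^ n - 3 * (-90) ^ n + 18 ^ n - (-10) ^ n
    - (2 * (-20) ^ n - 9 ^ n + 4 ^ n) * luc (-4) 9 n - 2 ^ n * luc (-2) 81 n

lemma two_mul_uTildeSeq_eq (n : ℕ) : 2 * uTildeSeq n = uTildeNum n := by
  have h1 : (sigma ^ n * (2 ^ (2 * n + 1) * (-5) ^ n - 3 ^ (2 * n) + 2 ^ (2 * n) +
      (2 * sigma) ^ n)).re = (2 * (-20) ^ n - 9 ^ n + 4 ^ n) * (sigma ^ n).re +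
      2 ^ n * ((sigma ^ 2) ^ n).re := by
    have e : sigma ^ n * (2 ^ (2 * n + 1) * (-5) ^ n - 3 ^ (2 * n) + 2 ^ (2 * n) +
        (2 * sigma) ^ n) = ((2 * (-20) ^ n - 9 ^ n + 4 ^ n : ℝ) : ℂ) * sigma ^ n +
        ((2 ^ n : ℝ) : ℂ) * (sigma ^ 2) ^ n := by
      push_cast
      rw [show (-20 : ℂ) = 2 ^ 2 * (-5) by norm_num, mul_pow _ _ n, ← pow_mul, mul_pow,
        show (9 : ℂ) = 3 ^ 2 by norm_num, show (4 : ℂ) = 2 ^ 2 by norm_num, ← pow_mul (2 : ℂ),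
        ← pow_mul (3 : ℂ)]
      ring
    rw [e, add_re, re_ofReal_mul, re_ofReal_mul]
  have h2 : 2 * ((sigma ^ 2) ^ n).re = luc (-2) 81 n := by
    have e1 : sigma ^ 2 = -1 - 4 * sqrtNeg 5 := by rw [sigma]; linear_combination sqrtNeg_sq 5
    apply ofReal_injective
    rw [two_re_cast, ofReal_intCast, e1, ← luc_eq (-1 - 4 * sqrtNeg 5) (-1 + 4 * sqrtNeg 5)]
    · simp only [map_pow, map_sub, map_mul, map_neg, map_one, map_ofNat, sqrtNeg_conj]
      ring
    · push_cast; ring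
    · push_cast; linear_combination -16 * sqrtNeg_sq 5
  have h3 := trSigma_eq n
  rw [trSigma] at h3
  rw [uTildeSeq, h1, uTildeNum]
  push_cast
  have e1 : (3 : ℝ) ^ (2 * n) = 9 ^ n := by rw [pow_mul]; norm_num
  have e2 : (3 : ℝ) ^ (4 * n + 2) = 9 * (9 ^ n * 9 ^ n) := by
    rw [← e1]; ring
  rw [← h2, ← h3, e2, pow_succ (3 : ℝ), e1, show (162 : ℝ) = 2 * 9 * 9 by norm_num,
    show (-90 : ℝ) = 2 * 9 * (-5) by norm_num,
    show (18 : ℝ) = 2 * 9 by norm_num, show (-10 : ℝ) = 2 * (-5) by norm_num]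
  simp only [mul_pow]
  ring

/-- `45 v_n`. -/
def vNum (n : ℕ) : ℤ := 36 ^ n + (-11) ^ n - luc (-20) 144 n

lemma fortyFive_mul_vSeq (n : ℕ) : 45 * vSeq n = vNum n := by
  have h : 2 * ((1 + sqrtNeg 11) ^ (2 * n)).re = luc (-20) 144 n := by
    apply ofReal_injective
    have e1 : (1 + sqrtNeg 11) ^ 2 = -10 + 2 * sqrtNeg 11 := by linear_combination sqrtNeg_sq 11
    rw [two_re_cast, ofReal_intCast, pow_mul, e1,
      ← luc_eq (-10 + 2 * sqrtNeg 11) (-10 - 2 * sqrtNeg 11)]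
    · simp only [map_pow, map_add, map_mul, map_neg, map_ofNat, sqrtNeg_conj]
      ring
    · push_cast; ring
    · push_cast; linear_combination -4 * sqrtNeg_sq 11
  rw [vSeq, vNum, h]
  push_cast
  ring

/-- The denominator sequence of discriminant `-11` and merit `400/99`. -/
def vTildeNum (n : ℕ) : ℤ :=
  6 * 396 ^ n + 44 ^ n + 99 ^ n - 3 * (-225) ^ n - (-25) ^ n - 2 * (-100) ^ n + 2 * (-36) ^ n
    + (2 * 44 ^ n - (-25) ^ n - 5 * (-100) ^ n) * luc (-5) 9 n
    + (-4) ^ n * luc (-5) 9 n * luc (-1) 25 n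

lemma vTildeSeq_eq (n : ℕ) : vTildeSeq n = vTildeNum n := by
  rw [vTildeSeq, gEleven, bEleven_eq, cEleven_eq, vTildeNum, pow_succ 3, pow_succ 2, pow_succ 5,
    pow_mul 3, pow_mul 2, pow_mul 5]
  push_cast
  rw [show (396 : ℝ) = 3 ^ 2 * 44 by norm_num, show (-225 : ℝ) = 3 ^ 2 * (-25) by norm_num,
    show (-100 : ℝ) = 2 ^ 2 * (-25) by norm_num, show (-36 : ℝ) = 2 ^ 2 * (-9) by norm_num,
    mul_pow _ (44 : ℝ), mul_pow _ (-25 : ℝ), mul_pow _ (-25 : ℝ), mul_pow _ (-9 : ℝ)]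
  have h : (25 : ℝ) ^ n * (-4) ^ n = (-25) ^ n * 4 ^ n := by
    rw [← mul_pow, ← mul_pow]; norm_num
  norm_num
  linear_combination (-5 * (luc (-5) 9 n : ℝ)) * h

/-- `3 w_n`. -/
def wNum (n : ℕ) : ℤ := 36 ^ n + (-35) ^ n - (2 * (-20) ^ n - 7 ^ n) * luc 1 9 n

lemma three_mul_wSeq (n : ℕ) : 3 * wSeq n = wNum n := by
  rw [wSeq_eq, trOmega_eq, wNum]
  push_cast
  rw [show (-20 : ℝ) = 4 * (-5) by norm_num, mul_pow]
  ring

/-- Four times the denominator sequence of discriminant `-35` and merit `28/5`. -/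
def wTildeNum (n : ℕ) : ℤ :=
  6 * 180 ^ n + 20 ^ n - (3 * 9 ^ n + 4 ^ n + 1) * (-7) ^ n - (-4) ^ n * luc 1 9 n

lemma four_mul_wTildeSeq (n : ℕ) : 4 * wTildeSeq n = wTildeNum n := by
  have e := trOmega_smul (-4) n
  push_cast at e
  rw [wTildeSeq, e, trOmega_eq, wTildeNum, pow_succ, pow_mul, pow_mul]
  push_cast
  norm_num
  ring

/-- `8 x_n`. -/
def xNum (n : ℕ) : ℤ :=
  4 ^ n * (56 * lucU 52 5184 n - 11 * lucU 49 1296 n) +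
    (36 ^ n - (-23) ^ n - 2 * 4 ^ n * (36 ^ n + (-23) ^ n)) * lucU (-11) 36 n +
    5 * (36 ^ n + (-23) ^ n) * lucU 1 144 n

lemma imPart_add (z w : ℂ) : imPart (z + w) = imPart z + imPart w := by
  rw [imPart, imPart, imPart, add_im]; ring

lemma imPart_real_mul (c : ℝ) (z : ℂ) : imPart ((c : ℂ) * z) = c * imPart z := by
  rw [imPart, imPart, im_ofReal_mul]; ring

lemma eight_mul_xSeq (n : ℕ) : 8 * xSeq n = xNum n := by
  have h4 : (4 : ℝ) ^ n ≠ 0 := by positivity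
  have h := xSeq_eq n
  have e : alpha n * (alpha n + 2 * beta n - 2 ^ (2 * n + 1) * gammaPlus n + gammaMinus n)
      - beta n * gammaPlus n = alpha n ^ 2 + ((2 : ℝ) : ℂ) * (alpha n * beta n) +
      ((36 ^ n - (-23) ^ n - 2 ^ (2 * n + 1) * (36 ^ n + (-23) ^ n) : ℝ) : ℂ) * alpha n +
      ((-(36 ^ n + (-23) ^ n) : ℝ) : ℂ) * beta n := by
    rw [gammaPlus, gammaMinus]; push_cast; ring
  rw [e, imPart_add, imPart_add, imPart_add, imPart_real_mul, imPart_real_mul, imPart_real_mul,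
    imPart_alpha, imPart_beta, imPart_alpha_sq, imPart_alpha_mul_beta, pow_succ, pow_mul,
    show (16 : ℝ) = 4 * 4 by norm_num, mul_pow] at h
  rw [xNum]
  push_cast
  apply mul_left_cancel₀ h4
  rw [← mul_assoc, mul_comm _ (8 : ℝ), h]
  norm_num
  ring

/-- The denominator sequence of discriminant `-4`. -/
def cTildeNum (n : ℕ) : ℤ :=
  15 * 202500 ^ n - 10 * 40000 ^ n - 2500 ^ n - 64 ^ n - 4 * (-20736) ^ n + 7 * (-10000) ^ n
    + (-625) ^ n - 2 * (-256) ^ n - 2 * 5184 ^ n + 324 ^ n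
    - (2 * 16 ^ n - (-4) ^ n + 1) * luc (-56) 10000 n

lemma cTildeSeq_eq (n : ℕ) : cTildeSeq n = cTildeNum n := by
  have h : luc (-56) 10000 n = 4 ^ n * luc (-14) 625 n := by rw [← luc_smul]; norm_num
  rw [cTildeSeq, six_add_eight_I_pow, trThreeFourI_eq, cTildeNum, h, pow_succ 15, pow_succ 10,
    pow_succ 2, pow_mul 15, pow_mul 10, pow_mul 5, pow_mul 2, pow_mul 18]
  push_cast
  rw [show (202500 : ℝ) = 4 * 50625 by norm_num, show (40000 : ℝ) = 4 * 10000 by norm_num,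
    show (2500 : ℝ) = 4 * 625 by norm_num, show (64 : ℝ) = 4 * 16 by norm_num,
    show (5184 : ℝ) = 16 * 324 by norm_num]
  simp only [mul_pow]
  norm_num
  ring

/-- `84 y_n`. -/
def yNum (n : ℕ) : ℤ := 5 * 15625 ^ n - 2 * 64 ^ n - (2 * 64 ^ n + 1) * (-27) ^ n

lemma eightyFour_mul_ySeq (n : ℕ) : 84 * ySeq n = yNum n := by
  rw [ySeq, yNum, pow_succ, pow_succ, pow_mul, pow_mul, pow_mul]
  push_cast
  norm_num
  ring

/-- `20 z_n`. -/
def zNum (n : ℕ) : ℤ :=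
  7 * 117649 ^ n - 729 ^ n * (2 + 3 * (-27) ^ n) - luc (-286) 117649 n

lemma twenty_mul_zSeq (n : ℕ) : 20 * zSeq n = zNum n := by
  rw [zSeq, two_re_two_add_pow, zNum, pow_succ, pow_succ, pow_mul, pow_mul, pow_mul]
  push_cast
  norm_num
  ring

/-! ### Divisibility of the numerators -/

lemma isIntegerSequence_sSeq : IsIntegerSequence sSeq [6601, 20377357, 95065741729] :=
  isIntegerSequence_of_numerator (m := 3) (num := sNum) (by norm_num) three_mul_sSeq
    (fun n => (by norm_num : (3 : ℤ) ∣ 21).trans (twentyOne_dvd_sNum n)) (by decide +kernel)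

lemma exists_sSeq_eq_seven_mul (n : ℕ) : ∃ z : ℤ, sSeq n = 7 * z := by
  obtain ⟨z, hz⟩ := twentyOne_dvd_sNum n
  refine ⟨z, ?_⟩
  have h := three_mul_sSeq n
  rw [hz] at h
  push_cast at h
  linear_combination (1 / 3) * h

lemma isIntegerSequence_tSeq :
    IsIntegerSequence tSeq [55, 571, -3557, -1277, 1212475, -4016045, -82965653] :=
  isIntegerSequence_of_numerator (m := 1) (num := tNum) one_ne_zero
    (fun n => by rw [Int.cast_one, one_mul, tSeq_eq]) (fun _ => one_dvd _) (by decide +kernel)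

lemma two_dvd_uNum (n : ℕ) : 2 ∣ uNum n := by
  have h1 : (2 : ℤ) ∣ 3 * 9 ^ n - (-5) ^ n := by
    rw [← even_iff_two_dvd, Int.even_sub']
    simp only [Int.odd_mul, (by decide : Odd (3 : ℤ)), (by decide : Odd (9 : ℤ)).pow,
      (by decide : Odd (-5 : ℤ)).pow, and_self]
  exact dvd_sub h1 ((two_dvd_luc (by norm_num) n).mul_left _)

lemma isIntegerSequence_uSeq :
    IsIntegerSequence uSeq [20, 113, 980, 10793, 86360, 774053, 7471820, 62858993] :=
  isIntegerSequence_of_numerator (m := 2) (num := uNum) two_ne_zero two_mul_uSeq_eq two_dvd_uNum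
    (by decide +kernel)

lemma two_dvd_uTildeNum (n : ℕ) : 2 ∣ uTildeNum n := by
  have h1 : (2 : ℤ) ∣ 9 * 162 ^ n - 3 * (-90) ^ n + 18 ^ n - (-10) ^ n := by
    rcases n with _ | n
    · norm_num
    · refine dvd_sub (dvd_add (dvd_sub ?_ ?_) ?_) ?_
      · exact (dvd_pow (by norm_num) n.succ_ne_zero).mul_left _
      · exact (dvd_pow (by norm_num) n.succ_ne_zero).mul_left _
      · exact dvd_pow (by norm_num) n.succ_ne_zero
      · exact dvd_pow (by norm_num) n.succ_ne_zero
  exact dvd_sub (dvd_sub h1 ((two_dvd_luc (by norm_num) n).mul_left _))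
    ((two_dvd_luc (by norm_num) n).mul_left _)

lemma isIntegerSequence_uTildeSeq :
    IsIntegerSequence uTildeSeq [790, 107111, 20593510, 3025683569, 511718343910] :=
  isIntegerSequence_of_numerator (m := 2) (num := uTildeNum) two_ne_zero two_mul_uTildeSeq_eq
    two_dvd_uTildeNum (by decide +kernel)

/-- Modulo 45 the numbers 36 and -11 are roots of x² + 20x + 144, so the Lucas sequence equals 36^n
+ (-11)^n. -/
lemma fortyFive_dvd_vNum (n : ℕ) : 45 ∣ vNum n := by
  rw [show (45 : ℤ) = (45 : ℕ) by rfl, ← ZMod.intCast_zmod_eq_zero_iff_dvd, vNum]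
  push_cast
  rw [← luc_eq (36 : ZMod 45) (-11) rfl rfl, sub_self]

lemma isIntegerSequence_vSeq :
    IsIntegerSequence vSeq [1, 29, 993, 38293, 1329305, 48535917, 1740077137] :=
  isIntegerSequence_of_numerator (m := 45) (num := vNum) (by norm_num) fortyFive_mul_vSeq
    fortyFive_dvd_vNum (by decide +kernel)

lemma isIntegerSequence_vTildeSeq :
    IsIntegerSequence vTildeSeq [262, 449966, 461557057, 195425426366] :=
  isIntegerSequence_of_numerator (m := 1) (num := vTildeNum) one_ne_zero
    (fun n => by rw [Int.cast_one, one_mul, vTildeSeq_eq]) (fun _ => one_dvd _) (by decide +kernel)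

lemma three_dvd_wNum (n : ℕ) : 3 ∣ wNum n := by
  rw [show (3 : ℤ) = (3 : ℕ) by rfl, ← ZMod.intCast_zmod_eq_zero_iff_dvd, wNum]
  push_cast
  rw [← luc_eq (0 : ZMod 3) 1 rfl rfl]
  reduce_mod_char
  simp only [one_pow]
  generalize (0 : ZMod 3) ^ n = x
  revert x
  decide

lemma isIntegerSequence_wSeq :
    IsIntegerSequence wSeq [16, 5096, -140379, -12384944, 774803876, 34673015481] :=
  isIntegerSequence_of_numerator (m := 3) (num := wNum) (by norm_num) three_mul_wSeq
    three_dvd_wNum (by decide +kernel)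

lemma four_dvd_wTildeNum (n : ℕ) : 4 ∣ wTildeNum n := by
  rcases n with _ | n
  · decide
  rw [show (4 : ℤ) = (4 : ℕ) by rfl, ← ZMod.intCast_zmod_eq_zero_iff_dvd, wTildeNum]
  push_cast
  reduce_mod_char
  simp
  rfl

lemma isIntegerSequence_wTildeSeq :
    IsIntegerSequence wTildeSeq [332, 45583, 8942693, 1562702887, 284184726617] :=
  isIntegerSequence_of_numerator (m := 4) (num := wTildeNum) (by norm_num) four_mul_wTildeSeq
    four_dvd_wTildeNum (by decide +kernel)

lemma lucU_zmod_eight : ∀ n, (lucU (-11) 36 (n + 2) : ZMod 8) = 5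
  | 0 => rfl
  | 1 => rfl
  | n + 2 => by
    rw [lucU]
    push_cast
    rw [lucU_zmod_eight n, lucU_zmod_eight (n + 1)]
    rfl

lemma lucU_zmod_eight' : ∀ n, (lucU 1 144 (n + 1) : ZMod 8) = 1
  | 0 => rfl
  | 1 => rfl
  | n + 2 => by
    rw [lucU]
    push_cast
    rw [lucU_zmod_eight' n, lucU_zmod_eight' (n + 1)]
    rfl

/-- Modulo 8 the Lucas sequences are eventually constant and 4^n vanishes for n ≥ 2; the first two
indices are checked directly. -/
lemma eight_dvd_xNum (n : ℕ) : 8 ∣ xNum n := by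
  rcases n with _ | _ | n
  · decide
  · decide
  rw [show (8 : ℤ) = (8 : ℕ) by rfl, ← ZMod.intCast_zmod_eq_zero_iff_dvd, xNum]
  push_cast
  rw [lucU_zmod_eight, lucU_zmod_eight' (n + 1)]
  have h4 : (4 : ZMod 8) ^ (n + 1 + 1) = 0 := by
    rw [pow_succ, pow_succ, mul_assoc]
    exact mul_zero _
  reduce_mod_char
  simp [h4]
  rfl

lemma isIntegerSequence_xSeq :
    IsIntegerSequence xSeq [25, 85132, -50570780, 66436773424, -39027031565300] :=
  isIntegerSequence_of_numerator (m := 8) (num := xNum) (by norm_num) eight_mul_xSeq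
    eight_dvd_xNum (by decide +kernel)

lemma isIntegerSequence_cTildeSeq :
    IsIntegerSequence cTildeSeq [2639795, 598022567345, 123944841925119215] :=
  isIntegerSequence_of_numerator (m := 1) (num := cTildeNum) one_ne_zero
    (fun n => by rw [Int.cast_one, one_mul, cTildeSeq_eq]) (fun _ => one_dvd _) (by decide +kernel)

lemma five_dvd_cTildeNum (n : ℕ) : 5 ∣ cTildeNum n := by
  rcases n with _ | n
  · decide
  rw [show (5 : ℤ) = (5 : ℕ) by rfl, ← ZMod.intCast_zmod_eq_zero_iff_dvd, cTildeNum]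
  push_cast
  rw [← luc_eq (-1 : ZMod 5) 0 rfl rfl]
  reduce_mod_char
  simp
  have h : (40 : ZMod 5) = 0 := rfl
  linear_combination 4 ^ (n + 1) * h

lemma exists_cTildeSeq_eq_five_mul (n : ℕ) : ∃ z : ℤ, cTildeSeq n = 5 * z := by
  obtain ⟨z, hz⟩ := five_dvd_cTildeNum n
  refine ⟨z, ?_⟩
  rw [cTildeSeq_eq, hz]
  push_cast
  rfl

/-- Modulo 84 the number 15625 is 1, while 64 and -27 = 57 are idempotent, so the numerator is
constant for n ≥ 1. -/
lemma eightyFour_dvd_yNum (n : ℕ) : 84 ∣ yNum n := by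
  rcases n with _ | n
  · decide
  rw [show (84 : ℤ) = (84 : ℕ) by rfl, ← ZMod.intCast_zmod_eq_zero_iff_dvd, yNum]
  push_cast
  have h1 := (show IsIdempotentElem (64 : ZMod 84) from rfl).pow_succ_eq n
  have h2 := (show IsIdempotentElem (57 : ZMod 84) from rfl).pow_succ_eq n
  reduce_mod_char
  simp only [h1, h2, one_pow]
  rfl

lemma isIntegerSequence_ySeq :
    IsIntegerSequence ySeq [970, 14460979, 227188159336, 3547683233832985] :=
  isIntegerSequence_of_numerator (m := 84) (num := yNum) (by norm_num) eightyFour_mul_ySeq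
    eightyFour_dvd_yNum (by decide +kernel)

/-- Modulo 20 the characteristic polynomial has the double root 17, and 9·(-27) is also 17. The
numerator becomes 5·9^n - 5·17^n, and both terms are 5 because 9 and 17 are 1 modulo 4. -/
lemma twenty_dvd_zNum (n : ℕ) : 20 ∣ zNum n := by
  rw [show (20 : ℤ) = (20 : ℕ) by rfl, ← ZMod.intCast_zmod_eq_zero_iff_dvd, zNum]
  push_cast
  rw [← luc_eq (17 : ZMod 20) 17 rfl rfl]
  have h1 : ∀ n, (5 : ZMod 20) * 9 ^ n = 5 := fun n => by
    induction n with
    | zero => rfl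
    | succ n ih => rw [pow_succ, ← mul_assoc, ih]; rfl
  have h2 : ∀ n, (5 : ZMod 20) * 17 ^ n = 5 := fun n => by
    induction n with
    | zero => rfl
    | succ n ih => rw [pow_succ, ← mul_assoc, ih]; rfl
  have e : (117649 : ZMod 20) = 9 := rfl
  have e' : (729 : ZMod 20) = 9 := rfl
  have e17 : (17 : ZMod 20) ^ n = 9 ^ n * (-27) ^ n := by rw [← mul_pow]; rfl
  rw [e, e']
  linear_combination h1 n - h2 n + 3 * e17

lemma isIntegerSequence_zSeq :
    IsIntegerSequence zSeq [44071, 4786291978, 571088556271897] :=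
  isIntegerSequence_of_numerator (m := 20) (num := zNum) (by norm_num) twenty_mul_zSeq
    twenty_dvd_zNum (by decide +kernel)

/-! ### Linear recurrences -/

/-- The shift operator on real sequences. -/
def shift : Module.End ℝ (ℕ → ℝ) := LinearMap.funLeft ℝ ℝ Nat.succ

lemma shift_pow_apply (f : ℕ → ℝ) (i n : ℕ) : (shift ^ i) f n = f (n + i) := by
  induction i generalizing n with
  | zero => rfl
  | succ i ih =>
    rw [pow_succ', Module.End.mul_apply, shift, LinearMap.funLeft_apply, ← shift, ih]
    congr 1
    omega

/-- The real sequences annihilated by an integer polynomial in the shift operator. -/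
def annihilated (p : Polynomial ℤ) : Submodule ℝ (ℕ → ℝ) := LinearMap.ker (Polynomial.aeval shift p)

lemma annihilated_mono {p q : Polynomial ℤ} (h : q ∣ p) : annihilated q ≤ annihilated p := by
  obtain ⟨r, rfl⟩ := h
  intro f hf
  rw [annihilated, LinearMap.mem_ker] at hf ⊢
  rw [mul_comm, map_mul, Module.End.mul_apply, hf, map_zero]

lemma aeval_shift_apply (p : Polynomial ℤ) (f : ℕ → ℝ) (n : ℕ) :
    Polynomial.aeval shift p f n =
      ∑ i ∈ Finset.range (p.natDegree + 1), (p.coeff i : ℝ) * f (n + i) := by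
  rw [Polynomial.aeval_eq_sum_range, LinearMap.sum_apply, Finset.sum_apply]
  refine Finset.sum_congr rfl fun i _ => ?_
  rw [LinearMap.smul_apply, Pi.smul_apply, shift_pow_apply, zsmul_eq_mul]

/-- A monic annihilating polynomial can be solved for the value at n + m with integer coefficients.
-/
lemma obeysRecurrence_of_annihilated {p : Polynomial ℤ} (hp : p.Monic) {m : ℕ}
    (hm : p.natDegree = m) {f : ℕ → ℝ} (hf : f ∈ annihilated p) : ObeysRecurrence f m := by
  subst hm
  refine ⟨fun i => -p.coeff i, fun n => ?_⟩
  have h := congrFun (LinearMap.mem_ker.mp hf) n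
  rw [aeval_shift_apply, Finset.sum_range_succ, hp.coeff_natDegree] at h
  rw [Fin.sum_univ_eq_sum_range (fun i => ((-p.coeff i : ℤ) : ℝ) * f (n + i))]
  simp only [Int.cast_neg, neg_mul, Finset.sum_neg_distrib]
  simp only [Int.cast_one, one_mul, Pi.zero_apply] at h
  linarith

/-- The product of the polynomials `x - λ` for `λ ∈ l` and `x² - P x + Q` for `(P, Q) ∈ q`. -/
def recPoly (l : List ℤ) (q : List (ℤ × ℤ)) : Polynomial ℤ :=
  (l.map fun a => Polynomial.X - Polynomial.C a).prod *
    (q.map fun c => Polynomial.X ^ 2 - Polynomial.C c.1 * Polynomial.X + Polynomial.C c.2).prod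

lemma monic_natDegree_quadratic (c : ℤ × ℤ) :
    (Polynomial.X ^ 2 - Polynomial.C c.1 * Polynomial.X + Polynomial.C c.2).Monic ∧
    (Polynomial.X ^ 2 - Polynomial.C c.1 * Polynomial.X + Polynomial.C c.2).natDegree = 2 := by
  constructor
  · monicity!
  · compute_degree!

lemma monic_natDegree_list_prod {d : ℕ} {l : List (Polynomial ℤ)}
    (h : ∀ p ∈ l, p.Monic ∧ p.natDegree = d) : l.prod.Monic ∧ l.prod.natDegree = d * l.length := by
  induction l with
  | nil => simp [Polynomial.monic_one]
  | cons p l ih =>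
    obtain ⟨h1, h2⟩ := ih fun p hp => h p (List.mem_cons_of_mem _ hp)
    obtain ⟨h3, h4⟩ := h p List.mem_cons_self
    rw [List.prod_cons]
    refine ⟨h3.mul h1, ?_⟩
    rw [h3.natDegree_mul h1, h2, h4, List.length_cons]
    ring

lemma monic_natDegree_recPoly (l : List ℤ) (q : List (ℤ × ℤ)) :
    (recPoly l q).Monic ∧ (recPoly l q).natDegree = l.length + 2 * q.length := by
  have h1 := monic_natDegree_list_prod (d := 1)
    (l := l.map fun a => Polynomial.X - Polynomial.C a) (by
      intro p hp
      obtain ⟨a, -, rfl⟩ := List.mem_map.mp hp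
      exact ⟨Polynomial.monic_X_sub_C a, Polynomial.natDegree_X_sub_C a⟩)
  have h2 := monic_natDegree_list_prod (d := 2)
    (l := q.map fun c => Polynomial.X ^ 2 - Polynomial.C c.1 * Polynomial.X + Polynomial.C c.2) (by
      intro p hp
      obtain ⟨a, -, rfl⟩ := List.mem_map.mp hp
      exact monic_natDegree_quadratic a)
  refine ⟨h1.1.mul h2.1, ?_⟩
  rw [recPoly, h1.1.natDegree_mul h2.1, h1.2, h2.2, List.length_map, List.length_map, one_mul]

lemma geometric_mem_annihilated {a : ℤ} {l : List ℤ} (h : a ∈ l) (q : List (ℤ × ℤ)) :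
    (fun n => (a : ℝ) ^ n) ∈ annihilated (recPoly l q) := by
  have hd : Polynomial.X - Polynomial.C a ∣ recPoly l q :=
    dvd_mul_of_dvd_left (List.dvd_prod (List.mem_map.mpr ⟨a, h, rfl⟩)) _
  apply annihilated_mono hd
  rw [annihilated, LinearMap.mem_ker]
  ext n
  rw [map_sub, Polynomial.aeval_X, Polynomial.aeval_C, LinearMap.sub_apply, Pi.sub_apply,
    ← pow_one shift, shift_pow_apply, Algebra.algebraMap_eq_smul_one, LinearMap.smul_apply,
    Pi.smul_apply, zsmul_eq_mul, Module.End.one_apply, Pi.zero_apply]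
  ring

lemma luc_mem_annihilated {c : ℤ × ℤ} {q : List (ℤ × ℤ)} (h : c ∈ q) (l : List ℤ) :
    (fun n => (luc c.1 c.2 n : ℝ)) ∈ annihilated (recPoly l q) := by
  have hd : Polynomial.X ^ 2 - Polynomial.C c.1 * Polynomial.X + Polynomial.C c.2 ∣ recPoly l q :=
    dvd_mul_of_dvd_right (List.dvd_prod (List.mem_map.mpr ⟨c, h, rfl⟩)) _
  apply annihilated_mono hd
  rw [annihilated, LinearMap.mem_ker]
  ext n
  rw [map_add, map_sub, map_mul, map_pow, Polynomial.aeval_X, Polynomial.aeval_C,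
    Polynomial.aeval_C, LinearMap.add_apply, LinearMap.sub_apply, Pi.add_apply, Pi.sub_apply,
    shift_pow_apply, Module.End.mul_apply, Algebra.algebraMap_eq_smul_one, LinearMap.smul_apply,
    Pi.smul_apply, zsmul_eq_mul, Module.End.one_apply, Algebra.algebraMap_eq_smul_one,
    LinearMap.smul_apply, Pi.smul_apply, zsmul_eq_mul, Module.End.one_apply, Pi.zero_apply]
  have h1 : shift (fun n => (luc c.1 c.2 n : ℝ)) n = luc c.1 c.2 (n + 1) := by
    rw [← pow_one shift, shift_pow_apply]
  rw [h1, luc]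
  push_cast
  ring

lemma sum_zipWith_mem {ι : Type*} {S : Submodule ℝ (ℕ → ℝ)} {g : ι → ℕ → ℝ} {l : List ι}
    (h : ∀ a ∈ l, g a ∈ S) (u : List ℝ) :
    (fun n => (List.zipWith (fun x a => x * g a n) u l).sum) ∈ S := by
  induction l generalizing u with
  | nil =>
    simp only [List.zipWith_nil_right, List.sum_nil]
    exact zero_mem S
  | cons a l ih =>
    rcases u with _ | ⟨x, u⟩
    · exact zero_mem S
    · simp only [List.zipWith_cons_cons, List.sum_cons]
      exact add_mem (S.smul_mem x (h a List.mem_cons_self))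
        (ih (fun b hb => h b (List.mem_cons_of_mem _ hb)) u)

/-- A geometric sequence contributes a linear factor and a Lucas sequence a quadratic one; the order
is the degree of the product. -/
lemma obeysRecurrence_of_eq_sum {f : ℕ → ℝ} (l : List ℤ) (q : List (ℤ × ℤ)) {m : ℕ}
    (hm : l.length + 2 * q.length = m) (u w : List ℝ)
    (h : ∀ n, f n = (List.zipWith (fun x (a : ℤ) => x * (a : ℝ) ^ n) u l).sum +
      (List.zipWith (fun x (c : ℤ × ℤ) => x * (luc c.1 c.2 n : ℝ)) w q).sum) :
    ObeysRecurrence f m := by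
  obtain ⟨h1, h2⟩ := monic_natDegree_recPoly l q
  refine obeysRecurrence_of_annihilated h1 (h2.trans hm) ?_
  rw [funext h]
  exact add_mem
    (sum_zipWith_mem (g := fun (a : ℤ) n => (a : ℝ) ^ n)
      (fun _ ha => geometric_mem_annihilated ha q) u)
    (sum_zipWith_mem (g := fun (c : ℤ × ℤ) n => (luc c.1 c.2 n : ℝ))
      (fun _ hc => luc_mem_annihilated hc l) w)

theorem obeysRecurrence_sSeq : ObeysRecurrence sSeq 4 := by
  refine obeysRecurrence_of_eq_sum [4096, 64, -1728, -27] [] rfl [4 / 3, -1 / 3, -2 / 3, -1 / 3] []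
    fun n => ?_
  have h := three_mul_sSeq n
  rw [sNum] at h
  push_cast at h
  simp only [List.zipWith_cons_cons, List.zipWith_nil_left, List.sum_cons, List.sum_nil]
  push_cast
  linear_combination (1 / 3) * h

theorem obeysRecurrence_uTildeSeq : ObeysRecurrence uTildeSeq 12 := by
  -- A pair (cP, c²Q) encodes c^n times the Lucas sequence of (P, Q). The order is 4 + 2·4.
  refine obeysRecurrence_of_eq_sum [162, -90, 18, -10]
    [(-20 * -4, (-20) ^ 2 * 9), (9 * -4, 9 ^ 2 * 9), (4 * -4, 4 ^ 2 * 9), (2 * -2, 2 ^ 2 * 81)] rfl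
    [9 / 2, -3 / 2, 1 / 2, -1 / 2] [-1, 1 / 2, -1 / 2, -1 / 2] fun n => ?_
  have h := two_mul_uTildeSeq_eq n
  rw [uTildeNum] at h
  simp only [List.zipWith_cons_cons, List.zipWith_nil_left, List.sum_cons, List.sum_nil, luc_smul]
  push_cast at h ⊢
  linear_combination (1 / 2) * h

/-- A product of two traces from the same quadratic field is a sum of two traces: (a + a')(b + b') =
(ab + a'b') + (ab' + a'b). Both have norm 9·25. -/
lemma luc_mul_luc_eleven (n : ℕ) :
    (luc (-5) 9 n : ℝ) * luc (-1) 25 n = luc (-14) 225 n + luc 19 225 n := by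
  have h : (luc (-5) 9 n : ℂ) * luc (-1) 25 n = luc (-14) 225 n + luc 19 225 n := by
    rw [← luc_eq ((-5 + sqrtNeg 11) / 2) ((-5 - sqrtNeg 11) / 2) (by push_cast; ring)
        (by push_cast; linear_combination (-1 / 4) * sqrtNeg_sq 11),
      ← luc_eq ((-1 + 3 * sqrtNeg 11) / 2) ((-1 - 3 * sqrtNeg 11) / 2) (by push_cast; ring)
        (by push_cast; linear_combination (-9 / 4) * sqrtNeg_sq 11),
      ← luc_eq (((-5 + sqrtNeg 11) / 2) * ((-1 + 3 * sqrtNeg 11) / 2))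
        (((-5 - sqrtNeg 11) / 2) * ((-1 - 3 * sqrtNeg 11) / 2))
        (by push_cast; linear_combination (3 / 2) * sqrtNeg_sq 11)
        (by push_cast; linear_combination ((9 / 16) * sqrtNeg 11 ^ 2 - 325 / 16) * sqrtNeg_sq 11),
      ← luc_eq (((-5 + sqrtNeg 11) / 2) * ((-1 - 3 * sqrtNeg 11) / 2))
        (((-5 - sqrtNeg 11) / 2) * ((-1 + 3 * sqrtNeg 11) / 2))
        (by push_cast; linear_combination (-3 / 2) * sqrtNeg_sq 11)
        (by push_cast; linear_combination ((9 / 16) * sqrtNeg 11 ^ 2 - 325 / 16) * sqrtNeg_sq 11)]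
    simp only [mul_pow]
    ring
  exact_mod_cast h

theorem obeysRecurrence_vTildeSeq : ObeysRecurrence vTildeSeq 17 := by
  refine obeysRecurrence_of_eq_sum [396, 44, 99, -225, -25, -100, -36]
    [(44 * -5, 44 ^ 2 * 9), (-25 * -5, (-25) ^ 2 * 9), (-100 * -5, (-100) ^ 2 * 9),
      (-4 * -14, (-4) ^ 2 * 225), (-4 * 19, (-4) ^ 2 * 225)] rfl
    [6, 1, 1, -3, -1, -2, 2] [2, -1, -5, 1, 1] fun n => ?_
  have h := luc_mul_luc_eleven n
  rw [vTildeSeq_eq, vTildeNum]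
  simp only [List.zipWith_cons_cons, List.zipWith_nil_left, List.sum_cons, List.sum_nil, luc_smul]
  push_cast
  linear_combination (-4) ^ n * h

theorem obeysRecurrence_cTildeSeq : ObeysRecurrence cTildeSeq 16 := by
  refine obeysRecurrence_of_eq_sum
    [202500, 40000, 2500, 64, -20736, -10000, -625, -256, 5184, 324]
    [(16 * -56, 16 ^ 2 * 10000), (-4 * -56, (-4) ^ 2 * 10000), (-56, 10000)] rfl
    [15, -10, -1, -1, -4, 7, 1, -2, -2, 1] [-2, 1, -1] fun n => ?_
  rw [cTildeSeq_eq, cTildeNum]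
  simp only [List.zipWith_cons_cons, List.zipWith_nil_left, List.sum_cons, List.sum_nil, luc_smul]
  push_cast
  ring

/-! ### Nonvanishing of the numerators and of the leading coefficients -/

lemma two_pow_sq (n : ℕ) : ((2 : ZMod 3) ^ n) ^ 2 = 1 := by
  rw [← pow_mul, mul_comm, pow_mul]
  exact one_pow _

/-- The roots are 1 and 0, whose difference is 1. -/
lemma lucU_succ_eq_one {R : Type*} [CommRing R] {P Q : ℤ} (hP : (P : R) = 1) (hQ : (Q : R) = 0)
    (n : ℕ) : (lucU P Q (n + 1) : R) = 1 := by
  have h := lucU_eq (1 : R) 0 (by rw [hP, add_zero]) (by rw [hQ, mul_zero]) (n + 1)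
  simpa using h.symm

/-- Twice the coefficient of `ζ(2n+1)` for discriminant `-7`. -/
def sevenNum (n : ℕ) : ℤ :=
  (2 * 4 ^ n + 1 + luc (-3) 4 n) * (9 ^ n + 4 ^ n) +
    4 ^ n * (1 - 2 * (2 * 4 ^ n + 1 + luc (-3) 4 n)) * (1 + (-7) ^ n) + 2 * 16 ^ n * (3 * 9 ^ n + 1)

lemma two_mul_sevenSeq_eq (n : ℕ) : 2 * sevenSeq n = sevenNum n := by
  rw [sevenSeq, vSeven_eq, Y_eq, sevenNum]
  push_cast
  ring

/-- `zI n` as an integer. -/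
def zINum (n : ℕ) : ℤ := 2 ^ n * (3 * 9 ^ n + 1) + (2 * 4 ^ n + 1) * luc (-4) 9 n

lemma zI_eq (n : ℕ) : zI n = zINum n := by
  rw [zI, X_eq, Y_eq, trSigma_eq, zINum]
  push_cast
  rfl

/-- `zSeven n` as an integer. -/
def zSevenNum (n : ℕ) : ℤ := (2 * 4 ^ n + 1) * (2 * 4 ^ n + 1 + luc (-3) 4 n) - 4 ^ n

lemma zSeven_eq (n : ℕ) : zSeven n = zSevenNum n := by
  rw [zSeven, X_eq, vSeven_eq, zSevenNum]
  push_cast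
  rfl

/-- `4 kappaX n` as an integer. -/
def kappaXNum (n : ℕ) : ℤ := -5 * lucU 1 144 n + (2 * 4 ^ n + 1) * lucU (-11) 36 n

lemma four_mul_kappaX (n : ℕ) : 4 * kappaX n = kappaXNum n := by
  rw [kappaX, X_eq, imPart_alpha, imPart_beta, kappaXNum, pow_succ]
  push_cast
  field_simp

/-- `lambdaC n` as an integer. -/
def lambdaCNum (n : ℕ) : ℤ := 4 ^ n - (-1) ^ n * (2 * 16 ^ n + 1)

lemma lambdaC_eq (n : ℕ) : lambdaC n = lambdaCNum n := by
  rw [lambdaC, X, lambdaCNum, pow_succ, pow_mul 2]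
  push_cast
  norm_num
  ring

/-- `kappaZ n` as an integer. -/
def kappaZNum (n : ℕ) : ℤ := 3 * 729 ^ n + 1 - (-27) ^ n

lemma kappaZ_eq (n : ℕ) : kappaZ n = kappaZNum n := by
  rw [kappaZ, kappaZNum, pow_succ, pow_mul 3]
  push_cast
  norm_num
  ring

/-- This and the following nonvanishing statements are congruences: for positive n the powers of
multiples of the modulus disappear and a nonzero residue is left. The modulus is 9 here because the
numerator is divisible by 3; modulo 9 it is 4 - 1 = 3. -/
lemma sNum_ne_zero {n : ℕ} (hn : 1 ≤ n) : sNum n ≠ 0 := by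
  obtain ⟨n, rfl⟩ := Nat.exists_eq_add_of_le' hn
  intro h
  replace h := congrArg (Int.cast : ℤ → ZMod 9) h
  rw [sNum] at h
  push_cast at h
  reduce_mod_char at h
  simp at h
  revert h
  decide

lemma tNum_ne_zero {n : ℕ} (hn : 1 ≤ n) : tNum n ≠ 0 := by
  obtain ⟨n, rfl⟩ := Nat.exists_eq_add_of_le' hn
  intro h
  replace h := congrArg (Int.cast : ℤ → ZMod 3) h
  rw [tNum] at h
  push_cast at h
  rw [← luc_eq (1 : ZMod 3) 0 rfl rfl] at h
  reduce_mod_char at h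
  simp at h
  revert h
  decide

lemma uNum_ne_zero {n : ℕ} (hn : 1 ≤ n) : uNum n ≠ 0 := by
  obtain ⟨n, rfl⟩ := Nat.exists_eq_add_of_le' hn
  intro h
  replace h := congrArg (Int.cast : ℤ → ZMod 3) h
  rw [uNum] at h
  push_cast at h
  rw [← luc_eq (-4 : ZMod 3) 0 rfl rfl] at h
  reduce_mod_char at h
  simp at h
  -- The residue still depends on 2^n, which modulo 3 is only known to have square 1; the remaining
  -- finite check runs over all such residues.
  have hx := two_pow_sq (n + 1)
  generalize (2 : ZMod 3) ^ (n + 1) = x at *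
  revert x
  decide

lemma uTildeNum_ne_zero {n : ℕ} (hn : 1 ≤ n) : uTildeNum n ≠ 0 := by
  obtain ⟨n, rfl⟩ := Nat.exists_eq_add_of_le' hn
  intro h
  replace h := congrArg (Int.cast : ℤ → ZMod 3) h
  rw [uTildeNum] at h
  push_cast at h
  rw [← luc_eq (-4 : ZMod 3) 0 rfl rfl, ← luc_eq (1 : ZMod 3) 0 rfl rfl] at h
  reduce_mod_char at h
  simp at h
  have hx := two_pow_sq (n + 1)
  generalize (2 : ZMod 3) ^ (n + 1) = x at *
  revert x
  decide

lemma vNum_ne_zero {n : ℕ} (hn : 1 ≤ n) : vNum n ≠ 0 := by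
  obtain ⟨n, rfl⟩ := Nat.exists_eq_add_of_le' hn
  intro h
  replace h := congrArg (Int.cast : ℤ → ZMod 2) h
  rw [vNum] at h
  push_cast at h
  rw [← luc_eq (0 : ZMod 2) 0 rfl rfl] at h
  reduce_mod_char at h
  simp at h

lemma vTildeNum_ne_zero {n : ℕ} (hn : 1 ≤ n) : vTildeNum n ≠ 0 := by
  obtain ⟨n, rfl⟩ := Nat.exists_eq_add_of_le' hn
  intro h
  replace h := congrArg (Int.cast : ℤ → ZMod 3) h
  rw [vTildeNum] at h
  push_cast at h
  rw [← luc_eq (1 : ZMod 3) 0 rfl rfl, ← luc_eq (1 : ZMod 3) 1 rfl rfl] at h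
  reduce_mod_char at h
  simp at h
  have hx := two_pow_sq (n + 1)
  generalize (2 : ZMod 3) ^ (n + 1) = x at *
  revert x
  decide

/-- The numerator is always divisible by 3, so the modulus is 5. There the Lucas sequence has the
double root 3 and 7·3 = 1, which leaves 1 + 2. -/
lemma wNum_ne_zero {n : ℕ} (hn : 1 ≤ n) : wNum n ≠ 0 := by
  obtain ⟨n, rfl⟩ := Nat.exists_eq_add_of_le' hn
  intro h
  replace h := congrArg (Int.cast : ℤ → ZMod 5) h
  rw [wNum] at h
  push_cast at h
  rw [← luc_eq (3 : ZMod 5) 3 rfl rfl] at h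
  reduce_mod_char at h
  simp at h
  have hx : (2 : ZMod 5) ^ (n + 1) * 3 ^ (n + 1) = 1 := by rw [← mul_pow]; exact one_pow _
  generalize (2 : ZMod 5) ^ (n + 1) = x at *
  generalize (3 : ZMod 5) ^ (n + 1) = y at *
  revert x y
  decide

lemma wTildeNum_ne_zero {n : ℕ} (hn : 1 ≤ n) : wTildeNum n ≠ 0 := by
  obtain ⟨n, rfl⟩ := Nat.exists_eq_add_of_le' hn
  intro h
  replace h := congrArg (Int.cast : ℤ → ZMod 3) h
  rw [wTildeNum] at h
  push_cast at h
  rw [← luc_eq (1 : ZMod 3) 0 rfl rfl] at h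
  reduce_mod_char at h
  simp at h
  have hx := two_pow_sq (n + 1)
  generalize (2 : ZMod 3) ^ (n + 1) = x at *
  revert x
  decide

lemma sevenNum_ne_zero {n : ℕ} (hn : 1 ≤ n) : sevenNum n ≠ 0 := by
  obtain ⟨n, rfl⟩ := Nat.exists_eq_add_of_le' hn
  intro h
  replace h := congrArg (Int.cast : ℤ → ZMod 7) h
  rw [sevenNum] at h
  push_cast at h
  rw [← luc_eq (2 : ZMod 7) 2 rfl rfl] at h
  reduce_mod_char at h
  simp at h
  -- Modulo 7 everything is a polynomial in 2^n, because 2 is a double root of the characteristic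
  -- polynomial and 4 = 2². As 2 has order 3, only cube roots of unity have to be tested.
  have hx : ((2 : ZMod 7) ^ (n + 1)) ^ 3 = 1 := by
    rw [← pow_mul, mul_comm, pow_mul]; exact one_pow _
  have h4 : (4 : ZMod 7) ^ (n + 1) = (2 ^ (n + 1)) ^ 2 := by
    rw [← pow_mul, mul_comm, pow_mul]; rfl
  rw [h4] at h
  clear h4
  generalize (2 : ZMod 7) ^ (n + 1) = x at *
  revert x
  decide

lemma xNum_ne_zero {n : ℕ} (hn : 1 ≤ n) : xNum n ≠ 0 := by
  obtain ⟨n, rfl⟩ := Nat.exists_eq_add_of_le' hn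
  intro h
  replace h := congrArg (Int.cast : ℤ → ZMod 3) h
  rw [xNum] at h
  push_cast at h
  rw [lucU_succ_eq_one rfl rfl, lucU_succ_eq_one rfl rfl, lucU_succ_eq_one rfl rfl,
    lucU_succ_eq_one rfl rfl] at h
  reduce_mod_char at h
  simp at h
  revert h
  decide

lemma cTildeNum_ne_zero {n : ℕ} (hn : 1 ≤ n) : cTildeNum n ≠ 0 := by
  obtain ⟨n, rfl⟩ := Nat.exists_eq_add_of_le' hn
  intro h
  replace h := congrArg (Int.cast : ℤ → ZMod 3) h
  rw [cTildeNum] at h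
  push_cast at h
  rw [← luc_eq (-1 : ZMod 3) (-1) rfl rfl] at h
  reduce_mod_char at h
  simp at h
  have hx := two_pow_sq (n + 1)
  generalize (2 : ZMod 3) ^ (n + 1) = x at *
  revert x
  decide

lemma yNum_ne_zero {n : ℕ} (hn : 1 ≤ n) : yNum n ≠ 0 := by
  obtain ⟨n, rfl⟩ := Nat.exists_eq_add_of_le' hn
  intro h
  replace h := congrArg (Int.cast : ℤ → ZMod 9) h
  rw [yNum] at h
  push_cast at h
  reduce_mod_char at h
  simp at h
  revert h
  decide

lemma zNum_ne_zero {n : ℕ} (hn : 1 ≤ n) : zNum n ≠ 0 := by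
  obtain ⟨n, rfl⟩ := Nat.exists_eq_add_of_le' hn
  intro h
  replace h := congrArg (Int.cast : ℤ → ZMod 3) h
  rw [zNum] at h
  push_cast at h
  rw [← luc_eq (1 : ZMod 3) 1 rfl rfl] at h
  reduce_mod_char at h
  simp at h
  revert h
  decide

lemma luc_ne_zero_of_sigma {n : ℕ} (hn : 1 ≤ n) : luc (-4) 9 n ≠ 0 := by
  obtain ⟨n, rfl⟩ := Nat.exists_eq_add_of_le' hn
  intro h
  replace h := congrArg (Int.cast : ℤ → ZMod 3) h
  rw [← luc_eq (-4 : ZMod 3) 0 rfl rfl] at h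
  reduce_mod_char at h
  simp at h
  revert h
  decide

lemma zINum_ne_zero {n : ℕ} (hn : 1 ≤ n) : zINum n ≠ 0 := by
  obtain ⟨n, rfl⟩ := Nat.exists_eq_add_of_le' hn
  intro h
  replace h := congrArg (Int.cast : ℤ → ZMod 3) h
  rw [zINum] at h
  push_cast at h
  rw [← luc_eq (-4 : ZMod 3) 0 rfl rfl] at h
  reduce_mod_char at h
  simp at h
  have hx := two_pow_sq (n + 1)
  generalize (2 : ZMod 3) ^ (n + 1) = x at *
  revert x
  decide

lemma zSevenNum_ne_zero {n : ℕ} (hn : 1 ≤ n) : zSevenNum n ≠ 0 := by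
  obtain ⟨n, rfl⟩ := Nat.exists_eq_add_of_le' hn
  intro h
  replace h := congrArg (Int.cast : ℤ → ZMod 3) h
  rw [zSevenNum] at h
  push_cast at h
  reduce_mod_char at h
  simp at h
  generalize (luc (-3) 4 (n + 1) : ZMod 3) = x at *
  revert x
  decide

lemma kappaXNum_ne_zero {n : ℕ} (hn : 1 ≤ n) : kappaXNum n ≠ 0 := by
  obtain ⟨n, rfl⟩ := Nat.exists_eq_add_of_le' hn
  intro h
  replace h := congrArg (Int.cast : ℤ → ZMod 3) h
  rw [kappaXNum] at h
  push_cast at h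
  rw [lucU_succ_eq_one rfl rfl, lucU_succ_eq_one rfl rfl] at h
  reduce_mod_char at h
  simp at h
  revert h
  decide

lemma lambdaCNum_ne_zero {n : ℕ} (hn : 1 ≤ n) : lambdaCNum n ≠ 0 := by
  obtain ⟨n, rfl⟩ := Nat.exists_eq_add_of_le' hn
  intro h
  replace h := congrArg (Int.cast : ℤ → ZMod 2) h
  rw [lambdaCNum] at h
  push_cast at h
  reduce_mod_char at h
  simp at h

lemma kappaZNum_ne_zero {n : ℕ} (hn : 1 ≤ n) : kappaZNum n ≠ 0 := by
  obtain ⟨n, rfl⟩ := Nat.exists_eq_add_of_le' hn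
  intro h
  replace h := congrArg (Int.cast : ℤ → ZMod 3) h
  rw [kappaZNum] at h
  push_cast at h
  reduce_mod_char at h
  simp at h

/-! ### The infinite families -/

lemma div_sixtyFour_pow_mem_dyadic {x : ℝ} (hx : x ∈ dyadic) (m : ℕ) : x / 64 ^ m ∈ dyadic := by
  have := div_two_pow_mem_dyadic hx (6 * m)
  rw [pow_mul] at this
  norm_num at this
  exact this

lemma trSigma_mem_dyadic (n : ℕ) : trSigma n ∈ dyadic := trSigma_eq n ▸ intCast_mem _ _

lemma bEleven_mem_dyadic (n : ℕ) : bEleven n ∈ dyadic := bEleven_eq n ▸ intCast_mem _ _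

lemma cEleven_mem_dyadic (n : ℕ) : cEleven n ∈ dyadic := cEleven_eq n ▸ intCast_mem _ _

lemma gEleven_mem_dyadic (n : ℕ) : gEleven n ∈ dyadic :=
  gEleven_eq n ▸ add_mem (Y_mem_dyadic _) (bEleven_mem_dyadic n)

lemma fEleven_mem_dyadic (n : ℕ) : fEleven n ∈ dyadic :=
  mul_mem (bEleven_mem_dyadic n)
    (sub_mem (add_mem (pow_mem (ofNat_mem _ 5) _) (one_mem _)) (cEleven_mem_dyadic n))

lemma trOmega_mem_dyadic (n : ℕ) : trOmega n ∈ dyadic := trOmega_eq n ▸ intCast_mem _ _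

lemma zI_mem_dyadic (n : ℕ) : zI n ∈ dyadic := zI_eq n ▸ intCast_mem _ _

lemma zSeven_mem_dyadic (n : ℕ) : zSeven n ∈ dyadic := zSeven_eq n ▸ intCast_mem _ _

lemma vSeven_mem_dyadic (n : ℕ) : vSeven n ∈ dyadic := by
  rw [vSeven_eq]
  exact add_mem (add_mem (mul_mem (ofNat_mem _ 2) (pow_mem (ofNat_mem _ 4) _)) (one_mem _))
    (intCast_mem _ _)

lemma lambdaC_mem_dyadic (n : ℕ) : lambdaC n ∈ dyadic := lambdaC_eq n ▸ intCast_mem _ _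

lemma kappaZ_mem_dyadic (n : ℕ) : kappaZ n ∈ dyadic := kappaZ_eq n ▸ intCast_mem _ _

lemma muZ_mem_dyadic (n : ℕ) : muZ n ∈ dyadic := by
  rw [muZ, two_re_two_add_pow]
  exact sub_mem (add_mem (pow_mem (ofNat_mem _ 7) _) (one_mem _)) (intCast_mem _ _)

lemma imPart_alpha_mem_dyadic (n : ℕ) : imPart (alpha n) ∈ dyadic := by
  rw [imPart_alpha]
  exact mul_mem (pow_mem (ofNat_mem _ 4) _) (intCast_mem _ _)

lemma imPart_beta_mem_dyadic (n : ℕ) : imPart (beta n) ∈ dyadic := by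
  rw [imPart_beta]
  exact mul_mem (mul_mem (neg_mem (ofNat_mem _ 5)) (pow_mem (ofNat_mem _ 4) _)) (intCast_mem _ _)

lemma imPart_alpha_mul_beta_mem_dyadic (n : ℕ) : imPart (alpha n * beta n) ∈ dyadic := by
  rw [imPart_alpha_mul_beta]
  exact mul_mem (mul_mem (ofNat_mem _ 28) (pow_mem (ofNat_mem _ 16) _)) (intCast_mem _ _)

lemma imPart_alpha_sq_mem_dyadic (n : ℕ) : imPart (alpha n ^ 2) ∈ dyadic := by
  rw [imPart_alpha_sq]
  exact mul_mem (mul_mem (neg_mem (ofNat_mem _ 11)) (pow_mem (ofNat_mem _ 16) _))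
    (intCast_mem _ _)

lemma div_sixteen_pow_mem_dyadic {x : ℝ} (hx : x ∈ dyadic) (m : ℕ) : x / 16 ^ m ∈ dyadic := by
  have := div_two_pow_mem_dyadic hx (4 * m)
  rw [pow_mul] at this
  norm_num at this
  exact this

lemma kappaX_mem_dyadic (n : ℕ) : kappaX n ∈ dyadic :=
  div_four_pow_mem_dyadic (add_mem (imPart_beta_mem_dyadic n)
    (mul_mem (X_mem_dyadic _) (imPart_alpha_mem_dyadic n))) _

lemma lambdaX_mem_dyadic (n : ℕ) : lambdaX n ∈ dyadic := by
  have h := div_four_pow_mem_dyadic (imPart_alpha_mem_dyadic n) 1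
  rw [pow_one] at h
  exact add_mem (mul_mem (neg_mem (X_mem_dyadic _)) (kappaX_mem_dyadic n)) h

lemma rhoX_mem_dyadic (n : ℕ) : rhoX n ∈ dyadic :=
  add_mem (mul_mem (neg_mem (Y_mem_dyadic _)) (kappaX_mem_dyadic n))
    (div_four_pow_mem_dyadic (add_mem
      (div_sixteen_pow_mem_dyadic
        (mul_mem (X_mem_dyadic _) (imPart_alpha_mul_beta_mem_dyadic n)) _)
      (div_four_pow_mem_dyadic (imPart_alpha_sq_mem_dyadic n) _)) _)

lemma thetaX_mem_dyadic (n : ℕ) : thetaX n ∈ dyadic := by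
  have hX := X_mem_dyadic (2 * n + 1)
  have hY := Y_mem_dyadic (2 * n + 1)
  have h := sub_mem (pow_mem hX 2) (pow_mem (ofNat_mem dyadic 4) n)
  exact div_four_pow_mem_dyadic (add_mem (sub_mem (sub_mem
    (mul_mem (mul_mem hX hY) (imPart_beta_mem_dyadic n))
    (div_sixteen_pow_mem_dyadic (mul_mem h (imPart_alpha_mul_beta_mem_dyadic n)) _))
    (div_four_pow_mem_dyadic (mul_mem hX (imPart_alpha_sq_mem_dyadic n)) _))
    (mul_mem (mul_mem h hY) (imPart_alpha_mem_dyadic n))) _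

lemma tauTwo_mem_dyadic (n : ℕ) : tauTwo n ∈ dyadic :=
  ⟨1, luc (-2) 9 n, by rw [pow_one, two_mul_tauTwo]⟩

lemma trThreeFourI_mem_dyadic (n : ℕ) : 2 * ((3 + 4 * I) ^ (2 * n)).re ∈ dyadic :=
  trThreeFourI_eq n ▸ intCast_mem _ _

lemma trSigma_ne_zero {n : ℕ} (hn : 1 ≤ n) : trSigma n ≠ 0 := by
  rw [trSigma_eq]
  exact_mod_cast luc_ne_zero_of_sigma hn

lemma zI_ne_zero {n : ℕ} (hn : 1 ≤ n) : zI n ≠ 0 := by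
  rw [zI_eq]
  exact_mod_cast zINum_ne_zero hn

lemma zSeven_ne_zero {n : ℕ} (hn : 1 ≤ n) : zSeven n ≠ 0 := by
  rw [zSeven_eq]
  exact_mod_cast zSevenNum_ne_zero hn

lemma kappaX_ne_zero {n : ℕ} (hn : 1 ≤ n) : kappaX n ≠ 0 := by
  intro h
  have := four_mul_kappaX n
  rw [h, mul_zero] at this
  exact kappaXNum_ne_zero hn (by exact_mod_cast this.symm)

lemma lambdaC_ne_zero {n : ℕ} (hn : 1 ≤ n) : lambdaC n ≠ 0 := by
  rw [lambdaC_eq]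
  exact_mod_cast lambdaCNum_ne_zero hn

lemma kappaZ_ne_zero {n : ℕ} (hn : 1 ≤ n) : kappaZ n ≠ 0 := by
  rw [kappaZ_eq]
  exact_mod_cast kappaZNum_ne_zero hn

lemma one_le_of_not_three_dvd {n : ℕ} (h : ¬ 3 ∣ n) : 1 ≤ n :=
  Nat.one_le_iff_ne_zero.mpr fun h0 => h (h0 ▸ dvd_zero 3)

lemma two_pow_sub_neg_three_pow_odd (n : ℕ) :
    Odd ((2 : ℤ) ^ (2 * n + 1) - (-3) ^ n) := by
  rw [Int.odd_sub']
  refine iff_of_true (Odd.pow (by decide)) ?_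
  rw [pow_succ]
  exact (even_two).mul_left _

/-- Since 64 is 1 modulo 3, so is 64^n, and 2·64^n + 1 is divisible by 3. This absorbs the
denominator 3 of the coefficients for k = 6n+1. -/
lemma exists_third_X_six (n : ℕ) : ∃ z : ℤ, X (6 * n + 1) = 3 * z := by
  obtain ⟨z, hz⟩ := sub_dvd_pow_sub_pow (64 : ℤ) 1 n
  refine ⟨42 * z + 1, ?_⟩
  have h : (64 : ℝ) ^ n = 1 + 63 * z := by
    rw [one_pow] at hz
    have := congrArg (Int.cast : ℤ → ℝ) hz
    push_cast at this
    linarith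
  rw [X_six_eq, h]
  push_cast
  ring

theorem isFamily_famH : IsFamily {n | ¬ 3 ∣ n} (fun n => 2 * n + 1) 3 (16 / 3)
    (fun n => 2 ^ (2 * n + 1) - (-3) ^ n) famH := by
  refine isFamily_of_relSum (fun n => n) [2 / 3, 1, 2] three_pos
    (fun _ hn => one_le_of_not_three_dvd hn) (fun n => by ring) famH_isPoint
    (fun n hn => ⟨_, famHPeriod_mem n, famH_relSum (one_le_of_not_three_dvd hn) hn⟩)
      (fun n _ => famH_sum n) (fun n hn => ?_)
    (fun n _ => ?_) (fun n _ => ?_) (fun n hn => ⟨_, List.mem_cons_self, ?_, ?_⟩) (by norm_num)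
  · refine ⟨2 * (2 ^ (2 * n + 1) - (-3) ^ n), mul_ne_zero two_ne_zero fun h => ?_, by
      push_cast; ring⟩
    have := two_pow_sub_neg_three_pow_odd n
    rw [h] at this
    exact absurd this (by decide)
  · simp only [famH,
      List.forall_mem_cons, List.not_mem_nil, IsEmpty.forall_iff, implies_true, and_true]
    and_intros
    all_goals repeat' first
      | assumption | exact one_mem _ | exact ofNat_mem _ _ | exact X_mem_dyadic _
      | exact Y_mem_dyadic _ | apply add_mem | apply sub_mem | apply mul_mem | apply neg_mem
      | apply pow_mem
  · simp only [famH,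
      List.forall_mem_cons, List.not_mem_nil, IsEmpty.forall_iff, implies_true, and_true,
      LambertTerm.merit]
    norm_num
  · exact mul_ne_zero two_ne_zero (pow_ne_zero _ (by norm_num))
  · norm_num [LambertTerm.merit]

theorem isFamily_famHSix : IsFamily {n | 1 ≤ n} (fun n => 6 * n + 1) 3 (16 / 3)
    (sSeq) famHSix := by
  refine isFamily_of_relSum (fun n => 3 * n) [2 / 3, 1, 2] three_pos
    (fun n (hn : 1 ≤ n) => by lia) (fun n => by ring) famHSix_isPoint
    (fun n hn => ⟨_, famHSixPeriod_mem n, famHSix_relSum hn⟩) (fun n _ => two_mul_sSeq n)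
      (fun n hn => ?_)
    (fun n _ => ?_) (fun n _ => ?_) (fun n hn => ⟨_, List.mem_cons_self, ?_, ?_⟩) (by norm_num)
  · obtain ⟨z, hz⟩ := isIntegerSequence_sSeq.1 n
    refine ⟨2 * z, mul_ne_zero two_ne_zero fun h => sNum_ne_zero hn ?_, by rw [hz]; push_cast; ring⟩
    have := three_mul_sSeq n
    rw [hz, h] at this
    exact_mod_cast this.symm
  -- All three coefficients are rewritten in z = X/3, where they become integral.
  · obtain ⟨z, hz⟩ := exists_third_X_six n
    have hd : (z : ℝ) ∈ dyadic := intCast_mem _ z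
    have h : (64 : ℝ) ^ n = (3 * z - 1) / 2 := by rw [← hz, X_six_eq]; ring
    simp only [famHSix, List.forall_mem_cons, List.not_mem_nil, IsEmpty.forall_iff, implies_true,
      and_true]
    rw [mul_comm 2 n, pow_mul, h, hz,
      show 2 / 3 * (3 * (z : ℝ)) * (-27) ^ n = 2 * z * (-27) ^ n by ring,
      show -2 / 3 * (4 * ((3 * (z : ℝ) - 1) / 2) ^ 2 + (3 * z - 1) / 2 + 1) =
        -6 * z ^ 2 + 3 * z - 1 by ring,
      show 2 / 3 * (3 * (z : ℝ)) = 2 * z by ring]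
    and_intros
    all_goals repeat' first
      | assumption | exact one_mem _ | exact ofNat_mem _ _ | apply add_mem | apply sub_mem
      | apply mul_mem | apply neg_mem | apply pow_mem
  · simp only [famHSix,
      List.forall_mem_cons, List.not_mem_nil, IsEmpty.forall_iff, implies_true, and_true,
      LambertTerm.merit]
    norm_num
  · exact mul_ne_zero (mul_ne_zero (by norm_num) (X_pos _).ne') (pow_ne_zero _ (by norm_num))
  · norm_num [LambertTerm.merit]

theorem isFamily_famG : IsFamily {n | 1 ≤ n} (fun n => 2 * n + 1) 2 (9 / 2)
    (tSeq) famG := by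
  refine isFamily_of_relSum (fun n => n) [3 / 4, 1, 2, 6] two_pos
    (fun _ hn => hn) (fun n => by ring) famG_isPoint
    (fun n hn => ⟨_, famGPeriod_mem n, famG_relSum hn⟩) (fun n _ => two_mul_tSeq n) (fun n hn => ?_)
    (fun n _ => ?_) (fun n _ => ?_) (fun n hn => ⟨_, List.mem_cons_self, ?_, ?_⟩) (by norm_num)
  · exact ⟨2 * tNum n, mul_ne_zero two_ne_zero (tNum_ne_zero hn), by rw [tSeq_eq]; push_cast; ring⟩
  · have h := tauTwo_mem_dyadic n
    simp only [famG,
      List.forall_mem_cons, List.not_mem_nil, IsEmpty.forall_iff, implies_true, and_true]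
    and_intros
    all_goals repeat' first
      | assumption | exact one_mem _ | exact ofNat_mem _ _ | exact X_mem_dyadic _
      | exact Y_mem_dyadic _ | apply add_mem | apply sub_mem | apply mul_mem | apply neg_mem
      | apply pow_mem
  · simp only [famG,
      List.forall_mem_cons, List.not_mem_nil, IsEmpty.forall_iff, implies_true, and_true,
      LambertTerm.merit]
    norm_num
  · exact mul_ne_zero two_ne_zero (pow_ne_zero _ (by norm_num))
  · norm_num [LambertTerm.merit]

theorem isFamily_famI : IsFamily {n | 1 ≤ n} (fun n => 2 * n + 1) 5 5
    (uSeq) famI := by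
  refine isFamily_of_relSum (fun n => n) [1 / 2, 3 / 5, 1, 2, 3] (by norm_num)
    (fun _ hn => hn) (fun n => by ring) famI_isPoint
    (fun n hn => ⟨_, famIPeriod_mem n, famI_relSum hn⟩) (fun n _ => two_mul_uSeq n) (fun n hn => ?_)
    (fun n _ => ?_) (fun n _ => ?_) (fun n hn => ⟨_, List.mem_cons_self, ?_, ?_⟩) (by norm_num)
  · exact ⟨uNum n, uNum_ne_zero hn, two_mul_uSeq_eq n⟩
  · have h := trSigma_mem_dyadic n
    simp only [famI,
      List.forall_mem_cons, List.not_mem_nil, IsEmpty.forall_iff, implies_true, and_true]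
    and_intros
    all_goals repeat' first
      | assumption | exact one_mem _ | exact ofNat_mem _ _ | exact X_mem_dyadic _
      | exact Y_mem_dyadic _ | apply div_two_pow_mem_dyadic | apply add_mem | apply sub_mem
      | apply mul_mem | apply neg_mem
      | apply pow_mem
  · simp only [famI,
      List.forall_mem_cons, List.not_mem_nil, IsEmpty.forall_iff, implies_true, and_true,
      LambertTerm.merit]
    norm_num
  · exact mul_ne_zero (neg_ne_zero.mpr (by positivity)) (trSigma_ne_zero hn)
  · norm_num [LambertTerm.merit]

theorem isFamily_famITilde : IsFamily {n | 1 ≤ n} (fun n => 2 * n + 1) 5 (36 / 5)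
    (uTildeSeq) famITilde := by
  refine isFamily_of_relSum (fun n => n) [3 / 5, 6 / 5, 2 / 3, 1, 3 / 2, 3, 6] (by norm_num)
    (fun _ hn => hn) (fun n => by ring) famITilde_isPoint
    (fun n hn => ⟨_, famITildePeriod_mem n, famITilde_relSum hn⟩) (fun n _ => two_mul_uTildeSeq n)
      (fun n hn => ?_)
    (fun n _ => ?_) (fun n _ => ?_) (fun n hn => ⟨_, List.mem_cons_self, ?_, ?_⟩) (by norm_num)
  · exact ⟨uTildeNum n, uTildeNum_ne_zero hn, two_mul_uTildeSeq_eq n⟩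
  · have h := trSigma_mem_dyadic n
    have hz := zI_mem_dyadic n
    simp only [famITilde,
      List.forall_mem_cons, List.not_mem_nil, IsEmpty.forall_iff, implies_true, and_true]
    and_intros
    all_goals repeat' first
      | assumption | exact one_mem _ | exact ofNat_mem _ _ | exact X_mem_dyadic _
      | exact Y_mem_dyadic _ | apply add_mem | apply sub_mem | apply mul_mem | apply neg_mem
      | apply pow_mem
  · simp only [famITilde,
      List.forall_mem_cons, List.not_mem_nil, IsEmpty.forall_iff, implies_true, and_true,
      LambertTerm.merit]
    norm_num
  · exact mul_ne_zero (pow_ne_zero _ (by norm_num)) (zI_ne_zero hn)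
  · norm_num [LambertTerm.merit]

theorem isFamily_famF : IsFamily {n | 1 ≤ n} (fun n => 2 * n + 1) 11 (44 / 9)
    (fun n => 45 / 2 * vSeq n) famF := by
  refine isFamily_of_relSum (fun n => n) [6 / 11, 1 / 3, 1 / 2, 2 / 3, 1, 3 / 2, 2, 3, 6]
    (by norm_num)
    (fun _ hn => hn) (fun n => by ring) famF_isPoint
    (fun n hn => ⟨_, famFPeriod_mem n, famF_relSum hn⟩) (fun n _ => two_mul_vSeq n) (fun n hn => ?_)
    -- The least merit 44/9 belongs to the second term of the list; the first has merit 144/11.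
    (fun n _ => ?_) (fun n _ => ?_) (fun n hn => ⟨_, List.mem_cons_of_mem _ List.mem_cons_self, ?_,
      ?_⟩) (by norm_num)
  · exact ⟨vNum n, vNum_ne_zero hn, by rw [← fortyFive_mul_vSeq]; ring⟩
  · have h := bEleven_mem_dyadic n
    simp only [famF, block, List.map_cons, List.map_nil,
      List.forall_mem_cons, List.not_mem_nil, IsEmpty.forall_iff, implies_true, and_true]
    and_intros
    all_goals repeat' first
      | assumption | exact one_mem _ | exact ofNat_mem _ _ | exact X_mem_dyadic _
      | exact Y_mem_dyadic _ | apply add_mem | apply sub_mem | apply mul_mem | apply neg_mem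
      | apply pow_mem
  · simp only [famF, block, List.map_cons, List.map_nil,
      List.forall_mem_cons, List.not_mem_nil, IsEmpty.forall_iff, implies_true, and_true,
      LambertTerm.merit]
    norm_num
  · exact mul_ne_zero one_ne_zero (mul_ne_zero (by positivity) (X_pos _).ne')
  · norm_num [LambertTerm.merit]

theorem isFamily_famFTilde : IsFamily {n | 1 ≤ n} (fun n => 2 * n + 1) 11 (400 / 99)
    (vTildeSeq) famFTilde := by
  refine isFamily_of_relSum (fun n => n) [10 / 33, 1 / 2, 1, 2, 5 / 11, 15 / 22, 10 / 11, 15 / 11,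
    30 / 11, 2 / 5, 3 / 5, 6 / 5,
    5 / 6, 5 / 3, 5 / 2, 10 / 3, 5, 15 / 2, 10, 15, 30] (by norm_num)
    (fun _ hn => hn) (fun n => by ring) famFTilde_isPoint
    (fun n hn => ⟨_, famFTildePeriod_mem n, famFTilde_relSum hn⟩) (fun n _ => two_mul_vTildeSeq n)
      (fun n hn => ?_)
    (fun n _ => ?_) (fun n _ => ?_) (fun n hn => ⟨_, List.mem_cons_self, ?_, ?_⟩) (by norm_num)
  · exact ⟨2 * vTildeNum n, mul_ne_zero two_ne_zero (vTildeNum_ne_zero hn), by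
      rw [vTildeSeq_eq]; push_cast; ring⟩
  · have hf := fEleven_mem_dyadic n
    have hg := gEleven_mem_dyadic n
    simp only [famFTilde, block, List.map_cons, List.map_nil, List.cons_append, List.nil_append,
      List.forall_mem_cons, List.not_mem_nil, IsEmpty.forall_iff, implies_true, and_true]
    and_intros
    all_goals repeat' first
      | assumption | exact one_mem _ | exact ofNat_mem _ _ | exact X_mem_dyadic _
      | exact Y_mem_dyadic _ | apply add_mem | apply sub_mem | apply mul_mem | apply neg_mem
      | apply pow_mem
  · simp only [famFTilde, block, List.map_cons, List.map_nil, List.cons_append, List.nil_append,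
      List.forall_mem_cons, List.not_mem_nil, IsEmpty.forall_iff, implies_true, and_true,
      LambertTerm.merit]
    norm_num
  · exact mul_ne_zero (mul_ne_zero (by norm_num) (pow_ne_zero _ (by norm_num)))
      (pow_ne_zero _ (by norm_num))
  · norm_num [LambertTerm.merit]

theorem isFamily_famW : IsFamily {n | 1 ≤ n} (fun n => 2 * n + 1) 35 (144 / 35)
    (fun n => 3 / 2 * wSeq n) famW := by
  refine isFamily_of_relSum (fun n => n) [6 / 35, 2 / 7, 1 / 5, 2 / 5, 1 / 3, 1 / 2, 2 / 3, 1,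
    3 / 2, 2, 3, 6] (by norm_num)
    (fun _ hn => hn) (fun n => by ring) famW_isPoint
    (fun n hn => ⟨_, famWPeriod_mem n, famW_relSum hn⟩) (fun n _ => two_mul_wSeq n) (fun n hn => ?_)
    (fun n _ => ?_) (fun n _ => ?_) (fun n hn => ⟨_, List.mem_cons_self, ?_, ?_⟩) (by norm_num)
  · exact ⟨wNum n, wNum_ne_zero hn, by rw [← three_mul_wSeq]; ring⟩
  · have h := trOmega_mem_dyadic n
    simp only [famW, block, List.map_cons, List.map_nil, List.cons_append, List.nil_append,
      List.forall_mem_cons, List.not_mem_nil, IsEmpty.forall_iff, implies_true, and_true]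
    and_intros
    all_goals repeat' first
      | assumption | exact one_mem _ | exact ofNat_mem _ _ | exact X_mem_dyadic _
      | exact Y_mem_dyadic _ | apply add_mem | apply sub_mem | apply mul_mem | apply neg_mem
      | apply pow_mem
  · simp only [famW, block, List.map_cons, List.map_nil, List.cons_append, List.nil_append,
      List.forall_mem_cons, List.not_mem_nil, IsEmpty.forall_iff, implies_true, and_true,
      LambertTerm.merit]
    norm_num
  · exact neg_ne_zero.mpr (pow_ne_zero _ (by norm_num))
  · norm_num [LambertTerm.merit]

theorem isFamily_famWTilde : IsFamily {n | 1 ≤ n} (fun n => 2 * n + 1) 35 (28 / 5)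
    (fun n => 2 * wTildeSeq n) famWTilde := by
  refine isFamily_of_relSum (fun n => n) [1 / 5, 1 / 2, 1, 2, 3 / 10, 2 / 5, 3 / 5, 6 / 5, 3 / 14,
    2 / 7, 3 / 7, 6 / 7] (by norm_num)
    (fun _ hn => hn) (fun n => by ring) famWTilde_isPoint
    (fun n hn => ⟨_, famWTildePeriod_mem n, famWTilde_relSum hn⟩) (fun n _ => two_mul_wTildeSeq n)
      (fun n hn => ?_)
    (fun n _ => ?_) (fun n _ => ?_) (fun n hn => ⟨_, List.mem_cons_self, ?_, ?_⟩) (by norm_num)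
  · exact ⟨wTildeNum n, wTildeNum_ne_zero hn, by rw [← four_mul_wTildeSeq]; ring⟩
  · have h := trOmega_mem_dyadic n
    simp only [famWTilde, block, List.map_cons, List.map_nil, List.cons_append, List.nil_append,
      List.forall_mem_cons, List.not_mem_nil, IsEmpty.forall_iff, implies_true, and_true]
    and_intros
    all_goals repeat' first
      | assumption | exact one_mem _ | exact ofNat_mem _ _ | exact X_mem_dyadic _
      | exact Y_mem_dyadic _ | apply add_mem | apply sub_mem | apply mul_mem | apply neg_mem
      | apply pow_mem
  · simp only [famWTilde, block, List.map_cons, List.map_nil, List.cons_append, List.nil_append,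
      List.forall_mem_cons, List.not_mem_nil, IsEmpty.forall_iff, implies_true, and_true,
      LambertTerm.merit]
    norm_num
  · exact mul_ne_zero (mul_ne_zero (neg_ne_zero.mpr (by positivity)) (X_pos _).ne') (Y_pos _).ne'
  · norm_num [LambertTerm.merit]

theorem isFamily_famSeven : IsFamily {n | 1 ≤ n} (fun n => 2 * n + 1) 7 (36 / 7)
    (sevenSeq) famSeven := by
  refine isFamily_of_relSum (fun n => n) [3 / 7, 6 / 7, 2 / 3, 1 / 2, 1, 3 / 2, 2, 3, 6]
    (by norm_num)
    (fun _ hn => hn) (fun n => by ring) famSeven_isPoint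
    (fun n hn => ⟨_, famSevenPeriod_mem n, famSeven_relSum hn⟩) (fun n _ => two_mul_sevenSeq n)
      (fun n hn => ?_)
    (fun n _ => ?_) (fun n _ => ?_) (fun n hn => ⟨_, List.mem_cons_self, ?_, ?_⟩) (by norm_num)
  · exact ⟨sevenNum n, sevenNum_ne_zero hn, two_mul_sevenSeq_eq n⟩
  · have hv := vSeven_mem_dyadic n
    have hz := zSeven_mem_dyadic n
    simp only [famSeven,
      List.forall_mem_cons, List.not_mem_nil, IsEmpty.forall_iff, implies_true, and_true]
    and_intros
    all_goals repeat' first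
      | assumption | exact one_mem _ | exact ofNat_mem _ _ | exact X_mem_dyadic _
      | exact Y_mem_dyadic _ | apply add_mem | apply sub_mem | apply mul_mem | apply neg_mem
      | apply pow_mem
  · simp only [famSeven,
      List.forall_mem_cons, List.not_mem_nil, IsEmpty.forall_iff, implies_true, and_true,
      LambertTerm.merit]
    norm_num
  · exact mul_ne_zero (pow_ne_zero _ (by norm_num)) (zSeven_ne_zero hn)
  · norm_num [LambertTerm.merit]

theorem isFamily_famX : IsFamily {n | 1 ≤ n} (fun n => 2 * n + 1) 23 (144 / 23)
    (xSeq) famX := by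
  refine isFamily_of_relSum (fun n => n) [6 / 23, 1 / 3, 1 / 2, 2 / 3, 1, 3 / 2, 2, 3, 6]
    (by norm_num)
    (fun _ hn => hn) (fun n => by ring) famX_isPoint
    (fun n hn => ⟨_, famXPeriod_mem n, famX_relSum hn⟩) (fun n _ => two_mul_xSeq n) (fun n hn => ?_)
    (fun n _ => ?_) (fun n _ => ?_) (fun n hn => ⟨_, List.mem_cons_self, ?_, ?_⟩) (by norm_num)
  · obtain ⟨z, hz⟩ := isIntegerSequence_xSeq.1 n
    refine ⟨2 * z, mul_ne_zero two_ne_zero fun h => xNum_ne_zero hn ?_, by rw [hz]; push_cast; ring⟩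
    have := eight_mul_xSeq n
    rw [hz, h] at this
    exact_mod_cast this.symm
  · have hk := kappaX_mem_dyadic n
    have hl := lambdaX_mem_dyadic n
    have hr := rhoX_mem_dyadic n
    have ht := thetaX_mem_dyadic n
    simp only [famX, block, List.map_cons, List.map_nil,
      List.forall_mem_cons, List.not_mem_nil, IsEmpty.forall_iff, implies_true, and_true]
    and_intros
    all_goals repeat' first
      | assumption | exact one_mem _ | exact ofNat_mem _ _ | exact X_mem_dyadic _
      | exact Y_mem_dyadic _ | apply add_mem | apply sub_mem | apply mul_mem | apply neg_mem
      | apply pow_mem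
  · simp only [famX, block, List.map_cons, List.map_nil,
      List.forall_mem_cons, List.not_mem_nil, IsEmpty.forall_iff, implies_true, and_true,
      LambertTerm.merit]
    norm_num
  · exact mul_ne_zero (pow_ne_zero _ (by norm_num)) (kappaX_ne_zero hn)
  · norm_num [LambertTerm.merit]

theorem isFamily_famC : IsFamily {n | 1 ≤ n} (fun n => 4 * n + 1) 1 (144 / 25)
    (fun n => 1 / 2 * cTildeSeq n) famC := by
  refine isFamily_of_relSum (fun n => 2 * n) [6 / 5, 2, 3, 5 / 3, 10 / 3, 5, 15 / 2, 15, 30] one_pos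
    (fun n (hn : 1 ≤ n) => by lia) (fun n => by ring) famC_isPoint
    (fun n hn => ⟨_, famCPeriod_mem n, famC_relSum hn⟩) (fun n _ => two_mul_cTildeSeq n)
      (fun n hn => ?_)
    (fun n _ => ?_) (fun n _ => ?_) (fun n hn => ⟨_, List.mem_cons_self, ?_, ?_⟩) (by norm_num)
  · exact ⟨cTildeNum n, cTildeNum_ne_zero hn, by rw [← cTildeSeq_eq]; ring⟩
  · have h := lambdaC_mem_dyadic n
    have ht := trThreeFourI_mem_dyadic n
    simp only [famC, block, List.map_cons, List.map_nil, List.cons_append, List.nil_append,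
      List.forall_mem_cons, List.not_mem_nil, IsEmpty.forall_iff, implies_true, and_true]
    and_intros
    all_goals repeat' first
      | assumption | exact one_mem _ | exact ofNat_mem _ _ | exact X_mem_dyadic _
      | exact Y_mem_dyadic _ | apply add_mem | apply sub_mem | apply mul_mem | apply neg_mem
      | apply pow_mem
  · simp only [famC, block, List.map_cons, List.map_nil, List.cons_append, List.nil_append,
      List.forall_mem_cons, List.not_mem_nil, IsEmpty.forall_iff, implies_true, and_true,
      LambertTerm.merit]
    norm_num
  · exact mul_ne_zero (by positivity) (lambdaC_ne_zero hn)
  · norm_num [LambertTerm.merit]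

theorem isFamily_famY : IsFamily {n | 1 ≤ n} (fun n => 6 * n + 1) 3 (25 / 3)
    (fun n => 42 * ySeq n) famY := by
  refine isFamily_of_relSum (fun n => 3 * n) [1, 5 / 6, 5 / 3, 5 / 2, 10 / 3, 5, 10] three_pos
    (fun n (hn : 1 ≤ n) => by lia) (fun n => by ring) famY_isPoint
    (fun n hn => ⟨_, famYPeriod_mem n, famY_relSum hn⟩) (fun n _ => two_mul_ySeq n) (fun n hn => ?_)
    -- The least merit 25/3 belongs to the second term; the first has merit 12.
    (fun n _ => ?_) (fun n _ => ?_) (fun n hn => ⟨_, List.mem_cons_of_mem _ List.mem_cons_self, ?_,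
      ?_⟩) (by norm_num)
  · exact ⟨yNum n, yNum_ne_zero hn, by rw [← eightyFour_mul_ySeq]; ring⟩
  · simp only [famY, block, List.map_cons, List.map_nil,
      List.forall_mem_cons, List.not_mem_nil, IsEmpty.forall_iff, implies_true, and_true]
    and_intros
    all_goals repeat' first
      | assumption | exact one_mem _ | exact ofNat_mem _ _ | exact X_mem_dyadic _
      | exact Y_mem_dyadic _ | apply div_sixtyFour_pow_mem_dyadic | apply add_mem | apply sub_mem
      | apply mul_mem | apply neg_mem
      | apply pow_mem
  · simp only [famY, block, List.map_cons, List.map_nil,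
      List.forall_mem_cons, List.not_mem_nil, IsEmpty.forall_iff, implies_true, and_true,
      LambertTerm.merit]
    norm_num
  · exact mul_ne_zero (div_pos (X_pos _) (by positivity)).ne'
      (mul_ne_zero (neg_ne_zero.mpr (pow_ne_zero _ (by norm_num))) (by positivity))
  · norm_num [LambertTerm.merit]

theorem isFamily_famZ : IsFamily {n | 1 ≤ n} (fun n => 6 * n + 1) 3 (49 / 3)
    (fun n => 10 * zSeq n) famZ := by
  refine isFamily_of_relSum (fun n => 3 * n) [7 / 6, 7 / 3, 14 / 3, 3 / 2, 3, 6, 7 / 2, 7, 14]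
    three_pos
    (fun n (hn : 1 ≤ n) => by lia) (fun n => by ring) famZ_isPoint
    (fun n hn => ⟨_, famZPeriod_mem n, famZ_relSum hn⟩) (fun n _ => two_mul_zSeq n) (fun n hn => ?_)
    (fun n _ => ?_) (fun n _ => ?_) (fun n hn => ⟨_, List.mem_cons_self, ?_, ?_⟩) (by norm_num)
  · exact ⟨zNum n, zNum_ne_zero hn, by rw [← twenty_mul_zSeq]; ring⟩
  · have hk := kappaZ_mem_dyadic n
    have hm := muZ_mem_dyadic n
    simp only [famZ, block, List.map_cons, List.map_nil, List.cons_append, List.nil_append,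
      List.forall_mem_cons, List.not_mem_nil, IsEmpty.forall_iff, implies_true, and_true]
    and_intros
    all_goals repeat' first
      | assumption | exact one_mem _ | exact ofNat_mem _ _ | exact X_mem_dyadic _
      | exact Y_mem_dyadic _ | apply div_sixtyFour_pow_mem_dyadic | apply add_mem | apply sub_mem
      | apply mul_mem | apply neg_mem
      | apply pow_mem
  · simp only [famZ, block, List.map_cons, List.map_nil, List.cons_append, List.nil_append,
      List.forall_mem_cons, List.not_mem_nil, IsEmpty.forall_iff, implies_true, and_true,
      LambertTerm.merit]
    norm_num
  · exact mul_ne_zero (mul_ne_zero (neg_ne_zero.mpr (pow_ne_zero _ (by norm_num)))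
      (kappaZ_ne_zero hn)) one_ne_zero
  · norm_num [LambertTerm.merit]

/-! ### The explicit evaluations -/

/-- Moves √D from the denominator, where the printed evaluations have it, to the numerator, where
the general theorem puts it. -/
lemma div_mul_sqrt_eq {D : ℝ} (hD : 0 < D) (a b : ℝ) : a / (b * √D) = a / (b * D) * √D := by
  have h := Real.sqrt_pos.mpr hD
  have h2 := Real.mul_self_sqrt hD.le
  rcases eq_or_ne b 0 with rfl | hb
  · simp
  · field_simp
    linear_combination -a * h2

lemma famHPeriod_one : famHPeriod 1 = (133 / 540 : ℚ) * sqrtNeg 3 := by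
  -- The explicit inverse of ρ - 1 turns the division in the period into a product in the field.
  have h : ((-1 + sqrtNeg 3) / 2 - 1)⁻¹ = (-3 - sqrtNeg 3) / 6 := by
    refine inv_eq_of_mul_eq_one_right ?_
    linear_combination (-1 / 12) * sqrtNeg_sq 3
  rw [famHPeriod, pow_one, pow_one, div_eq_mul_inv _ (_ - _), h,
    qper_one 0 (1 / 2) (3 / 4) (-3 / 4) 0 0 (17 / 864),
    qper_one (1 / 2) (1 / 2) 1 (-1 / 2) (1 / 2) (1 / 60) (1 / 60)]
  push_cast
  linear_combination ((1 / 45)) * sqrtNeg_sq 3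

lemma famHPeriod_two : famHPeriod 2 = (17 / 378 : ℚ) * sqrtNeg 3 := by
  have h : (((-1 + sqrtNeg 3) / 2) ^ 2 - 1)⁻¹ = (-3 + sqrtNeg 3) / 6 := by
    refine inv_eq_of_mul_eq_one_right ?_
    linear_combination (sqrtNeg 3 - 5) / 24 * sqrtNeg_sq 3
  rw [famHPeriod, div_eq_mul_inv _ (_ - _), h, qper_two 0 (1 / 2) (3 / 4) (-3 / 4) 0 (9 / 16) 0 0
    (79 / 181440),
    qper_two (1 / 2) (1 / 2) 1 (-1 / 2) (1 / 2) (-1 / 2) (-1 / 2) (-11 / 7560) (11 / 7560)]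
  push_cast
  linear_combination ((-22 / 2835)) * sqrtNeg_sq 3

theorem evaluates_three_disc_three : Evaluates 3 1 (133 * √3 / 5940 * Real.pi ^ 3)
        [⟨1/3, 4, -6/11⟩, ⟨3, 2, -18/11⟩, ⟨3, 4, 2/11⟩] := by
  have h := evaluates_of_relSum le_rfl three_pos (famH_isPoint 1) (famH_sum 1)
    (by rw [famH_relSum le_rfl (by norm_num), famHPeriod_one])
  refine h.scale (1 / 11) (by norm_num) (by push_cast; ring) ?_
  simp only [famH, List.map_cons, List.map_nil, X_eq]
  norm_num

theorem evaluates_five_disc_three : Evaluates 5 1 (17 * √3 / 8694 * Real.pi ^ 5)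
        [⟨1/3, 4, 18/23⟩, ⟨3, 2, -66/23⟩, ⟨3, 4, 2/23⟩] := by
  have h := evaluates_of_relSum one_le_two three_pos (famH_isPoint 2) (famH_sum 2)
    (by rw [famH_relSum one_le_two (by norm_num), famHPeriod_two])
  refine h.scale (1 / 23) (by norm_num) (by push_cast; ring) ?_
  simp only [famH, List.map_cons, List.map_nil, X_eq]
  norm_num

lemma famHSixPeriod_one : famHSixPeriod 1 = (10309 / 8100 : ℚ) * sqrtNeg 3 := by
  rw [famHSixPeriod, mul_one, qper_three 0 (1 / 2) (3 / 4) (-3 / 4) 0 (9 / 16) 0 (-27 / 64) 0 0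
    (143 / 1036800),
    qper_three (1 / 4) (1 / 4) (1 / 4) (-1 / 8) (1 / 8) (-1 / 32) (-1 / 32) (1 / 64) 0 (-1 / 46080)
      (13 / 138240),
    qper_three (-1 / 4) (1 / 4) (1 / 4) (-1 / 8) (-1 / 8) (-1 / 32) (1 / 32) (1 / 64) 0 (1 / 46080)
      (13 / 138240)]
  push_cast
  ring

lemma sSeq_one : sSeq 1 = 6601 := isIntegerSequence_sSeq.2 0 (by decide)

theorem evaluates_seven_disc_three : Evaluates 7 1 (10309 * √3 / 53468100 * Real.pi ^ 7)
        [⟨1/3, 4, -2322/6601⟩, ⟨3, 2, -10966/6601⟩, ⟨3, 4, 86/6601⟩] := by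
  have h := evaluates_of_relSum (show 1 ≤ 3 by norm_num) three_pos (famHSix_isPoint 1)
    (two_mul_sSeq 1)
    (by rw [famHSix_relSum le_rfl, famHSixPeriod_one])
  refine h.scale (1 / 6601) (by rw [sSeq_one]; norm_num) (by push_cast; ring) ?_
  simp only [famHSix, List.map_cons, List.map_nil, X_six_eq]
  norm_num

lemma tauTwo_two : tauTwo 2 = -7 := by
  have := two_mul_tauTwo 2
  norm_num [luc] at this
  linarith

lemma tSeq_two : tSeq 2 = 571 := isIntegerSequence_tSeq.2 1 (by decide)

theorem evaluates_five_disc_eight : Evaluates 5 1 (5171 * √2 / 2158380 * Real.pi ^ 5)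
        [⟨1/2, 3, 128/571⟩, ⟨2, 2, -812/571⟩, ⟨2, 4, -460/571⟩, ⟨2, 12, 2/571⟩] := by
  have h := evaluates_of_relSum one_le_two two_pos (famG_isPoint 2) (two_mul_tSeq 2)
    (by rw [famG_relSum one_le_two, famGPeriod_two])
  refine h.scale (1 / 571) (by rw [tSeq_two]; norm_num) (by push_cast; ring) ?_
  simp only [famG, List.map_cons, List.map_nil, tauTwo_two, X_eq, Y_eq]
  norm_num

lemma trSigma_one : trSigma 1 = -4 := by norm_num [trSigma_eq, luc]

lemma trSigma_two : trSigma 2 = -2 := by norm_num [trSigma_eq, luc]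

lemma uSeq_one : uSeq 1 = 20 := isIntegerSequence_uSeq.2 0 (by decide)

lemma uSeq_two : uSeq 2 = 113 := isIntegerSequence_uSeq.2 1 (by decide)

lemma uTildeSeq_one : uTildeSeq 1 = 790 := isIntegerSequence_uTildeSeq.2 0 (by decide)

lemma famIPeriod_one : famIPeriod 1 = (26 / 75 : ℚ) * sqrtNeg 5 := by
  rw [famIPeriod, qper_one 0 (1 / 3) (5 / 9) (-5 / 9) 0 0 (331 / 24300),
    qper_one (1 / 3) (1 / 3) (2 / 3) (-4 / 9) (2 / 9) (91 / 9720) (121 / 9720),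
    qper_one (-1 / 3) (1 / 3) (2 / 3) (-4 / 9) (-2 / 9) (-91 / 9720) (121 / 9720)]
  push_cast
  ring

lemma famIPeriod_two : famIPeriod 2 = (809 / 4725 : ℚ) * sqrtNeg 5 := by
  rw [famIPeriod, qper_two 0 (1 / 3) (5 / 9) (-5 / 9) 0 (25 / 81) 0 0 (617 / 1148175),
    qper_two (1 / 3) (1 / 3) (2 / 3) (-4 / 9) (2 / 9) (-4 / 81) (-16 / 81) (-71 / 91854)
      (181 / 229635),
    qper_two (-1 / 3) (1 / 3) (2 / 3) (-4 / 9) (-2 / 9) (-4 / 81) (16 / 81) (71 / 91854)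
      (181 / 229635)]
  push_cast
  ring

theorem evaluates_three_disc_twenty : Evaluates 3 1 (13 * √5 / 750 * Real.pi ^ 3)
        [⟨5, 1, 2/5⟩, ⟨1/5, 6, -1/4⟩, ⟨5, 2, -23/10⟩, ⟨5, 4, 1/10⟩, ⟨5, 6, 1/20⟩] := by
  have h := evaluates_of_relSum le_rfl (by norm_num) (famI_isPoint 1) (two_mul_uSeq 1)
    (by rw [famI_relSum le_rfl, famIPeriod_one])
  refine h.scale (1 / 20) (by rw [uSeq_one]; norm_num) (by push_cast; ring) ?_
  simp only [famI, List.map_cons, List.map_nil, trSigma_one, X_eq, Y_eq]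
  norm_num

theorem evaluates_five_disc_twenty : Evaluates 5 1 (809 * √5 / 533925 * Real.pi ^ 5)
        [⟨5, 1, 8/113⟩, ⟨1/5, 6, 25/113⟩, ⟨5, 2, -521/226⟩, ⟨5, 4, 1/226⟩, ⟨5, 6, 1/113⟩] := by
  have h := evaluates_of_relSum one_le_two (by norm_num) (famI_isPoint 2) (two_mul_uSeq 2)
    (by rw [famI_relSum one_le_two, famIPeriod_two])
  refine h.scale (1 / 113) (by rw [uSeq_two]; norm_num) (by push_cast; ring) ?_
  simp only [famI, List.map_cons, List.map_nil, trSigma_two, X_eq, Y_eq]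
  norm_num

lemma zI_one : zI 1 = 20 := by norm_num [zI, X, Y, trSigma_one]

lemma famITildePeriod_one : famITildePeriod 1 = (18491 / 1350 : ℚ) * sqrtNeg 5 := by
  rw [famITildePeriod, qper_one (1 / 6) (1 / 6) (1 / 6) (-1 / 9) (1 / 18) (-11 / 19440)
    (199 / 19440),
    qper_one (-1 / 6) (1 / 6) (1 / 6) (-1 / 9) (-1 / 18) (11 / 19440) (199 / 19440),
    qper_one 0 (1 / 6) (5 / 36) (-5 / 36) 0 0 (2221 / 194400),
    qper_one (1 / 3) (1 / 3) (2 / 3) (-4 / 9) (2 / 9) (91 / 9720) (121 / 9720),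
    qper_one (-1 / 3) (1 / 3) (2 / 3) (-4 / 9) (-2 / 9) (-91 / 9720) (121 / 9720),
    qper_one 0 (1 / 3) (5 / 9) (-5 / 9) 0 0 (331 / 24300)]
  push_cast
  ring

theorem evaluates_three_disc_twenty' : Evaluates 3 1 (18491 * √5 / 1066500 * Real.pi ^ 3)
        ([⟨1/5, 6, -10/79⟩, ⟨1/5, 12, -2/79⟩, ⟨5, 4/3, 18/395⟩]
          ++ block 5 1 (2/395) [(2, -384), (3, 4), (6, 5), (12, 1)]) := by
  have h := evaluates_of_relSum le_rfl (by norm_num) (famITilde_isPoint 1) (two_mul_uTildeSeq 1)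
    (by rw [famITilde_relSum le_rfl, famITildePeriod_one])
  refine h.scale (1 / 790) (by rw [uTildeSeq_one]; norm_num) (by push_cast; ring) ?_
  simp only [famITilde, block, List.map_cons, List.map_nil, List.cons_append, List.nil_append,
    trSigma_one, zI_one, Y_eq]
  norm_num

lemma bEleven_one : bEleven 1 = -5 := by norm_num [bEleven_eq, luc]

lemma cEleven_one : cEleven 1 = -1 := by norm_num [cEleven_eq, luc]

lemma gEleven_one : gEleven 1 = 23 := by norm_num [gEleven, bEleven_one]

lemma fEleven_one : fEleven 1 = -635 := by norm_num [fEleven, bEleven_one, cEleven_one]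

lemma vSeq_one : vSeq 1 = 1 := by simpa using isIntegerSequence_vSeq.2 0 (by decide)

lemma vTildeSeq_one : vTildeSeq 1 = 262 := isIntegerSequence_vTildeSeq.2 0 (by decide)

lemma famFPeriod_one : famFPeriod 1 = (623 / 2376 : ℚ) * sqrtNeg 11 := by
  rw [famFPeriod, qper_one (1 / 6) (1 / 6) (1 / 3) (-5 / 18) (1 / 18) (13 / 4860) (37 / 4860),
    qper_one (-1 / 6) (1 / 6) (1 / 3) (-5 / 18) (-1 / 18) (-13 / 4860) (37 / 4860),
    qper_one 0 (1 / 6) (11 / 36) (-11 / 36) 0 0 (3397 / 427680)]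
  push_cast
  ring

theorem evaluates_three_disc_eleven : Evaluates 3 1 (623 / (4860 * √11) * Real.pi ^ 3)
        (⟨1/11, 12, 22/45⟩ :: block 11 (1/3) (2/45)
          [(2, 81), (3, 132), (4, -9), (6, -297), (9, -4), (12, 33), (18, 9), (36, -1)]) := by
  have h := evaluates_of_relSum le_rfl (by norm_num) (famF_isPoint 1) (two_mul_vSeq 1)
    (by rw [famF_relSum le_rfl, famFPeriod_one])
  refine h.scale (2 / 45) (by rw [vSeq_one]; norm_num)
    (by rw [div_mul_sqrt_eq (by norm_num)]; push_cast; ring) ?_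
  simp only [famF, block, List.map_cons, List.map_nil, bEleven_one, X_eq, Y_eq]
  norm_num

lemma famFTildePeriod_one : famFTildePeriod 1 = (45643 / 14850 : ℚ) * sqrtNeg 11 := by
  rw [famFTildePeriod, gEleven_one, bEleven_one, qper_one 0 (3 / 10) (99 / 100) (-99 / 100) 0 0
    (69301 / 5940000),
    qper_one 0 (2 / 15) (44 / 225) (-44 / 225) 0 0 (102061 / 13365000),
    qper_one 0 (1 / 30) (11 / 900) (-11 / 900) 0 0 (859621 / 53460000),
    qper_one 0 (1 / 10) (11 / 100) (-11 / 100) 0 0 (5207 / 660000),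
    qper_one 0 (1 / 15) (11 / 225) (-11 / 225) 0 0 (63121 / 6682500),
    qper_one 0 (1 / 5) (11 / 25) (-11 / 25) 0 0 (707 / 82500),
    qper_one (3 / 10) (1 / 10) (1 / 5) (-1 / 50) (3 / 50) (1 / 2500) (41 / 7500),
    qper_one (-3 / 10) (1 / 10) (1 / 5) (-1 / 50) (-3 / 50) (-1 / 2500) (41 / 7500),
    qper_one (-5 / 6) (5 / 6) (25 / 3) (-125 / 18) (-25 / 18) (-3049 / 24300) (1201 / 24300),
    qper_one (5 / 6) (5 / 6) (25 / 3) (-125 / 18) (25 / 18) (3049 / 24300) (1201 / 24300),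
    qper_one (-1 / 6) (1 / 30) (1 / 25) (7 / 450) (-1 / 90) (2249 / 121500) (3367 / 607500),
    qper_one (1 / 6) (1 / 30) (1 / 25) (7 / 450) (1 / 90) (-2249 / 121500) (3367 / 607500)]
  push_cast
  linear_combination (0) * sqrtNeg_sq 11

theorem evaluates_three_disc_eleven' : Evaluates 3 131 (13 * 3511 / (2700 * √11) * Real.pi ^ 3)
        (⟨1/11, 20/3, -99⟩ ::
          (block 11 1 (-635) [(1, 4), (2, -9), (4, 1)]
          ++ block (1/11) 5 11 [(2, -3 ^ 2 * 23), (3, -4), (4, 23), (6, 9), (12, -1)]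
          ++ block 11 (1/5) 25 [(4, -23), (6, -9), (12, 1)]
          ++ block 11 (5/3) 1 [(1, 36), (2, -81), (3, -2 ^ 2 * 23), (4, 9), (6, 3 ^ 2 * 23),
              (9, 4), (12, -23), (18, -9), (36, 1)])) := by
  have h := evaluates_of_relSum le_rfl (by norm_num) (famFTilde_isPoint 1) (two_mul_vTildeSeq 1)
    (by rw [famFTilde_relSum le_rfl, famFTildePeriod_one])
  refine h.scale (1 / 2) (by rw [vTildeSeq_one]; norm_num)
    (by rw [div_mul_sqrt_eq (by norm_num)]; push_cast; ring) ?_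
  simp only [famFTilde, block, List.map_cons, List.map_nil, List.cons_append, List.nil_append,
    fEleven_one, gEleven_one, X_eq]
  norm_num

lemma trOmega_one : trOmega 1 = 1 := by norm_num [trOmega_eq, luc]

lemma wSeq_one : wSeq 1 = 16 := isIntegerSequence_wSeq.2 0 (by decide)

lemma wTildeSeq_one : wTildeSeq 1 = 332 := isIntegerSequence_wTildeSeq.2 0 (by decide)

lemma famWPeriod_one : famWPeriod 1 = (2969 / 18900 : ℚ) * sqrtNeg 35 := by
  rw [famWPeriod, qper_one 0 (1 / 6) (35 / 36) (-35 / 36) 0 0 (8821 / 1360800),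
    qper_one 0 (1 / 10) (7 / 20) (-7 / 20) 0 0 (383 / 84000),
    qper_one (1 / 2) (1 / 10) (3 / 5) (-1 / 10) (1 / 10) (31 / 2700) (47 / 13500),
    qper_one (-1 / 2) (1 / 10) (3 / 5) (-1 / 10) (-1 / 10) (-31 / 2700) (47 / 13500)]
  push_cast
  linear_combination 0 * sqrtNeg_sq 35

theorem evaluates_three_disc_thirty_five : Evaluates 3 1 (2969 / (12960 * √35) * Real.pi ^ 3)
        ([⟨1/35, 12, 35/24⟩, ⟨5/7, 4, -7/24⟩, ⟨7/5, 2, -15/8⟩, ⟨7/5, 4, 5/24⟩]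
          ++ block 35 (1/3) (1/24)
            [(2, 81), (3, 112), (4, -9), (6, -252), (9, -4), (12, 28), (18, 9), (36, -1)]) := by
  have h := evaluates_of_relSum le_rfl (by norm_num) (famW_isPoint 1) (two_mul_wSeq 1)
    (by rw [famW_relSum le_rfl, famWPeriod_one])
  refine h.scale (1 / 24) (by rw [wSeq_one]; norm_num)
    (by rw [div_mul_sqrt_eq (by norm_num)]; push_cast; ring) ?_
  simp only [famW, block, List.map_cons, List.map_nil, List.cons_append, List.nil_append,
    trOmega_one, X_eq, Y_eq]
  norm_num

lemma famWTildePeriod_one : famWTildePeriod 1 = (4573 / 1050 : ℚ) * sqrtNeg 35 := by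
  rw [famWTildePeriod, qper_one (1 / 6) (1 / 30) (1 / 15) (-1 / 90) (1 / 90) (-223 / 24300)
    (449 / 121500),
    qper_one (-1 / 6) (1 / 30) (1 / 15) (-1 / 90) (-1 / 90) (223 / 24300) (449 / 121500),
    qper_one 0 (1 / 30) (7 / 180) (-7 / 180) 0 0 (38749 / 6804000),
    qper_one 0 (2 / 15) (28 / 45) (-28 / 45) 0 0 (9109 / 1701000),
    qper_one 0 (1 / 10) (7 / 20) (-7 / 20) 0 0 (383 / 84000),
    qper_one 0 (1 / 15) (7 / 45) (-7 / 45) 0 0 (3649 / 850500)]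
  push_cast
  ring

theorem evaluates_three_disc_thirty_five' : Evaluates 3 1 (4573 / (19920 * √35) * Real.pi ^ 3)
        (⟨7/5, 2, -315/166⟩ ::
          (block 35 1 (1/664) [(1, 4), (2, -9), (4, 1)]
          ++ block (7/5) 1 (5/664) [(3, -4), (4, 28), (6, 9), (12, -1)]
          ++ block (5/7) 1 (-7/664) [(3, -4), (4, 28), (6, 9), (12, -1)])) := by
  have h := evaluates_of_relSum le_rfl (by norm_num) (famWTilde_isPoint 1) (two_mul_wTildeSeq 1)
    (by rw [famWTilde_relSum le_rfl, famWTildePeriod_one])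
  refine h.scale (1 / 664) (by rw [wTildeSeq_one]; norm_num)
    (by rw [div_mul_sqrt_eq (by norm_num)]; push_cast; ring) ?_
  simp only [famWTilde, block, List.map_cons, List.map_nil, List.cons_append, List.nil_append,
    trOmega_one, X_eq, Y_eq]
  norm_num

lemma kappaX_one : kappaX 1 = 1 := by norm_num [kappaX, X, imPart_alpha, imPart_beta, lucU]

lemma lambdaX_one : lambdaX 1 = -8 := by norm_num [lambdaX, X, kappaX_one, imPart_alpha, lucU]

lemma rhoX_one : rhoX 1 = -15 := by
  norm_num [rhoX, X, Y, kappaX_one, imPart_alpha_mul_beta, imPart_alpha_sq, lucU]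

lemma thetaX_one : thetaX 1 = 114 := by
  norm_num [thetaX, X, Y, imPart_alpha, imPart_beta, imPart_alpha_mul_beta, imPart_alpha_sq, lucU]

lemma xSeq_one : xSeq 1 = 25 := isIntegerSequence_xSeq.2 0 (by decide)

lemma famXPeriod_one : famXPeriod 1 = (93 / 460 : ℚ) * sqrtNeg 23 := by
  have h0 := sqrtNeg_ne_zero (D := 23) (by norm_num)
  have h1 : (((-11 + sqrtNeg 23) / 2) ^ 1 - ((-11 - sqrtNeg 23) / 2) ^ 1) * (sqrtNeg 23)⁻¹ = 1 := by
    field_simp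
    ring
  have h2 : (((1 - 5 * sqrtNeg 23) / 2) ^ 1 - ((1 + 5 * sqrtNeg 23) / 2) ^ 1) * (sqrtNeg 23)⁻¹ =
      -5 := by
    field_simp
    ring
  rw [famXPeriod, h1, h2, kappaX_one, qper_one 0 (1 / 6) (23 / 36) (-23 / 36) 0 0 (1193 / 178848),
    qper_one (1 / 12) (1 / 12) (1 / 6) (-11 / 72) (1 / 72) (-19 / 77760) (401 / 77760),
    qper_one (-1 / 12) (1 / 12) (1 / 6) (-11 / 72) (-1 / 72) (19 / 77760) (401 / 77760),
    qper_one (7 / 12) (1 / 12) (1 / 2) (13 / 72) (7 / 72) (791 / 77760) (221 / 77760),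
    qper_one (-7 / 12) (1 / 12) (1 / 2) (13 / 72) (-7 / 72) (-791 / 77760) (221 / 77760),
    qper_one (-1 / 6) (1 / 6) (2 / 3) (-11 / 18) (-1 / 18) (-97 / 19440) (127 / 19440),
    qper_one (1 / 6) (1 / 6) (2 / 3) (-11 / 18) (1 / 18) (97 / 19440) (127 / 19440)]
  push_cast
  linear_combination 0 * sqrtNeg_sq 23

theorem evaluates_three_disc_twenty_three : Evaluates 3 1 (93 / (500 * √23) * Real.pi ^ 3)
        (⟨1/23, 12, -23/25⟩ :: block 23 (1/3) (1/25)
          [(2, -72), (3, -60), (4, 9), (6, 114), (9, 4), (12, -15), (18, -8), (36, 1)]) := by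
  have h := evaluates_of_relSum le_rfl (by norm_num) (famX_isPoint 1) (two_mul_xSeq 1)
    (by rw [famX_relSum le_rfl, famXPeriod_one])
  refine h.scale (1 / 25) (by rw [xSeq_one]; norm_num)
    (by rw [div_mul_sqrt_eq (by norm_num)]; push_cast; ring) ?_
  simp only [famX, block, List.map_cons, List.map_nil, kappaX_one, lambdaX_one, rhoX_one,
    thetaX_one]
  norm_num

lemma lambdaC_one : lambdaC 1 = 37 := by norm_num [lambdaC, X]

lemma cTildeSeq_one : cTildeSeq 1 = 2639795 := isIntegerSequence_cTildeSeq.2 0 (by decide)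

lemma famCPeriod_one : famCPeriod 1 = (12075457 / 2700 : ℚ) * sqrtNeg 1 := by
  have h : (3 + 4 * sqrtNeg 1) ^ 2 + (3 - 4 * sqrtNeg 1) ^ 2 = -14 := by
    linear_combination 32 * sqrtNeg_sq 1
  rw [famCPeriod, mul_one, h, lambdaC_one, qper_two 0 (5 / 6) (25 / 36) (-25 / 36) 0 (625 / 1296) 0
    0 (9383 / 10497600),
    qper_two 0 (3 / 5) (9 / 25) (-9 / 25) 0 (81 / 625) 0 0 (1964 / 1265625),
    qper_two (-3 / 5) (3 / 5) (18 / 25) 0 (-18 / 25) (-324 / 625) 0 (-44 / 1265625)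
      (44591 / 17718750),
    qper_two (3 / 5) (3 / 5) (18 / 25) 0 (18 / 25) (-324 / 625) 0 (44 / 1265625) (44591 / 17718750),
    qper_two (1 / 5) (3 / 5) (2 / 5) (-8 / 25) (6 / 25) (28 / 625) (-96 / 625) (-983 / 2953125)
      (3229 / 1968750),
    qper_two (-1 / 5) (3 / 5) (2 / 5) (-8 / 25) (-6 / 25) (28 / 625) (96 / 625) (983 / 2953125)
      (3229 / 1968750),
    qper_two 0 (1 / 5) (1 / 25) (-1 / 25) 0 (1 / 625) 0 0 (422 / 140625),
    qper_two (1 / 5) (1 / 5) (2 / 25) 0 (2 / 25) (-4 / 625) 0 (-46 / 46875) (377 / 218750),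
    qper_two (-1 / 5) (1 / 5) (2 / 25) 0 (-2 / 25) (-4 / 625) 0 (46 / 46875) (377 / 218750),
    qper_two (2 / 5) (1 / 5) (1 / 5) (3 / 25) (4 / 25) (-7 / 625) (24 / 625) (-277 / 984375)
      (1039 / 984375),
    qper_two (-2 / 5) (1 / 5) (1 / 5) (3 / 25) (-4 / 25) (-7 / 625) (-24 / 625) (277 / 984375)
      (1039 / 984375),
    qper_two 0 (1 / 3) (1 / 9) (-1 / 9) 0 (1 / 81) 0 0 (14 / 6561),
    qper_two (1 / 3) (1 / 3) (2 / 9) 0 (2 / 9) (-4 / 81) 0 (-2 / 6561) (143 / 91854),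
    qper_two (-1 / 3) (1 / 3) (2 / 9) 0 (-2 / 9) (-4 / 81) 0 (2 / 6561) (143 / 91854),
    qper_two 0 (1 / 2) (1 / 4) (-1 / 4) 0 (1 / 16) 0 0 (1 / 576),
    qper_two (1 / 2) (1 / 2) (1 / 2) 0 (1 / 2) (-1 / 4) 0 0 (1 / 504)]
  push_cast
  ring

theorem evaluates_five_disc_four : Evaluates 5 (2639795 / 74) (12075457 / 99900 * Real.pi ^ 5)
        ([⟨1, 12/5, 5 ^ 4⟩, ⟨1, 4, -3050976/37⟩, ⟨1, 6, 2 ^ 5 * 389⟩]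
          ++ block 1 (5/3) 1
            [(2, -3 ^ 4 * 37), (4, 3 ^ 4), (6, 2 ^ 4 * 61), (9, 2 ^ 4), (18, -37), (36, 1)]) := by
  have h := evaluates_of_relSum (show 1 ≤ 2 * 1 by norm_num) one_pos (famC_isPoint 1)
    (two_mul_cTildeSeq 1)
    (by rw [famC_relSum le_rfl, famCPeriod_one])
  refine h.scale (1 / 37) (by rw [cTildeSeq_one]; norm_num) (by push_cast; ring) ?_
  simp only [famC, block, List.map_cons, List.map_nil, List.cons_append, List.nil_append,
    trThreeFourI_eq, lambdaC_one, luc, X, Y]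
  norm_num

lemma ySeq_one : ySeq 1 = 970 := isIntegerSequence_ySeq.2 0 (by decide)

lemma zSeq_one : zSeq 1 = 44071 := isIntegerSequence_zSeq.2 0 (by decide)

lemma famYPeriod_one : famYPeriod 1 = (21203 / 2700 : ℚ) * sqrtNeg 3 := by
  have h : ((11 + 5 * sqrtNeg 3) / 2) ^ 3 = (-143) + (180) * sqrtNeg 3 := by
    linear_combination ((825 / 8) + (125 / 8) * sqrtNeg 3) * sqrtNeg_sq 3
  rw [famYPeriod, mul_one, h, qper_three (1 / 10) (1 / 10) (1 / 25) (-1 / 50) (1 / 50) (-1 / 1250)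
    (-1 / 1250) (1 / 15625) 0 (-2032 / 17578125) (7904 / 52734375),
    qper_three (-1 / 10) (1 / 10) (1 / 25) (-1 / 50) (-1 / 50) (-1 / 1250) (1 / 1250) (1 / 15625) 0
      (2032 / 17578125) (7904 / 52734375),
    qper_three (3 / 10) (1 / 10) (3 / 25) (3 / 50) (3 / 50) (-9 / 1250) (9 / 1250) (-27 / 15625) 0
      (-1408 / 17578125) (10276 / 158203125),
    qper_three (-3 / 10) (1 / 10) (3 / 25) (3 / 50) (-3 / 50) (-9 / 1250) (-9 / 1250) (-27 / 15625)
      0 (1408 / 17578125) (10276 / 158203125),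
    qper_three (1 / 2) (1 / 10) (7 / 25) (11 / 50) (1 / 10) (23 / 1250) (11 / 250) (-143 / 15625)
      (36 / 3125) (568 / 172265625) (42524 / 861328125),
    qper_three (3 / 14) (5 / 14) (3 / 7) (-33 / 98) (15 / 98) (207 / 4802) (-495 / 4802)
      (3861 / 117649) (4860 / 117649) (6824 / 1297080225) (219496 / 2334744405),
    qper_three (1 / 4) (1 / 4) (1 / 4) (-1 / 8) (1 / 8) (-1 / 32) (-1 / 32) (1 / 64) 0 (-1 / 46080)
      (13 / 138240),
    qper_three (-1 / 4) (1 / 4) (1 / 4) (-1 / 8) (-1 / 8) (-1 / 32) (1 / 32) (1 / 64) 0 (1 / 46080)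
      (13 / 138240)]
  push_cast
  linear_combination ((37753312 / 51883209)) * sqrtNeg_sq 3

theorem evaluates_seven_disc_three' : Evaluates 7 970 (3029 * √3 / 16200 * Real.pi ^ 7)
        (⟨3, 2, -(29 * 449) / 7⟩ :: block (1/3) 5 (43 / (2 ^ 7 * 7))
          [(1, 12 ^ 3), (2, -3 ^ 3 * 129), (3, -64), (4, 27), (6, 129), (12, -1)]) := by
  have h := evaluates_of_relSum (show 1 ≤ 3 by norm_num) three_pos (famY_isPoint 1) (two_mul_ySeq 1)
    (by rw [famY_relSum le_rfl, famYPeriod_one])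
  refine h.scale (1 / 42) (by rw [ySeq_one]; norm_num) (by push_cast; ring) ?_
  simp only [famY, block, List.map_cons, List.map_nil, X_six_eq]
  norm_num

lemma kappaZ_one : kappaZ 1 = 2215 := by norm_num [kappaZ]

lemma muZ_one : muZ 1 = 823830 := by
  rw [muZ, two_re_two_add_pow]
  norm_num [luc]

lemma famZPeriod_one : famZPeriod 1 = (11468 / 135 : ℚ) * sqrtNeg 3 := by
  have h : ((23 + 7 * sqrtNeg 3) / 2) ^ 3 = (253) + (1260) * sqrtNeg 3 := by
    linear_combination ((3381 / 8) + (343 / 8) * sqrtNeg 3) * sqrtNeg_sq 3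
  rw [famZPeriod, mul_one, h, kappaZ_one, muZ_one, qper_three (1 / 14) (1 / 14) (1 / 49) (-1 / 98)
    (1 / 98) (-1 / 4802) (-1 / 4802) (1 / 117649) 0 (-44864 / 259416045) (30784 / 155649627),
    qper_three (-1 / 14) (1 / 14) (1 / 49) (-1 / 98) (-1 / 98) (-1 / 4802) (1 / 4802) (1 / 117649)
      0 (44864 / 259416045) (30784 / 155649627),
    qper_three (3 / 14) (1 / 14) (3 / 49) (3 / 98) (3 / 98) (-9 / 4802) (9 / 4802) (-27 / 117649) 0
      (-38272 / 259416045) (880828 / 11673722025),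
    qper_three (-3 / 14) (1 / 14) (3 / 49) (3 / 98) (-3 / 98) (-9 / 4802) (-9 / 4802)
      (-27 / 117649) 0 (38272 / 259416045) (880828 / 11673722025),
    qper_three (5 / 14) (1 / 14) (1 / 7) (11 / 98) (5 / 98) (23 / 4802) (55 / 4802) (-143 / 117649)
      (180 / 117649) (-1896 / 28824005) (167516 / 3891240675),
    qper_three (-5 / 14) (1 / 14) (1 / 7) (11 / 98) (-5 / 98) (23 / 4802) (-55 / 4802)
      (-143 / 117649) (-180 / 117649) (1896 / 28824005) (167516 / 3891240675),
    qper_three (1 / 2) (1 / 14) (13 / 49) (23 / 98) (1 / 14) (191 / 4802) (23 / 686) (253 / 117649)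
      (180 / 16807) (232 / 68824665) (615256 / 16862042925),
    qper_three (3 / 26) (7 / 26) (3 / 13) (-69 / 338) (21 / 338) (1719 / 57122) (-1449 / 57122)
      (-6831 / 4826809) (34020 / 4826809) (-30136 / 2823683265) (2648084 / 25413149385),
    qper_three (1 / 6) (1 / 6) (1 / 9) (-1 / 18) (1 / 18) (-1 / 162) (-1 / 162) (1 / 729) 0
      (-16 / 295245) (32 / 295245),
    qper_three (-1 / 6) (1 / 6) (1 / 9) (-1 / 18) (-1 / 18) (-1 / 162) (1 / 162) (1 / 729) 0
      (16 / 295245) (32 / 295245),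
    qper_three (1 / 2) (1 / 6) (1 / 3) (1 / 6) (1 / 6) (-1 / 18) (1 / 18) (-1 / 27) 0 0 (4 / 54675)]
  push_cast
  linear_combination ((164234169680 / 1694209959)) * sqrtNeg_sq 3

theorem evaluates_seven_disc_three'' : Evaluates 7 44071 (5734 * √3 / 675 * Real.pi ^ 7)
        (block (1/3) 1 (1 / 2 ^ 7)
          [(7, 443 * 12 ^ 3), (9, 10545024), (14, -1542969), (18, -21254814), (21, -28352),
           (28, 11961), (36, 164766), (42, 57147), (84, -443)]) := by
  have h := evaluates_of_relSum (show 1 ≤ 3 by norm_num) three_pos (famZ_isPoint 1) (two_mul_zSeq 1)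
    (by rw [famZ_relSum le_rfl, famZPeriod_one])
  replace h := h.scale (1 / 10) (v' := 44071) (p' := 5734 * √3 / 675 * Real.pi ^ 7)
    (by rw [zSeq_one]; norm_num) (by push_cast; ring) rfl
  rw [Evaluates] at h ⊢
  -- The printed list orders its terms by exponent, unlike the three blocks of the family, so the
  -- two sums are compared rather than the lists.
  refine h.trans (congrArg _ (congrArg _ ?_))
  simp only [famZ, lambertSum, LambertTerm.arg, block, List.map_cons, List.map_nil,
    List.cons_append,
    List.nil_append, List.sum_cons, List.sum_nil, X_six_eq, kappaZ_one, muZ_one]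
  norm_num
  ring

lemma vSeven_one : vSeven 1 = 6 := by norm_num [vSeven_eq, luc]

lemma zSeven_one : zSeven 1 = 50 := by norm_num [zSeven, X, vSeven_one]

lemma famSevenPeriod_one : famSevenPeriod 1 = (11429 / 1260 : ℚ) * sqrtNeg 7 := by
  rw [famSevenPeriod, zSeven_one, vSeven_one, qper_one 0 (1 / 3) (7 / 9) (-7 / 9) 0 0 (89 / 6804),
    qper_one 0 (1 / 6) (7 / 36) (-7 / 36) 0 0 (521 / 54432),
    qper_one (1 / 12) (1 / 12) (1 / 18) (-1 / 24) (1 / 72) (-463 / 77760) (829 / 77760),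
    qper_one (-1 / 12) (1 / 12) (1 / 18) (-1 / 24) (-1 / 72) (463 / 77760) (829 / 77760),
    qper_one (5 / 12) (1 / 12) (2 / 9) (1 / 8) (5 / 72) (17 / 15552) (65 / 15552),
    qper_one (-5 / 12) (1 / 12) (2 / 9) (1 / 8) (-5 / 72) (-17 / 15552) (65 / 15552),
    qper_one (1 / 2) (1 / 6) (4 / 9) (1 / 18) (1 / 6) (37 / 4320) (241 / 38880),
    qper_one (-1 / 2) (1 / 6) (4 / 9) (1 / 18) (-1 / 6) (-37 / 4320) (241 / 38880)]
  push_cast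
  linear_combination 0 * sqrtNeg_sq 7

/-- For N = 1 there is an additional relation between √-7/2, √-7 and 2√-7. T_2 at w = (1+√-7)/2
gives √-7 and (±1+√-7)/4, which invert to w with factors of sum -3. Hence φ(√-7) = 12 φ(w) up to
periods, and w can be removed from T_2 at √-7. -/
lemma ph_one_disc_seven : ph 1 7 0 2 + 4 * ph 1 7 0 (1 / 2) - 26 / 3 * ph 1 7 0 1 =
    ipi 1 * (29 / 1080 * sqrtNeg 7) := by
  have hD : 0 < 7 := by norm_num
  have t2 := ph_hecke_two le_rfl hD 0 1 0 2 0 (1 / 2) (1 / 2)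
  have t2' := ph_hecke_two le_rfl hD (1 / 2) (1 / 2) 0 1 (1 / 4) (-1 / 4) (1 / 4)
  have s1 := ph_step le_rfl hD (1 / 4) (1 / 4) (1 / 2) (1 / 2) 4 ((-3 + sqrtNeg 7) / 2)
    (by push_cast; ring)
  have s2 := ph_step le_rfl hD (-1 / 4) (1 / 4) (1 / 2) (1 / 2) 4 ((-3 - sqrtNeg 7) / 2)
    (by push_cast; ring)
  rw [qper_one (1 / 4) (1 / 4) (1 / 2) (-3 / 8) (1 / 8) (17 / 2880) (29 / 2880)] at s1
  rw [qper_one (-1 / 4) (1 / 4) (1 / 2) (-3 / 8) (-1 / 8) (-17 / 2880) (29 / 2880)] at s2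
  push_cast at s1 s2
  linear_combination t2 + (t2' + s1 + s2) / 3

theorem evaluates_three_disc_seven : Evaluates 3 73 (15 / (2 * √7) * Real.pi ^ 3)
        ([⟨1/7, 6, -175⟩, ⟨1/7, 12, 21⟩, ⟨7, 4/3, -27⟩]
          ++ block 7 1 1 [(1, -12), (2, 40), (3, -12), (4, -3), (6, 25), (12, -3)]) := by
  have e : 15 / (2 * √7) * Real.pi ^ 3 = (15 / 14 : ℚ) * √(7 : ℕ) * Real.pi ^ (2 * 1 + 1) := by
    rw [div_mul_sqrt_eq (by norm_num)]
    push_cast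
    ring
  rw [e]
  refine evaluates_of_relSum (N := 1) (L := [3 / 7, 6 / 7, 2 / 3, 1 / 2, 1, 3 / 2, 2, 3, 6])
    le_rfl (by norm_num) ?_ ?_ ?_
  · simp only [block, List.map_cons, List.map_nil, List.cons_append, List.nil_append,
      List.forall₂_cons, isPoint_iff, List.Forall₂.nil, and_true]
    norm_num
  · norm_num [block]
  · have h := famSeven_relSum le_rfl
    rw [famSevenPeriod_one] at h
    simp only [relSum, famSeven, block, List.map_cons, List.map_nil, List.cons_append,
      List.nil_append, List.zipWith_cons_cons, List.zipWith_nil_left, List.sum_cons, List.sum_nil,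
      vSeven_one, zSeven_one, X_eq, Y_eq] at h ⊢
    push_cast at h ⊢
    -- Half of the family member has coefficient 504 at √-7/2; subtracting 129 times the additional
    -- relation, whose coefficient there is 4, leaves -12.
    linear_combination h / 2 - 129 * ph_one_disc_seven

/-! ### The denominators of the first family -/

lemma two_pow_sub_neg_three_pow_pos (n : ℕ) : 0 < (2 : ℤ) ^ (2 * n + 1) - (-3) ^ n := by
  have h1 : (-3 : ℤ) ^ n ≤ 3 ^ n := by
    have := le_abs_self ((-3 : ℤ) ^ n)
    rwa [abs_pow, abs_neg, abs_of_pos (by norm_num : (0 : ℤ) < 3)] at this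
  have h2 : (3 : ℤ) ^ n ≤ 4 ^ n := pow_le_pow_left₀ (by norm_num) (by norm_num) n
  have h3 : (0 : ℤ) < 4 ^ n := by positivity
  rw [pow_succ, pow_mul]
  norm_num
  linarith

/-- The denominator is odd and positive, so the fraction with numerator 2 is already reduced. -/
lemma den_two_div (n : ℕ) : (((2 : ℚ) / (2 ^ (2 * n + 1) - (-3) ^ n)).den : ℤ) =
    2 ^ (2 * n + 1) - (-3) ^ n := by
  have h := two_pow_sub_neg_three_pow_odd n
  have hc : Nat.Coprime (2 : ℤ).natAbs ((2 : ℤ) ^ (2 * n + 1) - (-3) ^ n).natAbs :=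
    (Nat.coprime_two_left.mpr (Int.natAbs_odd.mpr h))
  have := Rat.den_div_eq_of_coprime (two_pow_sub_neg_three_pow_pos n) hc
  push_cast at this
  exact this

lemma sSeq_zero : sSeq 0 = 0 := by norm_num [sSeq]

lemma cTildeSeq_zero : cTildeSeq 0 = 0 := by norm_num [cTildeSeq]

end ZetaLambert

end

theorem mainTheorem7 :
    -- explicit evaluations
    -- discriminant -3, merit 16/3
    (Evaluates 3 1 (133 * √3 / 5940 * Real.pi ^ 3)
        [⟨1/3, 4, -6/11⟩, ⟨3, 2, -18/11⟩, ⟨3, 4, 2/11⟩]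
    ∧ Evaluates 5 1 (17 * √3 / 8694 * Real.pi ^ 5)
        [⟨1/3, 4, 18/23⟩, ⟨3, 2, -66/23⟩, ⟨3, 4, 2/23⟩]
    ∧ Evaluates 7 1 (10309 * √3 / 53468100 * Real.pi ^ 7)
        [⟨1/3, 4, -2322/6601⟩, ⟨3, 2, -10966/6601⟩, ⟨3, 4, 86/6601⟩]
    -- discriminant -8, merit 9/2
    ∧ Evaluates 3 1 (181 * √2 / 6600 * Real.pi ^ 3)
        [⟨1/2, 3, -16/55⟩, ⟨2, 2, -4/5⟩, ⟨2, 4, -52/55⟩, ⟨2, 12, 2/55⟩]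
    ∧ Evaluates 5 1 (5171 * √2 / 2158380 * Real.pi ^ 5)
        [⟨1/2, 3, 128/571⟩, ⟨2, 2, -812/571⟩, ⟨2, 4, -460/571⟩, ⟨2, 12, 2/571⟩]
    -- discriminant -20, merits 5 and 36/5
    ∧ Evaluates 3 1 (13 * √5 / 750 * Real.pi ^ 3)
        [⟨5, 1, 2/5⟩, ⟨1/5, 6, -1/4⟩, ⟨5, 2, -23/10⟩, ⟨5, 4, 1/10⟩, ⟨5, 6, 1/20⟩]
    ∧ Evaluates 5 1 (809 * √5 / 533925 * Real.pi ^ 5)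
        [⟨5, 1, 8/113⟩, ⟨1/5, 6, 25/113⟩, ⟨5, 2, -521/226⟩, ⟨5, 4, 1/226⟩, ⟨5, 6, 1/113⟩]
    ∧ Evaluates 3 1 (18491 * √5 / 1066500 * Real.pi ^ 3)
        ([⟨1/5, 6, -10/79⟩, ⟨1/5, 12, -2/79⟩, ⟨5, 4/3, 18/395⟩]
          ++ block 5 1 (2/395) [(2, -384), (3, 4), (6, 5), (12, 1)])
    -- discriminant -11, merits 44/9 and 400/99
    ∧ Evaluates 3 1 (623 / (4860 * √11) * Real.pi ^ 3)
        (⟨1/11, 12, 22/45⟩ :: block 11 (1/3) (2/45)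
          [(2, 81), (3, 132), (4, -9), (6, -297), (9, -4), (12, 33), (18, 9), (36, -1)])
    ∧ Evaluates 3 131 (13 * 3511 / (2700 * √11) * Real.pi ^ 3)
        (⟨1/11, 20/3, -99⟩ ::
          (block 11 1 (-635) [(1, 4), (2, -9), (4, 1)]
          ++ block (1/11) 5 11 [(2, -3 ^ 2 * 23), (3, -4), (4, 23), (6, 9), (12, -1)]
          ++ block 11 (1/5) 25 [(4, -23), (6, -9), (12, 1)]
          ++ block 11 (5/3) 1 [(1, 36), (2, -81), (3, -2 ^ 2 * 23), (4, 9), (6, 3 ^ 2 * 23),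
              (9, 4), (12, -23), (18, -9), (36, 1)]))
    -- discriminant -35, merits 144/35 and 28/5
    ∧ Evaluates 3 1 (2969 / (12960 * √35) * Real.pi ^ 3)
        ([⟨1/35, 12, 35/24⟩, ⟨5/7, 4, -7/24⟩, ⟨7/5, 2, -15/8⟩, ⟨7/5, 4, 5/24⟩]
          ++ block 35 (1/3) (1/24)
            [(2, 81), (3, 112), (4, -9), (6, -252), (9, -4), (12, 28), (18, 9), (36, -1)])
    ∧ Evaluates 3 1 (4573 / (19920 * √35) * Real.pi ^ 3)
        (⟨7/5, 2, -315/166⟩ ::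
          (block 35 1 (1/664) [(1, 4), (2, -9), (4, 1)]
          ++ block (7/5) 1 (5/664) [(3, -4), (4, 28), (6, 9), (12, -1)]
          ++ block (5/7) 1 (-7/664) [(3, -4), (4, 28), (6, 9), (12, -1)]))
    -- discriminant -7, merit 36/7
    ∧ Evaluates 3 73 (15 / (2 * √7) * Real.pi ^ 3)
        ([⟨1/7, 6, -175⟩, ⟨1/7, 12, 21⟩, ⟨7, 4/3, -27⟩]
          ++ block 7 1 1 [(1, -12), (2, 40), (3, -12), (4, -3), (6, 25), (12, -3)])
    -- discriminant -23, merit 144/23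
    ∧ Evaluates 3 1 (93 / (500 * √23) * Real.pi ^ 3)
        (⟨1/23, 12, -23/25⟩ :: block 23 (1/3) (1/25)
          [(2, -72), (3, -60), (4, 9), (6, 114), (9, 4), (12, -15), (18, -8), (36, 1)])
    -- discriminant -4, merit 144/25
    ∧ Evaluates 5 (2639795 / 74) (12075457 / 99900 * Real.pi ^ 5)
        ([⟨1, 12/5, 5 ^ 4⟩, ⟨1, 4, -3050976/37⟩, ⟨1, 6, 2 ^ 5 * 389⟩]
          ++ block 1 (5/3) 1
            [(2, -3 ^ 4 * 37), (4, 3 ^ 4), (6, 2 ^ 4 * 61), (9, 2 ^ 4), (18, -37), (36, 1)])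
    -- discriminant -3, merits 25/3 and 49/3
    ∧ Evaluates 7 970 (3029 * √3 / 16200 * Real.pi ^ 7)
        (⟨3, 2, -(29 * 449) / 7⟩ :: block (1/3) 5 (43 / (2 ^ 7 * 7))
          [(1, 12 ^ 3), (2, -3 ^ 3 * 129), (3, -64), (4, 27), (6, 129), (12, -1)])
    ∧ Evaluates 7 44071 (5734 * √3 / 675 * Real.pi ^ 7)
        (block (1/3) 1 (1 / 2 ^ 7)
          [(7, 443 * 12 ^ 3), (9, 10545024), (14, -1542969), (18, -21254814), (21, -28352),
           (28, 11961), (36, 164766), (42, 57147), (84, -443)]))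
    -- the infinite families
    ∧ (IsFamily {n | ¬ 3 ∣ n} (fun n => 2 * n + 1) 3 (16/3)
        (fun n => 2 ^ (2 * n + 1) - (-3) ^ n) famH
    ∧ IsFamily {n | 1 ≤ n} (fun n => 6 * n + 1) 3 (16/3) sSeq famHSix
    ∧ IsFamily {n | 1 ≤ n} (fun n => 2 * n + 1) 2 (9/2) tSeq famG
    ∧ IsFamily {n | 1 ≤ n} (fun n => 2 * n + 1) 5 5 uSeq famI
    ∧ IsFamily {n | 1 ≤ n} (fun n => 2 * n + 1) 5 (36/5) uTildeSeq famITilde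
    ∧ IsFamily {n | 1 ≤ n} (fun n => 2 * n + 1) 11 (44/9) (fun n => 45 / 2 * vSeq n) famF
    ∧ IsFamily {n | 1 ≤ n} (fun n => 2 * n + 1) 11 (400/99) vTildeSeq famFTilde
    ∧ IsFamily {n | 1 ≤ n} (fun n => 2 * n + 1) 35 (144/35) (fun n => 3 / 2 * wSeq n) famW
    ∧ IsFamily {n | 1 ≤ n} (fun n => 2 * n + 1) 35 (28/5) (fun n => 2 * wTildeSeq n) famWTilde
    ∧ IsFamily {n | 1 ≤ n} (fun n => 2 * n + 1) 7 (36/7) sevenSeq famSeven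
    ∧ IsFamily {n | 1 ≤ n} (fun n => 2 * n + 1) 23 (144/23) xSeq famX
    ∧ IsFamily {n | 1 ≤ n} (fun n => 4 * n + 1) 1 (144/25) (fun n => 1 / 2 * cTildeSeq n) famC
    ∧ IsFamily {n | 1 ≤ n} (fun n => 6 * n + 1) 3 (25/3) (fun n => 42 * ySeq n) famY
    ∧ IsFamily {n | 1 ≤ n} (fun n => 6 * n + 1) 3 (49/3) (fun n => 10 * zSeq n) famZ)
    -- the denominator sequences
    ∧ ((∀ n : ℕ, ¬ 3 ∣ n →
        (((2 : ℚ) / (2 ^ (2 * n + 1) - (-3) ^ n)).den : ℤ) = 2 ^ (2 * n + 1) - (-3) ^ n)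
    ∧ IsIntegerSequence sSeq [6601, 20377357, 95065741729]
    ∧ IsIntegerSequence tSeq [55, 571, -3557, -1277, 1212475, -4016045, -82965653]
    ∧ IsIntegerSequence uSeq [20, 113, 980, 10793, 86360, 774053, 7471820, 62858993]
    ∧ IsIntegerSequence uTildeSeq [790, 107111, 20593510, 3025683569, 511718343910]
    ∧ IsIntegerSequence vSeq [1, 29, 993, 38293, 1329305, 48535917, 1740077137]
    ∧ IsIntegerSequence vTildeSeq [262, 449966, 461557057, 195425426366]
    ∧ IsIntegerSequence wSeq [16, 5096, -140379, -12384944, 774803876, 34673015481]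
    ∧ IsIntegerSequence wTildeSeq [332, 45583, 8942693, 1562702887, 284184726617]
    ∧ IsIntegerSequence xSeq [25, 85132, -50570780, 66436773424, -39027031565300]
    ∧ IsIntegerSequence cTildeSeq [2639795, 598022567345, 123944841925119215]
    ∧ IsIntegerSequence ySeq [970, 14460979, 227188159336, 3547683233832985]
    ∧ IsIntegerSequence zSeq [44071, 4786291978, 571088556271897])
    -- recurrences and divisibility
    ∧ (ObeysRecurrence sSeq 4 ∧ sSeq 0 = 0 ∧ (∀ n, ∃ z : ℤ, sSeq n = 7 * z)
    ∧ ObeysRecurrence uTildeSeq 12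
    ∧ ObeysRecurrence vTildeSeq 17
    ∧ ObeysRecurrence cTildeSeq 16 ∧ cTildeSeq 0 = 0
    ∧ (∀ n, ∃ z : ℤ, cTildeSeq n = 5 * z)) := by
  exact ⟨⟨evaluates_three_disc_three, evaluates_five_disc_three, evaluates_seven_disc_three,
    evaluates_three_disc_eight, evaluates_five_disc_eight, evaluates_three_disc_twenty,
    evaluates_five_disc_twenty, evaluates_three_disc_twenty', evaluates_three_disc_eleven,
    evaluates_three_disc_eleven', evaluates_three_disc_thirty_five,
    evaluates_three_disc_thirty_five', evaluates_three_disc_seven,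
    evaluates_three_disc_twenty_three, evaluates_five_disc_four, evaluates_seven_disc_three',
    evaluates_seven_disc_three''⟩,
    ⟨isFamily_famH, isFamily_famHSix, isFamily_famG, isFamily_famI, isFamily_famITilde,
    isFamily_famF, isFamily_famFTilde, isFamily_famW, isFamily_famWTilde, isFamily_famSeven,
    isFamily_famX, isFamily_famC, isFamily_famY, isFamily_famZ⟩,
    ⟨fun n _ => den_two_div n, isIntegerSequence_sSeq, isIntegerSequence_tSeq,
    isIntegerSequence_uSeq, isIntegerSequence_uTildeSeq, isIntegerSequence_vSeq,
    isIntegerSequence_vTildeSeq, isIntegerSequence_wSeq, isIntegerSequence_wTildeSeq,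
    isIntegerSequence_xSeq, isIntegerSequence_cTildeSeq, isIntegerSequence_ySeq,
    isIntegerSequence_zSeq⟩,
    obeysRecurrence_sSeq, sSeq_zero, exists_sSeq_eq_seven_mul, obeysRecurrence_uTildeSeq,
    obeysRecurrence_vTildeSeq, obeysRecurrence_cTildeSeq, cTildeSeq_zero,
    exists_cTildeSeq_eq_five_mul⟩
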